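/- **Theorem (MA-SOBA-q, expectation form).** *Problem.* Let $f(x,y)=\mathbb E_\xi[F(x,y;\xi)]$ and $g(x,y)=\mathbb E_\zeta[G(x,y;\zeta)]$ on $\mathbb R^{d_x}\times\mathbb R^{d_y}$ (Euclidean norm), where $F(\cdot;\xi)$ is differentiable and $G(\cdot;\zeta)$ is twice differentiable. Let $y^*(x)=\arg\min_y g(x,y)$ and $H(x)=f(x,y^*(x))$. Let $L^f,L_1^g,L_2^g\ge 0$ and $C^f,\mu,\sigma_f,\sigma_{g,1},\sigma_{g,2}>0$, and assume: 1. $f$ is differentiable, $\nabla f$ is $L^f$-Lipschitz, and $\|\nabla_2 f(x,y^*(x))\|\le C^f$ for all $x$; 2. $g$ is twice differentiable, $\nabla g$ is $L_1^g$-Lipschitz, $\nabla^2 g$ is $L_2^g$-Lipschitz, and $g(x,\cdot)$ is $\mu$-strongly convex for every $x$; 3. for all $(x,y)$: $\mathbb E\|\nabla F(x,y;\xi)-\nabla f(x,y)\|^2\le\sigma_f^2$, $\mathbb E\|\nabla G(x,y;\zeta)-\nabla g(x,y)\|^2\le\sigma_{g,1}^2$, $\mathbb E\|\nabla^2 G(x,y;\zeta)-\nabla^2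 g(x,y)\|^2\le\sigma_{g,2}^2$ (operator norm for Hessians); 4. $H$ is bounded below. *Algorithm MA-SOBA-q.* Given deterministic $(x_{-1},y_{-1},z_{-1})$, $(x_0,y_0,z_0)$, $v^x_{-1}$, a number $K>1$ of iterations, constant steps $\alpha,\beta,\gamma$ and momentum parameter $\rho$, and a mini-batch size $S$, draw for each $k\ge -1$ mini-batches $\mathcal S_1=\mathcal S_1^{(k)}$ of $S$ samples $\xi$ and $\mathcal S_2=\mathcal S_2^{(k)}$ of $S$ samples $\zeta$ (all samples independent), and denote by $F(\cdot;\mathcal S_1)$, $G(\cdot;\mathcal S_2)$ the averages of $F(\cdot;\xi)$, $G(\cdot;\zeta)$ over the mini-batch. With $D^x_k=\nabla_1F(x_k,y_k;\mathcal S_1)-\nabla^2_{12}G(x_k,y_k;\mathcal S_2)z_k$ for $k\ge-1$, put for $k=0,\dots,K-1$ $$v^x_k=(1-\rho)v^x_{k-1}+\rho D^x_{k-1},\qquad x_{k+1}=x_k-\alpha v^x_k,$$ $$y_{k+1}=y_k-\beta\nabla_2G(x_k,y_k;\mathcal S_2),\qquad z_{k+1}=z_k-\gamma\big(\nabla^2_{22}G(x_k,y_k;\mathcal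 S_2)z_k-\nabla_2F(x_k,y_k;\mathcal S_1)\big).$$ *Conclusion.* There are constants $c_\alpha,c_\beta,c_\gamma,c_\rho>0$, depending only on $L^f,L_1^g,L_2^g,C^f,\mu,\sigma_f,\sigma_{g,1},\sigma_{g,2}$, such that for every problem and every initialization as above $H$ is differentiable and there is $C>0$ (depending on the problem and the initialization, but not on $K,p,q,\varepsilon$) such that the following hold. (a) *Rate.* For all real $p,q\ge 0$ and all integers $K>1$, the iterates run with $\alpha=c_\alpha K^{-p}$, $\beta=c_\beta K^{-p}$, $\gamma=c_\gamma K^{-p}$, $\rho=c_\rho K^{-p}$ and $S=\lceil K^q\rceil$ satisfy $\mathbb E\|\nabla H(x_k)\|^2<\infty$ for $1\le k\le K$ and $$\frac1K\sum_{k=1}^K\mathbb E\|\nabla H(x_k)\|^2\le C\Big(\frac1{K^{1-p}}+\frac1{K^{p+q}}\Big).$$ (b) *Sample complexity.* If moreover $q+2p=1$, then for every $\varepsilon\in(0,1]$ there is $K>1$ such that, with the parameters of (a), $\frac1K\sum_{k=1}^K\mathbb E\|\nabla H(x_k)\|^2\le\varepsilon$ (so that a uniformly random iterate is an $\varepsilon$-stationary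 point), some iterate $x_k$ with $1\le k\le K$ satisfies $\mathbb E\|\nabla H(x_k)\|^2\le\varepsilon$, and the total number of evaluations of stochastic gradients and stochastic Hessian (Jacobian)-vector products in the whole run is at most $C\varepsilon^{-2}$. -/

import Mathlib

open MeasureTheory ProbabilityTheory
open scoped NNReal

namespace Bilevel

/-- `ℝ^d` with the Euclidean norm. -/
abbrev Vec (d : ℕ) : Type := EuclideanSpace ℝ (Fin d)

noncomputable section

/-- The product of two Euclidean spaces, with the Euclidean norm `‖(x, y)‖² = ‖x‖² + ‖y‖²`. -/
def Joint (X Y : Type*) : Type _ := WithLp 2 (X × Y)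

instance (X Y : Type*) [NormedAddCommGroup X] [NormedAddCommGroup Y] :
    NormedAddCommGroup (Joint X Y) :=
  inferInstanceAs (NormedAddCommGroup (WithLp 2 (X × Y)))

instance (X Y : Type*) [NormedAddCommGroup X] [InnerProductSpace ℝ X]
    [NormedAddCommGroup Y] [InnerProductSpace ℝ Y] : InnerProductSpace ℝ (Joint X Y) :=
  inferInstanceAs (InnerProductSpace ℝ (WithLp 2 (X × Y)))

instance (X Y : Type*) [NormedAddCommGroup X] [CompleteSpace X]
    [NormedAddCommGroup Y] [CompleteSpace Y] : CompleteSpace (Joint X Y) :=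
  inferInstanceAs (CompleteSpace (WithLp 2 (X × Y)))

/-- The point `(x, y)`. -/
def pt {X Y : Type*} (x : X) (y : Y) : Joint X Y := WithLp.toLp 2 (x, y)

/-- The component `x` of `(x, y)`. -/
def Joint.fst {X Y : Type*} (v : Joint X Y) : X := (WithLp.ofLp v).1

/-- The component `y` of `(x, y)`. -/
def Joint.snd {X Y : Type*} (v : Joint X Y) : Y := (WithLp.ofLp v).2

theorem norm_sq_pt {X Y : Type*} [NormedAddCommGroup X] [NormedAddCommGroup Y] (x : X) (y : Y) :
    ‖pt x y‖ ^ 2 = ‖x‖ ^ 2 + ‖y‖ ^ 2 :=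
  WithLp.prod_norm_sq_eq_of_L2 (WithLp.toLp 2 (x, y))

theorem inner_pt {X Y : Type*} [NormedAddCommGroup X] [InnerProductSpace ℝ X]
    [NormedAddCommGroup Y] [InnerProductSpace ℝ Y] (x x' : X) (y y' : Y) :
    inner ℝ (pt x y) (pt x' y') = inner ℝ x x' + inner ℝ y y' :=
  WithLp.prod_inner_apply (WithLp.toLp 2 (x, y)) (WithLp.toLp 2 (x', y'))

section

/-! The definitions are written for two Euclidean spaces `X` and `Y`; they are used for
`X = Vec dx` and `Y = Vec dy`. -/

variable {X Y : Type*} [NormedAddCommGroup X] [InnerProductSpace ℝ X] [CompleteSpace X]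
  [NormedAddCommGroup Y] [InnerProductSpace ℝ Y] [CompleteSpace Y]
  {Ξ Z : Type*} [MeasurableSpace Ξ] [MeasurableSpace Z]

/-! Derivatives of a function of `(x, y)`, as blocks of its gradient and of its Hessian. -/

/-- The Hessian `∇² h`, as the derivative of the gradient. -/
def hess (h : Joint X Y → ℝ) (v : Joint X Y) :
    Joint X Y →L[ℝ] Joint X Y :=
  fderiv ℝ (gradient h) v

/-- `∇₁ h (x, y)`. -/
def grad₁ (h : Joint X Y → ℝ) (v : Joint X Y) : X := (gradient h v).fst

/-- `∇₂ h (x, y)`. -/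
def grad₂ (h : Joint X Y → ℝ) (v : Joint X Y) : Y := (gradient h v).snd

/-- The Jacobian-vector product `∇²₁₂ h (x, y) z`. -/
def hess₁₂ (h : Joint X Y → ℝ) (v : Joint X Y) (z : Y) : X :=
  (hess h v (pt 0 z)).fst

/-- The Hessian-vector product `∇²₂₂ h (x, y) z`. -/
def hess₂₂ (h : Joint X Y → ℝ) (v : Joint X Y) (z : Y) : Y :=
  (hess h v (pt 0 z)).snd

/-- The data of a bilevel problem in expectation form: the laws of the samples `ξ` and `ζ`, and
the sample functions `F (x, y; ξ)` and `G (x, y; ζ)`. -/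
structure Problem (X Y Ξ Z : Type*) [MeasurableSpace Ξ] [MeasurableSpace Z] where
  lawF : Measure Ξ
  lawG : Measure Z
  F : Joint X Y → Ξ → ℝ
  G : Joint X Y → Z → ℝ

namespace Problem

/-- The upper-level objective `f (x, y) = E_ξ [F (x, y; ξ)]`. -/
def f (B : Problem X Y Ξ Z) (v : Joint X Y) : ℝ := ∫ s, B.F v s ∂B.lawF

/-- The lower-level objective `g (x, y) = E_ζ [G (x, y; ζ)]`. -/
def g (B : Problem X Y Ξ Z) (v : Joint X Y) : ℝ := ∫ s, B.G v s ∂B.lawG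

/-- The lower-level solution `y*(x) = argmin_y g (x, y)` (unique under strong convexity). -/
def yStar (B : Problem X Y Ξ Z) (x : X) : Y :=
  Classical.epsilon fun y => ∀ y', B.g (pt x y) ≤ B.g (pt x y')

/-- The hyper-objective `H (x) = f (x, y*(x))`. -/
def H (B : Problem X Y Ξ Z) (x : X) : ℝ := B.f (pt x (B.yStar x))

/-- The expectation form is meaningful: the sample spaces are probability spaces, the sample
functions are measurable and integrable in the sample, `F` has a gradient and `G` has a gradient
and a Hessian in `(x, y)`. -/
structure ExpectationForm (B : Problem X Y Ξ Z) : Prop where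
  probF : IsProbabilityMeasure B.lawF
  probG : IsProbabilityMeasure B.lawG
  measurable_F : ∀ v, Measurable (B.F v)
  measurable_G : ∀ v, Measurable (B.G v)
  integrable_F : ∀ v, Integrable (B.F v) B.lawF
  integrable_G : ∀ v, Integrable (B.G v) B.lawG
  differentiable_F : ∀ s, Differentiable ℝ fun v => B.F v s
  differentiable_G : ∀ s, Differentiable ℝ fun v => B.G v s
  differentiable_gradient_G : ∀ s, Differentiable ℝ (gradient fun v => B.G v s)

/-- Assumptions on the upper-level objective. -/
structure UpperLevel (B : Problem X Y Ξ Z) (Lf : ℝ≥0) (Cf : ℝ) : Prop where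
  differentiable : Differentiable ℝ B.f
  lipschitz_gradient : LipschitzWith Lf (gradient B.f)
  bound_grad₂ : ∀ x, ‖grad₂ B.f (pt x (B.yStar x))‖ ≤ Cf

/-- Assumptions on the lower-level objective. -/
structure LowerLevel (B : Problem X Y Ξ Z) (L1g L2g : ℝ≥0) (μ : ℝ) : Prop where
  differentiable : Differentiable ℝ B.g
  differentiable_gradient : Differentiable ℝ (gradient B.g)
  lipschitz_gradient : LipschitzWith L1g (gradient B.g)
  lipschitz_hess : LipschitzWith L2g (hess B.g)
  strongConvex : ∀ x, StrongConvexOn Set.univ μ fun y => B.g (pt x y)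

/-- Bounded variance of the stochastic gradients and Hessians (operator norm for Hessians). -/
structure BoundedVariance (B : Problem X Y Ξ Z) (σf σg1 σg2 : ℝ) : Prop where
  gradF : ∀ v,
    Integrable (fun s => ‖gradient (fun w => B.F w s) v - gradient B.f v‖ ^ 2) B.lawF ∧
    ∫ s, ‖gradient (fun w => B.F w s) v - gradient B.f v‖ ^ 2 ∂B.lawF ≤ σf ^ 2
  gradG : ∀ v,
    Integrable (fun s => ‖gradient (fun w => B.G w s) v - gradient B.g v‖ ^ 2) B.lawG ∧
    ∫ s, ‖gradient (fun w => B.G w s) v - gradient B.g v‖ ^ 2 ∂B.lawG ≤ σg1 ^ 2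
  hessG : ∀ v,
    Integrable (fun s => ‖hess (fun w => B.G w s) v - hess B.g v‖ ^ 2) B.lawG ∧
    ∫ s, ‖hess (fun w => B.G w s) v - hess B.g v‖ ^ 2 ∂B.lawG ≤ σg2 ^ 2

end Problem

/-! The algorithm MA-SOBA-q. -/

/-- The mini-batch average of `S` oracle answers, together with the number of oracle calls. -/
def miniBatch {E : Type*} [AddCommGroup E] [Module ℝ E] (S : ℕ) (φ : ℕ → E) : E × ℕ :=
  ((S : ℝ)⁻¹ • ∑ i ∈ Finset.range S, φ i, S)

/-- The initialization: `(x₋₁, y₋₁, z₋₁)`, `(x₀, y₀, z₀)` and `v₋₁ˣ`. -/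
structure Init (X Y : Type*) where
  xPrev : X
  yPrev : Y
  zPrev : Y
  x : X
  y : Y
  z : Y
  vPrev : X

/-- Step sizes `α, β, γ`, momentum parameter `ρ` (all constant in `k`) and mini-batch size. -/
structure Params where
  α : ℝ
  β : ℝ
  γ : ℝ
  ρ : ℝ
  batch : ℕ

/-- The state before iteration `k`: `x_k`, `y_k`, `z_k`, `v_{k-1}ˣ`, `D_{k-1}ˣ`, and the number of
calls made so far to stochastic gradients and Hessian (Jacobian)-vector products. -/
structure State (X Y : Type*) where
  x : X
  y : Y
  z : Y
  v : X
  D : X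
  calls : ℕ

/-- The stochastic direction
`Dˣ = ∇₁F (x, y; S₁) - ∇²₁₂G (x, y; S₂) z`, with its number of oracle calls. -/
def dirX (B : Problem X Y Ξ Z) (S : ℕ) (ξ : ℕ → Ξ) (ζ : ℕ → Z)
    (x : X) (y z : Y) : X × ℕ :=
  let a := miniBatch S fun i => grad₁ (fun w => B.F w (ξ i)) (pt x y)
  let b := miniBatch S fun i => hess₁₂ (fun w => B.G w (ζ i)) (pt x y) z
  (a.1 - b.1, a.2 + b.2)

/-- The stochastic direction `vʸ = ∇₂G (x, y; S₂)`, with its number of oracle calls. -/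
def dirY (B : Problem X Y Ξ Z) (S : ℕ) (ζ : ℕ → Z) (x : X) (y : Y) : Y × ℕ :=
  miniBatch S fun i => grad₂ (fun w => B.G w (ζ i)) (pt x y)

/-- The stochastic direction
`vᶻ = ∇²₂₂G (x, y; S₂) z - ∇₂F (x, y; S₁)`, with its number of oracle calls. -/
def dirZ (B : Problem X Y Ξ Z) (S : ℕ) (ξ : ℕ → Ξ) (ζ : ℕ → Z)
    (x : X) (y z : Y) : Y × ℕ :=
  let a := miniBatch S fun i => hess₂₂ (fun w => B.G w (ζ i)) (pt x y) z
  let b := miniBatch S fun i => grad₂ (fun w => B.F w (ξ i)) (pt x y)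
  (a.1 - b.1, a.2 + b.2)

/-- The state before iteration `0`; the samples given here are those used in `D₋₁ˣ`. -/
def initState (B : Problem X Y Ξ Z) (θ : Params) (I : Init X Y) (ξ : ℕ → Ξ) (ζ : ℕ → Z) :
    State X Y :=
  let D := dirX B θ.batch ξ ζ I.xPrev I.yPrev I.zPrev
  { x := I.x, y := I.y, z := I.z, v := I.vPrev, D := D.1, calls := D.2 }

/-- One iteration, with the samples of its two mini-batches. -/
def step (B : Problem X Y Ξ Z) (θ : Params) (ξ : ℕ → Ξ) (ζ : ℕ → Z) (s : State X Y) :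
    State X Y :=
  let v := (1 - θ.ρ) • s.v + θ.ρ • s.D
  let D := dirX B θ.batch ξ ζ s.x s.y s.z
  let vy := dirY B θ.batch ζ s.x s.y
  let vz := dirZ B θ.batch ξ ζ s.x s.y s.z
  { x := s.x - θ.α • v
    y := s.y - θ.β • vy.1
    z := s.z - θ.γ • vz.1
    v := v
    D := D.1
    calls := s.calls + D.2 + vy.2 + vz.2 }

/-- The state after `k` iterations. The samples `ξ j i`, `ζ j i` with `i < batch` form the
mini-batches of iteration `j - 1`; the ones with `j = 0` are used in `D₋₁ˣ`. -/
def run (B : Problem X Y Ξ Z) (θ : Params) (I : Init X Y) (ξ : ℕ → ℕ → Ξ) (ζ : ℕ → ℕ → Z) :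
    ℕ → State X Y
  | 0 => initState B θ I (ξ 0) (ζ 0)
  | k + 1 => step B θ (ξ (k + 1)) (ζ (k + 1)) (run B θ I ξ ζ k)

/-- All samples `ξ j i` and `ζ j i` are independent, `ξ j i` with law `lawF` and `ζ j i` with law
`lawG`. -/
structure IIDSamples (B : Problem X Y Ξ Z) {Ω : Type*} [MeasurableSpace Ω] (P : Measure Ω)
    (ξ : ℕ → ℕ → Ω → Ξ) (ζ : ℕ → ℕ → Ω → Z) : Prop where
  measurable_ξ : ∀ j i, Measurable (ξ j i)
  measurable_ζ : ∀ j i, Measurable (ζ j i)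
  map_eq : ∀ j i, P.map (fun ω => (ξ j i ω, ζ j i ω)) = B.lawF.prod B.lawG
  indep : iIndepFun (fun (a : ℕ × ℕ) ω => (ξ a.1 a.2 ω, ζ a.1 a.2 ω)) P

/-- The random iterate `x_k`. -/
def iterate (B : Problem X Y Ξ Z) (θ : Params) (I : Init X Y) {Ω : Type*}
    (ξ : ℕ → ℕ → Ω → Ξ) (ζ : ℕ → ℕ → Ω → Z) (k : ℕ) (ω : Ω) : X :=
  (run B θ I (fun j i => ξ j i ω) (fun j i => ζ j i ω) k).x

/-- The number of oracle calls in a run of `K` iterations. -/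
def oracleCalls (B : Problem X Y Ξ Z) (θ : Params) (I : Init X Y) {Ω : Type*}
    (ξ : ℕ → ℕ → Ω → Ξ) (ζ : ℕ → ℕ → Ω → Z) (K : ℕ) (ω : Ω) : ℕ :=
  (run B θ I (fun j i => ξ j i ω) (fun j i => ζ j i ω) K).calls

/-- The average `(1/K) ∑_{k=1}^K E ‖∇H (x_k)‖²`. -/
def avgSqGrad (B : Problem X Y Ξ Z) (θ : Params) (I : Init X Y) {Ω : Type*}
    [MeasurableSpace Ω] (P : Measure Ω) (ξ : ℕ → ℕ → Ω → Ξ) (ζ : ℕ → ℕ → Ω → Z) (K : ℕ) : ℝ :=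
  (1 / (K : ℝ)) * ∑ k ∈ Finset.Icc 1 K, ∫ ω, ‖gradient B.H (iterate B θ I ξ ζ k ω)‖ ^ 2 ∂P

/-- The random point `x` is `ε`-stationary: `E ‖∇H (x)‖² ≤ ε`. -/
def IsStationary (B : Problem X Y Ξ Z) {Ω : Type*} [MeasurableSpace Ω] (P : Measure Ω)
    (ε : ℝ) (x : Ω → X) : Prop :=
  Integrable (fun ω => ‖gradient B.H (x ω)‖ ^ 2) P ∧ ∫ ω, ‖gradient B.H (x ω)‖ ^ 2 ∂P ≤ ε

/-- The parameters `α = cα K^{-p}`, `β = cβ K^{-p}`, `γ = cγ K^{-p}`, `ρ = cρ K^{-p}` and the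
mini-batch size `K^q`, rounded up to an integer. -/
def params (cα cβ cγ cρ p q : ℝ) (K : ℕ) : Params where
  α := cα * (K : ℝ) ^ (-p)
  β := cβ * (K : ℝ) ^ (-p)
  γ := cγ * (K : ℝ) ^ (-p)
  ρ := cρ * (K : ℝ) ^ (-p)
  batch := ⌈(K : ℝ) ^ q⌉₊

end

end

end Bilevel

set_option linter.unusedSectionVars false

/-! The proof is a descent argument for one Lyapunov function that couples the four quantities of
the method. With `u = (1 - ρ) v_{k-1} + ρ D_{k-1}`, which is the direction `v_k` about to be used,
it is `H(x) - h₀ + a‖y - y*(x)‖² + b‖z - z*(x)‖² + c‖u - ∇H(x)‖²`, where `z*(x)` solves `∇²₂₂g z =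
∇₂f` at `(x, y*(x))` and `∇H = ∇₁f - ∇²₁₂g z*` there.

Because `D` enters with a delay, the next `x` is a function of the current state, so conditionally
on the state the descent inequality for `H` has no noise. It yields `-α/2‖∇H‖² - α/2‖u‖² + α/2‖u -
∇H‖²` up to `Qα²‖u‖²`. The `y`-error contracts by strong convexity. The `z`-error contracts up to a
multiple of the `y`-error. The momentum error contracts at rate `ρ` up to the bias of `D`, which is
controlled by the `y`- and `z`-errors. The drift of `y*`, `z*` and `∇H` costs multiples of `‖x_{k+1}
- x_k‖² = α²‖u‖²`, paid by `-α/2‖u‖²`. If all steps are proportional to `t = K^{-p}`, every gain and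
loss has order `t`, so fixed weights `a, b, c` work for all `t ≤ 1` (`exists_stepSizes`), and what
remains is noise of order `t²/S` (`lyapunov_step`). Summation gives `t ∑ E‖∇H‖² ≲ 1 + K t²/S`, which
is the rate. For `q + 2p = 1` the two terms of the rate coincide and the cost `K^{1+q}` is the
square of `K^{1-p}`.

Three further points need care. `H` is differentiated through a direct quadratic expansion, without
differentiating `y*` (`abs_H_sub_sub_inner_le`). Unbiasedness of the stochastic derivatives is not
assumed; it follows from the uniform variance bounds, which make difference quotients bounded in
`L²` (`integral_deriv_eq`). The noise of a Hessian-vector product grows with `‖z‖`, and `z_k` is not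
bounded a priori; the growing part is absorbed by the contraction (`variance_le`, `step_z`). -/

namespace Bilevel

open Filter Topology

noncomputable section

/-! ### Algebra and norms of the Euclidean product. -/

section Joint

variable {X Y : Type*} [NormedAddCommGroup X] [InnerProductSpace ℝ X]
  [NormedAddCommGroup Y] [InnerProductSpace ℝ Y]

instance [FiniteDimensional ℝ X] [FiniteDimensional ℝ Y] : FiniteDimensional ℝ (Joint X Y) :=
  inferInstanceAs (FiniteDimensional ℝ (WithLp 2 (X × Y)))

instance : MeasurableSpace (Joint X Y) := borel _

instance : BorelSpace (Joint X Y) := ⟨rfl⟩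

/-- The projection `(x, y) ↦ x` as a continuous linear map. -/
def Joint.fstL : Joint X Y →L[ℝ] X := (WithLp.fstL 2 ℝ X Y :)

/-- The projection `(x, y) ↦ y` as a continuous linear map. -/
def Joint.sndL : Joint X Y →L[ℝ] Y := (WithLp.sndL 2 ℝ X Y :)

theorem Joint.sndL_apply (v : Joint X Y) : Joint.sndL v = v.snd := rfl

@[simp] theorem fst_pt (x : X) (y : Y) : (pt x y).fst = x := rfl

@[simp] theorem snd_pt (x : X) (y : Y) : (pt x y).snd = y := rfl

theorem pt_fst_snd (v : Joint X Y) : pt v.fst v.snd = v := rfl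

theorem Joint.snd_sub (v w : Joint X Y) : (v - w).snd = v.snd - w.snd := rfl

theorem pt_sub (x x' : X) (y y' : Y) : pt x y - pt x' y' = pt (x - x') (y - y') := rfl

theorem pt_add (x x' : X) (y y' : Y) : pt x y + pt x' y' = pt (x + x') (y + y') := rfl

theorem pt_smul (c : ℝ) (x : X) (y : Y) : c • pt x y = pt (c • x) (c • y) := rfl

theorem norm_sq_fst_add_snd (v : Joint X Y) : ‖v‖ ^ 2 = ‖v.fst‖ ^ 2 + ‖v.snd‖ ^ 2 := by
  rw [← norm_sq_pt, pt_fst_snd]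

theorem norm_fst_le (v : Joint X Y) : ‖v.fst‖ ≤ ‖v‖ := by
  refine abs_le_of_sq_le_sq' ?_ (norm_nonneg _) |>.2
  rw [norm_sq_fst_add_snd]; nlinarith [sq_nonneg ‖v.snd‖]

theorem norm_snd_le (v : Joint X Y) : ‖v.snd‖ ≤ ‖v‖ := by
  refine abs_le_of_sq_le_sq' ?_ (norm_nonneg _) |>.2
  rw [norm_sq_fst_add_snd]; nlinarith [sq_nonneg ‖v.fst‖]

theorem norm_pt_le (x : X) (y : Y) : ‖pt x y‖ ≤ ‖x‖ + ‖y‖ := by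
  refine abs_le_of_sq_le_sq' ?_ (by positivity) |>.2
  rw [norm_sq_pt]; nlinarith [norm_nonneg x, norm_nonneg y]

@[simp] theorem norm_pt_zero_left (y : Y) : ‖pt (0 : X) y‖ = ‖y‖ := by
  rw [← sq_eq_sq₀ (norm_nonneg _) (norm_nonneg _), norm_sq_pt]; simp

@[simp] theorem norm_pt_zero_right (x : X) : ‖pt x (0 : Y)‖ = ‖x‖ := by
  rw [← sq_eq_sq₀ (norm_nonneg _) (norm_nonneg _), norm_sq_pt]; simp

theorem inner_fst_add_snd (v w : Joint X Y) :
    inner ℝ v w = inner ℝ v.fst w.fst + inner ℝ v.snd w.snd := by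
  rw [← inner_pt, pt_fst_snd, pt_fst_snd]

theorem inner_pt_zero_left (v : Joint X Y) (w : Y) :
    inner ℝ v (pt 0 w) = inner ℝ v.snd w := by
  rw [inner_fst_add_snd]; simp

theorem continuous_pt : Continuous fun p : X × Y => pt p.1 p.2 :=
  (WithLp.prodContinuousLinearEquiv 2 ℝ X Y).symm.continuous

end Joint

/-! ### Gradients, symmetry of the Hessian, first-order expansions. -/

section Gradient

variable {E : Type*} [NormedAddCommGroup E] [InnerProductSpace ℝ E] [CompleteSpace E]

/-- The derivative of `h` along a line, in terms of its gradient. -/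
theorem hasDerivAt_line {h : E → ℝ} (hd : Differentiable ℝ h) (v w : E) (t : ℝ) :
    HasDerivAt (fun t : ℝ => h (v + t • w)) (inner ℝ (gradient h (v + t • w)) w) t := by
  have h1 : HasDerivAt (fun t : ℝ => v + t • w) w t := by
    simpa using ((hasDerivAt_id t).smul_const w).const_add v
  have := (hd (v + t • w)).hasFDerivAt.comp_hasDerivAt t h1
  rwa [inner_gradient_left]

/-- The Hessian is symmetric. -/
theorem inner_fderiv_gradient_comm {h : E → ℝ} (hd : Differentiable ℝ h)
    (hd' : Differentiable ℝ (gradient h)) (v a b : E) :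
    inner ℝ (fderiv ℝ (gradient h) v a) b = inner ℝ a (fderiv ℝ (gradient h) v b) := by
  have h1 : ∀ y, HasFDerivAt h (InnerProductSpace.toDual ℝ E (gradient h y)) y := fun y =>
    (hd y).hasGradientAt.hasFDerivAt
  have h2 : HasFDerivAt (fun y => InnerProductSpace.toDual ℝ E (gradient h y))
      ((InnerProductSpace.toDual ℝ E).toContinuousLinearEquiv.toContinuousLinearMap.comp
        (fderiv ℝ (gradient h) v)) v :=
    (InnerProductSpace.toDual ℝ E).toContinuousLinearEquiv.toContinuousLinearMap.hasFDerivAt.comp v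
      (hd' v).hasFDerivAt
  have h3 := second_derivative_symmetric h1 h2 a b
  simp at h3
  rw [h3, real_inner_comm]

/-- A function with `L`-Lipschitz derivative is quadratically close to its linearization. -/
theorem norm_sub_sub_fderiv_le {F : Type*} [NormedAddCommGroup F] [NormedSpace ℝ F] {φ : E → F}
    (hd : Differentiable ℝ φ) {L : ℝ}
    (hL : ∀ v w, ‖fderiv ℝ φ v - fderiv ℝ φ w‖ ≤ L * ‖v - w‖) (hL0 : 0 ≤ L) (v w : E) :
    ‖φ w - φ v - fderiv ℝ φ v (w - v)‖ ≤ L * ‖w - v‖ ^ 2 := by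
  -- The mean value inequality for `φ` minus its linear part loses the factor `1/2` of Taylor's
  -- formula; only the quadratic order matters later.
  have := (convex_segment v w).norm_image_sub_le_of_norm_hasFDerivWithin_le' (f := φ)
    (f' := fderiv ℝ φ) (φ := fderiv ℝ φ v) (C := L * ‖w - v‖)
    (fun x _ => (hd x).hasFDerivAt.hasFDerivWithinAt) (fun x hx => ?_) (left_mem_segment ℝ v w)
    (right_mem_segment ℝ v w)
  · rwa [mul_assoc, ← sq] at this
  · refine (hL x v).trans (mul_le_mul_of_nonneg_left ?_ hL0)
    obtain ⟨t, ⟨h0, h1⟩, rfl⟩ := (segment_eq_image' ℝ v w ▸ hx)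
    simp only [add_sub_cancel_left, norm_smul, Real.norm_eq_abs, abs_of_nonneg h0]
    exact mul_le_of_le_one_left (norm_nonneg _) h1

/-- A function with Lipschitz gradient is quadratically close to its linearization. -/
theorem abs_sub_sub_inner_gradient_le {φ : E → ℝ} (hd : Differentiable ℝ φ) {L : ℝ≥0}
    (hL : LipschitzWith L (gradient φ)) (v w : E) :
    |φ w - φ v - inner ℝ (gradient φ v) (w - v)| ≤ L * ‖w - v‖ ^ 2 := by
  have := norm_sub_sub_fderiv_le (L := L) hd (fun v w => ?_) L.2 v w
  · rwa [inner_gradient_left, ← Real.norm_eq_abs]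
  · rw [← toDual_gradient, ← toDual_gradient, ← map_sub, LinearIsometryEquiv.norm_map]
    exact hL.norm_sub_le v w

end Gradient

/-! ### Lower-level solution, adjoint variable and hypergradient. -/

section Deterministic

variable {X Y : Type*} [NormedAddCommGroup X] [InnerProductSpace ℝ X] [CompleteSpace X]
  [NormedAddCommGroup Y] [InnerProductSpace ℝ Y] [CompleteSpace Y]
  {Ξ Z : Type*} [MeasurableSpace Ξ] [MeasurableSpace Z]
  {B : Problem X Y Ξ Z} {Lf L1g L2g : ℝ≥0} {Cf μ : ℝ}

namespace Problem

variable (hU : B.UpperLevel Lf Cf) (hL : B.LowerLevel L1g L2g μ)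

include hL in
-- Strong convexity on the segment from `y` to `y'` bounds the slope at parameter `t` by an
-- expression continuous in `t`; let `t → 0+`.
theorem LowerLevel.first_order (x : X) (y y' : Y) :
    B.g (pt x y) + inner ℝ (grad₂ B.g (pt x y)) (y' - y) + μ / 2 * ‖y' - y‖ ^ 2
      ≤ B.g (pt x y') := by
  have h1 := hasDerivAt_line hL.differentiable (pt x y) (pt 0 (y' - y)) 0
  have h2 := hasDerivWithinAt_iff_tendsto_slope.1 (h1.hasDerivWithinAt (s := Set.Ioi 0))
  simp only [zero_smul, add_zero, inner_pt_zero_left] at h2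
  have hs : Set.Ioi (0 : ℝ) \ {0} = Set.Ioi 0 := by ext; simp
  rw [hs] at h2
  have h3 : Tendsto (fun t : ℝ => B.g (pt x y') - B.g (pt x y) - (1 - t) * (μ / 2 * ‖y' - y‖ ^ 2))
      (𝓝[>] 0) (𝓝 (B.g (pt x y') - B.g (pt x y) - (1 - 0) * (μ / 2 * ‖y' - y‖ ^ 2))) := by
    refine Tendsto.mono_left (Continuous.tendsto ?_ 0) nhdsWithin_le_nhds
    fun_prop
  have h4 : ∀ᶠ t in 𝓝[>] (0 : ℝ),
      slope (fun t : ℝ => B.g (pt x y + t • pt 0 (y' - y))) 0 t ≤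
      B.g (pt x y') - B.g (pt x y) - (1 - t) * (μ / 2 * ‖y' - y‖ ^ 2) := by
    filter_upwards [Ioo_mem_nhdsGT (zero_lt_one' ℝ)] with t ht
    have hc := (hL.strongConvex x).2 (Set.mem_univ y') (Set.mem_univ y) ht.1.le
      (sub_nonneg.2 ht.2.le) (by ring)
    have he : t • y' + (1 - t) • y = y + t • (y' - y) := by module
    simp only [smul_eq_mul, he] at hc
    rw [slope_def_field, div_le_iff₀ (by simpa using ht.1)]
    simp only [zero_smul, add_zero, pt_smul, pt_add, smul_zero, sub_zero]
    linarith
  have := le_of_tendsto_of_tendsto h2 h3 h4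
  change inner ℝ (grad₂ B.g (pt x y)) (y' - y) ≤ _ at this
  linarith

include hL in
theorem LowerLevel.strong_monotone (x : X) (y y' : Y) :
    μ * ‖y' - y‖ ^ 2 ≤ inner ℝ (grad₂ B.g (pt x y') - grad₂ B.g (pt x y)) (y' - y) := by
  have h1 := hL.first_order x y y'
  have h2 := hL.first_order x y' y
  rw [← neg_sub y' y, inner_neg_right, norm_neg] at h2
  rw [inner_sub_left]
  linarith

include hL in
theorem LowerLevel.norm_grad₂_sub_le (v w : Joint X Y) :
    ‖grad₂ B.g v - grad₂ B.g w‖ ≤ L1g * ‖v - w‖ :=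
  (norm_snd_le (gradient B.g v - gradient B.g w)).trans (hL.lipschitz_gradient.norm_sub_le v w)

include hL in
-- The first-order bound at `y = 0` forces quadratic growth, so `g(x, ·)` is continuous and
-- coercive. This makes the choice in `yStar` meaningful.
theorem LowerLevel.exists_min [FiniteDimensional ℝ Y] (hμ : 0 < μ) (x : X) :
    ∃ y, ∀ y', B.g (pt x y) ≤ B.g (pt x y') := by
  have hc : Continuous fun y => B.g (pt x y) :=
    hL.differentiable.continuous.comp
      (continuous_pt.comp (by fun_prop : Continuous fun y : Y => (x, y)))
  refine hc.exists_forall_le ?_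
  have h1 : Tendsto (fun y : Y => ‖y‖) (cocompact Y) atTop := tendsto_norm_cocompact_atTop
  have h2 : Tendsto (fun r : ℝ => B.g (pt x 0) + r * (μ / 2 * r - ‖grad₂ B.g (pt x 0)‖))
      atTop atTop := by
    refine tendsto_atTop_add_const_left _ _ (tendsto_id.atTop_mul_atTop₀ ?_)
    exact tendsto_atTop_add_const_right _ _ (tendsto_id.const_mul_atTop (by positivity))
  refine tendsto_atTop_mono (fun y => ?_) (h2.comp h1)
  have := hL.first_order x 0 y
  have h3 := neg_le_of_abs_le (abs_real_inner_le_norm (grad₂ B.g (pt x 0)) y)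
  simp only [sub_zero] at this
  simp only [Function.comp]
  nlinarith

variable [FiniteDimensional ℝ Y] (hμ : 0 < μ)

include hL hμ

theorem LowerLevel.yStar_le (x : X) (y : Y) : B.g (pt x (B.yStar x)) ≤ B.g (pt x y) :=
  Classical.epsilon_spec (hL.exists_min hμ x) y

theorem LowerLevel.grad₂_yStar (x : X) : grad₂ B.g (pt x (B.yStar x)) = 0 := by
  have h0 : ∀ w, inner ℝ (grad₂ B.g (pt x (B.yStar x))) w = 0 := fun w => by
    have h1 := hasDerivAt_line hL.differentiable (pt x (B.yStar x)) (pt 0 w) 0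
    have h2 : IsLocalMin (fun t : ℝ => B.g (pt x (B.yStar x) + t • pt 0 w)) 0 :=
      Filter.Eventually.of_forall fun t => by
        simp only [zero_smul, add_zero, pt_smul, pt_add, smul_zero]
        exact hL.yStar_le hμ x _
    have := h2.hasDerivAt_eq_zero h1
    rw [zero_smul, add_zero, inner_pt_zero_left] at this
    exact this
  exact inner_self_eq_zero.1 (h0 _)

/-- Apply strong monotonicity of `∇₂g(x, ·)` to the two solutions. Since `∇₂g` vanishes at `(x,
y*(x))` and at `(x', y*(x'))`, the first can be replaced by the second, and the difference left over
is a change of `x` alone. -/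
theorem LowerLevel.norm_yStar_sub_le (x x' : X) :
    ‖B.yStar x - B.yStar x'‖ ≤ L1g / μ * ‖x - x'‖ := by
  set d := ‖B.yStar x - B.yStar x'‖
  have h1 := hL.strong_monotone x (B.yStar x') (B.yStar x)
  have h2 : grad₂ B.g (pt x (B.yStar x)) - grad₂ B.g (pt x (B.yStar x'))
      = grad₂ B.g (pt x' (B.yStar x')) - grad₂ B.g (pt x (B.yStar x')) := by
    rw [hL.grad₂_yStar hμ, hL.grad₂_yStar hμ]
  have h3 := hL.norm_grad₂_sub_le (pt x' (B.yStar x')) (pt x (B.yStar x'))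
  rw [pt_sub, sub_self, norm_pt_zero_right, norm_sub_rev] at h3
  rw [h2] at h1
  have h4 := real_inner_le_norm (grad₂ B.g (pt x' (B.yStar x')) - grad₂ B.g (pt x (B.yStar x')))
    (B.yStar x - B.yStar x')
  rw [div_mul_eq_mul_div, le_div_iff₀ hμ]
  change d * μ ≤ _
  have h5 : μ * d ^ 2 ≤ L1g * ‖x - x'‖ * d :=
    h1.trans (h4.trans (mul_le_mul_of_nonneg_right
      (by rwa [norm_sub_rev, norm_sub_rev x x']) (norm_nonneg _)))
  rcases (norm_nonneg _ : 0 ≤ d).eq_or_lt with h | h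
  · rw [← show (0 : ℝ) = d from h, zero_mul]; positivity
  · nlinarith

omit [FiniteDimensional ℝ Y] hμ in
theorem LowerLevel.hess_symm (v a b : Joint X Y) :
    inner ℝ (hess B.g v a) b = inner ℝ a (hess B.g v b) :=
  inner_fderiv_gradient_comm hL.differentiable hL.differentiable_gradient v a b

omit [FiniteDimensional ℝ Y] hμ in
-- Strong monotonicity for the increment `t • w`, divided by `t²`, in the limit `t → 0+`.
theorem LowerLevel.hess₂₂_coercive (v : Joint X Y) (w : Y) :
    μ * ‖w‖ ^ 2 ≤ inner ℝ (hess₂₂ B.g v w) w := by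
  have h1 : HasDerivAt (fun t : ℝ => v + t • pt (0 : X) w) (pt 0 w) 0 := by
    simpa using ((hasDerivAt_id (0 : ℝ)).smul_const (pt (0 : X) w)).const_add v
  have h1' : HasFDerivAt (gradient B.g) (hess B.g v) (v + (0 : ℝ) • pt (0 : X) w) := by
    rw [zero_smul, add_zero]
    exact (hL.differentiable_gradient v).hasFDerivAt
  have h2 := (Joint.sndL (X := X) (Y := Y)).hasFDerivAt.comp_hasDerivAt (0 : ℝ)
    (h1'.comp_hasDerivAt 0 h1)
  have h3 := hasDerivWithinAt_iff_tendsto_slope.1 (h2.hasDerivWithinAt (s := Set.Ioi 0))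
  have hs : Set.Ioi (0 : ℝ) \ {0} = Set.Ioi 0 := by ext; simp
  rw [hs] at h3
  have h4 := h3.inner (tendsto_const_nhds (x := w)) (𝕜 := ℝ)
  refine ge_of_tendsto h4 ?_
  filter_upwards [self_mem_nhdsWithin] with t ht
  have ht : 0 < t := ht
  have h5 := hL.strong_monotone v.fst v.snd (v.snd + t • w)
  have e1 : pt v.fst (v.snd + t • w) = v + t • pt (0 : X) w := by
    rw [pt_smul, smul_zero, ← pt_fst_snd v, pt_add]; simp
  rw [e1, pt_fst_snd, add_sub_cancel_left, norm_smul, inner_smul_right, mul_pow, Real.norm_eq_abs,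
    sq_abs] at h5
  simp only [slope, Function.comp, zero_smul, add_zero, sub_zero, Joint.sndL_apply, vsub_eq_sub]
  rw [inner_smul_left]
  simp only [conj_trivial]
  have h6 : t * (t * (μ * ‖w‖ ^ 2)) ≤ t * inner ℝ (grad₂ B.g (v + t • pt 0 w) - grad₂ B.g v) w := by
    linarith
  exact (le_inv_mul_iff₀ ht).2 (le_of_mul_le_mul_left h6 ht)

omit [FiniteDimensional ℝ Y] in
theorem LowerLevel.norm_le_hess₂₂ (v : Joint X Y) (w : Y) : μ * ‖w‖ ≤ ‖hess₂₂ B.g v w‖ := by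
  have h1 := hL.hess₂₂_coercive v w
  have h2 := real_inner_le_norm (hess₂₂ B.g v w) w
  rcases (norm_nonneg w).eq_or_lt with h | h
  · rw [← h]; simp
  · nlinarith

omit hL hμ [FiniteDimensional ℝ Y] in
theorem hess₂₂_eq (h : Joint X Y → ℝ) (v : Joint X Y) (z : Y) :
    hess₂₂ h v z = (Joint.sndL ∘L hess h v) (pt 0 z) := rfl

omit hL hμ [FiniteDimensional ℝ Y] in
theorem hess₁₂_eq (h : Joint X Y → ℝ) (v : Joint X Y) (z : Y) :
    hess₁₂ h v z = (Joint.fstL ∘L hess h v) (pt 0 z) := rfl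

omit hL hμ [FiniteDimensional ℝ Y] in
theorem hess₂₂_sub (h : Joint X Y → ℝ) (v : Joint X Y) (z z' : Y) :
    hess₂₂ h v (z - z') = hess₂₂ h v z - hess₂₂ h v z' := by
  simp only [hess₂₂_eq, ← map_sub, pt_sub, sub_zero]

omit hL hμ [FiniteDimensional ℝ Y] in
theorem hess₁₂_sub (h : Joint X Y → ℝ) (v : Joint X Y) (z z' : Y) :
    hess₁₂ h v (z - z') = hess₁₂ h v z - hess₁₂ h v z' := by
  simp only [hess₁₂_eq, ← map_sub, pt_sub, sub_zero]

omit hL hμ [FiniteDimensional ℝ Y] in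
theorem hess₂₂_add_smul (h : Joint X Y → ℝ) (v : Joint X Y) (z z' : Y) (c : ℝ) :
    hess₂₂ h v (z + c • z') = hess₂₂ h v z + c • hess₂₂ h v z' := by
  simp only [hess₂₂_eq, ← map_smul, ← map_add, pt_add, pt_smul, smul_zero, add_zero]

theorem LowerLevel.exists_zStar (v : Joint X Y) (b : Y) : ∃ z, hess₂₂ B.g v z = b := by
  let A : Y →ₗ[ℝ] Y :=
    { toFun := hess₂₂ B.g v
      map_add' := fun a b => by simpa using hess₂₂_add_smul B.g v a b 1
      map_smul' := fun c b => by
        have h0 : hess₂₂ B.g v 0 = 0 := by simpa using hess₂₂_sub B.g v b b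
        simpa [h0] using hess₂₂_add_smul B.g v 0 b c }
  have : Function.Injective A := (injective_iff_map_eq_zero A).2 fun a ha => by
    have h1 := hL.norm_le_hess₂₂ hμ v a
    have h2 : hess₂₂ B.g v a = 0 := ha
    rw [h2, norm_zero] at h1
    exact norm_le_zero_iff.1 (nonpos_of_mul_nonpos_right h1 hμ)
  exact LinearMap.injective_iff_surjective.1 this b

omit hL hμ [FiniteDimensional ℝ Y] in
/-- The solution of the linear system `∇²₂₂ g (x, y*(x)) z = ∇₂ f (x, y*(x))`. -/
def zStar (B : Problem X Y Ξ Z) (x : X) : Y :=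
  Classical.epsilon fun z => hess₂₂ B.g (pt x (B.yStar x)) z = grad₂ B.f (pt x (B.yStar x))

omit hL hμ [FiniteDimensional ℝ Y] in
/-- The formula for the gradient of the hyper-objective. -/
def hyperGrad (B : Problem X Y Ξ Z) (x : X) : X :=
  grad₁ B.f (pt x (B.yStar x)) - hess₁₂ B.g (pt x (B.yStar x)) (B.zStar x)

theorem LowerLevel.hess₂₂_zStar (x : X) :
    hess₂₂ B.g (pt x (B.yStar x)) (B.zStar x) = grad₂ B.f (pt x (B.yStar x)) :=
  Classical.epsilon_spec (hL.exists_zStar hμ _ _)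

include hU

/-- This is where the bound on `∇₂f` along `y*` enters: `f` itself is not assumed Lipschitz. -/
theorem norm_zStar_le (x : X) : ‖B.zStar x‖ ≤ Cf / μ := by
  rw [le_div_iff₀ hμ, mul_comm]
  refine (hL.norm_le_hess₂₂ hμ (pt x (B.yStar x)) _).trans ?_
  rw [hL.hess₂₂_zStar hμ]
  exact hU.bound_grad₂ x

omit hL hμ [FiniteDimensional ℝ Y] in
theorem UpperLevel.norm_grad₂_sub_le (v w : Joint X Y) :
    ‖grad₂ B.f v - grad₂ B.f w‖ ≤ Lf * ‖v - w‖ :=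
  (norm_snd_le (gradient B.f v - gradient B.f w)).trans (hU.lipschitz_gradient.norm_sub_le v w)

omit hL hμ [FiniteDimensional ℝ Y] in
theorem UpperLevel.norm_grad₁_sub_le (v w : Joint X Y) :
    ‖grad₁ B.f v - grad₁ B.f w‖ ≤ Lf * ‖v - w‖ :=
  (norm_fst_le (gradient B.f v - gradient B.f w)).trans (hU.lipschitz_gradient.norm_sub_le v w)

omit hU hμ [FiniteDimensional ℝ Y] in
theorem LowerLevel.norm_hess₂₂_sub_le (v w : Joint X Y) (z : Y) :
    ‖hess₂₂ B.g v z - hess₂₂ B.g w z‖ ≤ L2g * ‖v - w‖ * ‖z‖ := by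
  refine (norm_snd_le ((hess B.g v - hess B.g w) (pt 0 z))).trans
    ((ContinuousLinearMap.le_opNorm _ _).trans ?_)
  rw [norm_pt_zero_left]
  gcongr
  exact hL.lipschitz_hess.norm_sub_le v w

omit hU hμ [FiniteDimensional ℝ Y] in
theorem LowerLevel.norm_hess₁₂_sub_le (v w : Joint X Y) (z : Y) :
    ‖hess₁₂ B.g v z - hess₁₂ B.g w z‖ ≤ L2g * ‖v - w‖ * ‖z‖ := by
  refine (norm_fst_le ((hess B.g v - hess B.g w) (pt 0 z))).trans
    ((ContinuousLinearMap.le_opNorm _ _).trans ?_)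
  rw [norm_pt_zero_left]
  gcongr
  exact hL.lipschitz_hess.norm_sub_le v w

omit hU hμ [FiniteDimensional ℝ Y] in
theorem LowerLevel.norm_hess_le (v : Joint X Y) : ‖hess B.g v‖ ≤ L1g :=
  norm_fderiv_le_of_lipschitz ℝ hL.lipschitz_gradient

omit hU hμ [FiniteDimensional ℝ Y] in
theorem LowerLevel.norm_hess₁₂_le (v : Joint X Y) (z : Y) : ‖hess₁₂ B.g v z‖ ≤ L1g * ‖z‖ := by
  refine (norm_fst_le _).trans ((ContinuousLinearMap.le_opNorm _ _).trans ?_)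
  rw [norm_pt_zero_left]
  gcongr
  exact hL.norm_hess_le v

omit hU hμ [FiniteDimensional ℝ Y] in
theorem LowerLevel.norm_hess₂₂_le (v : Joint X Y) (z : Y) : ‖hess₂₂ B.g v z‖ ≤ L1g * ‖z‖ := by
  refine (norm_snd_le _).trans ((ContinuousLinearMap.le_opNorm _ _).trans ?_)
  rw [norm_pt_zero_left]
  gcongr
  exact hL.norm_hess_le v

omit hU in
theorem LowerLevel.norm_pt_yStar_sub_le (x x' : X) :
    ‖pt x (B.yStar x) - pt x' (B.yStar x')‖ ≤ (1 + L1g / μ) * ‖x - x'‖ := by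
  rw [pt_sub, add_mul, one_mul]
  exact (norm_pt_le _ _).trans (by gcongr; exact hL.norm_yStar_sub_le hμ x x')

/-- With `z` frozen at the bounded vector `z*(x)`, the `z`-direction is Lipschitz in the point.
Since it vanishes at `(x, y*(x))`, this measures its error at `(x, y)`. -/
theorem norm_grad₂_sub_hess₂₂_sub_le (v w : Joint X Y) (x : X) :
    ‖(hess₂₂ B.g v (B.zStar x) - grad₂ B.f v) - (hess₂₂ B.g w (B.zStar x) - grad₂ B.f w)‖
      ≤ (Lf + L2g * (Cf / μ)) * ‖v - w‖ := by
  have h1 := hL.norm_hess₂₂_sub_le v w (B.zStar x)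
  have h2 := hU.norm_grad₂_sub_le v w
  rw [sub_sub_sub_comm]
  refine (norm_sub_le _ _).trans ?_
  have h3 : L2g * ‖v - w‖ * ‖B.zStar x‖ ≤ L2g * ‖v - w‖ * (Cf / μ) := by
    gcongr; exact norm_zStar_le hU hL hμ x
  linarith

theorem norm_grad₁_sub_hess₁₂_sub_le (v w : Joint X Y) (x : X) :
    ‖(grad₁ B.f v - hess₁₂ B.g v (B.zStar x)) - (grad₁ B.f w - hess₁₂ B.g w (B.zStar x))‖
      ≤ (Lf + L2g * (Cf / μ)) * ‖v - w‖ := by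
  have h1 := hL.norm_hess₁₂_sub_le v w (B.zStar x)
  have h2 := hU.norm_grad₁_sub_le v w
  rw [sub_sub_sub_comm]
  refine (norm_sub_le _ _).trans ?_
  have h3 : L2g * ‖v - w‖ * ‖B.zStar x‖ ≤ L2g * ‖v - w‖ * (Cf / μ) := by
    gcongr; exact norm_zStar_le hU hL hμ x
  linarith

/-- By coercivity at `x` it suffices to bound the residual of `z*(x')` in the linear system at `x`.
That residual vanishes in the system at `x'`, so the frozen-`z` Lipschitz bound applies. -/
theorem norm_zStar_sub_le (x x' : X) :
    ‖B.zStar x - B.zStar x'‖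
      ≤ (Lf + L2g * (Cf / μ)) * (1 + L1g / μ) / μ * ‖x - x'‖ := by
  have h1 := hL.norm_le_hess₂₂ hμ (pt x (B.yStar x)) (B.zStar x - B.zStar x')
  have h2 := norm_grad₂_sub_hess₂₂_sub_le hU hL hμ (pt x' (B.yStar x')) (pt x (B.yStar x)) x'
  rw [hL.hess₂₂_zStar hμ x', sub_self, zero_sub, neg_sub, ← hL.hess₂₂_zStar hμ x,
    ← hess₂₂_sub] at h2
  have h3 := hL.norm_pt_yStar_sub_le hμ x' x
  have hCf : 0 ≤ Cf := (norm_nonneg _).trans (hU.bound_grad₂ x)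
  rw [div_mul_eq_mul_div, le_div_iff₀ hμ, mul_comm, norm_sub_rev x x']
  refine h1.trans (h2.trans ?_)
  rw [mul_assoc]
  gcongr

theorem norm_hyperGrad_sub_le (x x' : X) :
    ‖B.hyperGrad x - B.hyperGrad x'‖ ≤ ((Lf + L2g * (Cf / μ)) * (1 + L1g / μ) +
      L1g * ((Lf + L2g * (Cf / μ)) * (1 + L1g / μ) / μ)) * ‖x - x'‖ := by
  have h1 := norm_grad₁_sub_hess₁₂_sub_le hU hL hμ (pt x (B.yStar x)) (pt x' (B.yStar x')) x'
  have h2 := hL.norm_hess₁₂_le (pt x (B.yStar x)) (B.zStar x - B.zStar x')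
  have h3 := hL.norm_pt_yStar_sub_le hμ x x'
  have h4 := norm_zStar_sub_le hU hL hμ x x'
  have hCf : 0 ≤ Cf := (norm_nonneg _).trans (hU.bound_grad₂ x)
  have e : B.hyperGrad x - B.hyperGrad x' =
    ((grad₁ B.f (pt x (B.yStar x)) - hess₁₂ B.g (pt x (B.yStar x)) (B.zStar x')) -
      (grad₁ B.f (pt x' (B.yStar x')) - hess₁₂ B.g (pt x' (B.yStar x')) (B.zStar x'))) -
      hess₁₂ B.g (pt x (B.yStar x)) (B.zStar x - B.zStar x') := by
    rw [hess₁₂_sub, hyperGrad, hyperGrad]; abel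
  rw [e, add_mul, mul_assoc, mul_assoc (L1g : ℝ)]
  refine (norm_sub_le _ _).trans (add_le_add (h1.trans ?_) (h2.trans ?_)) <;> gcongr

/-- Expand `f` along the curve `(x, y*(x))` and remove the unknown increment of `y*` by the adjoint
method. The expansion of `∇₂g`, zero at both ends, says that `∇²g` applied to the increment has a
quadratically small second component; pairing it with `z*` trades `⟨∇₂f, δy⟩` for `-⟨∇²₁₂g z*, δx⟩`.
The bound gives both differentiability of `H` and the descent inequality. -/
theorem abs_H_sub_sub_inner_le (x x' : X) :
    |B.H x' - B.H x - inner ℝ (B.hyperGrad x) (x' - x)|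
      ≤ (Lf + L2g * (Cf / μ)) * (1 + L1g / μ) ^ 2 * ‖x' - x‖ ^ 2 := by
  set v := pt x (B.yStar x) with hv
  set w := pt x' (B.yStar x') with hw
  have h1 := abs_sub_sub_inner_gradient_le hU.differentiable hU.lipschitz_gradient v w
  have h2 := norm_sub_sub_fderiv_le hL.differentiable_gradient (L := L2g)
    (fun v w => hL.lipschitz_hess.norm_sub_le v w) L2g.2 v w
  have h3 := hL.norm_pt_yStar_sub_le hμ x' x
  have hCf : 0 ≤ Cf := (norm_nonneg _).trans (hU.bound_grad₂ x)
  have hz := norm_zStar_le hU hL hμ x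
  -- The optimality conditions at `x` and `x'` remove the first two terms.
  have e1 : (gradient B.g w - gradient B.g v - fderiv ℝ (gradient B.g) v (w - v)).snd
      = - (hess B.g v (w - v)).snd := by
    have a1 : (gradient B.g w).snd = 0 := hL.grad₂_yStar hμ x'
    have a2 : (gradient B.g v).snd = 0 := hL.grad₂_yStar hμ x
    rw [Joint.snd_sub, Joint.snd_sub, a1, a2]; simp [hess]
  have h4 : ‖(hess B.g v (w - v)).snd‖ ≤ L2g * ‖w - v‖ ^ 2 := by
    rw [← norm_neg, ← e1]; exact (norm_snd_le _).trans h2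
  -- The adjoint identity: symmetry moves the Hessian onto `(0, z*)`, whose image has second
  -- component `∇₂f` by the equation of `z*`, so the `y`-increments cancel.
  have e2 : inner ℝ (gradient B.f v) (w - v) = inner ℝ (B.hyperGrad x) (x' - x)
      + inner ℝ (B.zStar x) (hess B.g v (w - v)).snd := by
    have b1 : inner ℝ (B.zStar x) (hess B.g v (w - v)).snd
        = inner ℝ (hess B.g v (pt 0 (B.zStar x))) (w - v) := by
      rw [hL.hess_symm, real_inner_comm, inner_fst_add_snd (pt 0 (B.zStar x))]
      simp [real_inner_comm]
    rw [b1, inner_fst_add_snd, inner_fst_add_snd (hess B.g v _)]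
    have b2 : (hess B.g v (pt 0 (B.zStar x))).snd = (gradient B.f v).snd := hL.hess₂₂_zStar hμ x
    have b3 : B.hyperGrad x = (gradient B.f v).fst - (hess B.g v (pt 0 (B.zStar x))).fst := rfl
    have b4 : (w - v).fst = x' - x := rfl
    rw [b2, b3, b4, inner_sub_left]; ring
  have h5 : |inner ℝ (B.zStar x) (hess B.g v (w - v)).snd| ≤ Cf / μ * (L2g * ‖w - v‖ ^ 2) :=
    (abs_real_inner_le_norm _ _).trans (by gcongr)
  have h6 : ‖w - v‖ ^ 2 ≤ (1 + L1g / μ) ^ 2 * ‖x' - x‖ ^ 2 := by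
    rw [← mul_pow]; gcongr
  have h7 : (Lf + L2g * (Cf / μ)) * ‖w - v‖ ^ 2 ≤
    (Lf + L2g * (Cf / μ)) * ((1 + L1g / μ) ^ 2 * ‖x' - x‖ ^ 2) := by gcongr
  have e3 : B.H x' - B.H x - inner ℝ (B.hyperGrad x) (x' - x) =
      (B.f w - B.f v - inner ℝ (gradient B.f v) (w - v)) +
        inner ℝ (B.zStar x) (hess B.g v (w - v)).snd := by
    rw [e2, H, H]; ring
  rw [e3]
  refine (abs_add_le _ _).trans ?_
  linarith

theorem hasGradientAt_H (x : X) : HasGradientAt B.H (B.hyperGrad x) x := by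
  rw [hasGradientAt_iff_isLittleO]
  have h1 : (fun x' => B.H x' - B.H x - inner ℝ (B.hyperGrad x) (x' - x)) =O[𝓝 x]
      fun x' => ‖x' - x‖ ^ 2 :=
    Asymptotics.IsBigO.of_bound _ (Filter.Eventually.of_forall fun x' => by
      rw [Real.norm_eq_abs, norm_pow, norm_norm]
      exact abs_H_sub_sub_inner_le hU hL hμ x x')
  refine h1.trans_isLittleO ?_
  have : (fun x' => ‖x' - x‖ ^ 2) =o[𝓝 x] fun x' => ‖x' - x‖ :=
    (Asymptotics.isLittleO_pow_id one_lt_two).comp_tendsto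
      (by simpa [Function.comp_def] using (continuous_norm.comp (continuous_sub_right x)).tendsto x)
  exact this.of_norm_right

theorem gradient_H : gradient B.H = B.hyperGrad :=
  gradient_eq (hasGradientAt_H hU hL hμ)

theorem differentiable_H : Differentiable ℝ B.H :=
  fun x => (hasGradientAt_H hU hL hμ x).differentiableAt

end Problem

end Deterministic

/-! ### Joint measurability of the stochastic derivatives. -/

section Measurability

variable {E S : Type*} [NormedAddCommGroup E] [InnerProductSpace ℝ E] [FiniteDimensional ℝ E]
  [MeasurableSpace E] [BorelSpace E] [MeasurableSpace S]

theorem measurable_of_inner {T : Type*} [MeasurableSpace T] {φ : T → E}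
    (h : ∀ e, Measurable fun t => inner ℝ (φ t) e) : Measurable φ := by
  have e : φ = fun t => ∑ i, inner ℝ (φ t) (stdOrthonormalBasis ℝ E i) •
      stdOrthonormalBasis ℝ E i := by
    funext t
    conv_lhs => rw [← (stdOrthonormalBasis ℝ E).sum_repr (φ t)]
    simp_rw [OrthonormalBasis.repr_apply_apply, real_inner_comm]
  rw [e]
  exact Finset.measurable_sum _ fun i _ => (h _).smul_const _

/-- A Carathéodory function is jointly measurable. -/
theorem measurable_caratheodory {F : Type*} [MeasurableSpace F] [TopologicalSpace F]
    [TopologicalSpace.PseudoMetrizableSpace F] [BorelSpace F] {φ : E → S → F}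
    (hc : ∀ s, Continuous fun v => φ v s) (hm : ∀ v, Measurable (φ v)) :
    Measurable fun p : E × S => φ p.1 p.2 :=
  measurable_uncurry_of_continuous_of_measurable (u := φ) hc hm

/-- The directional derivative of a jointly measurable function is jointly measurable. -/
theorem measurable_fderiv_apply {φ : E → S → ℝ} (hd : ∀ s, Differentiable ℝ fun v => φ v s)
    (hm : ∀ v, Measurable (φ v)) :
    Measurable fun p : (E × S) × E => fderiv ℝ (fun v => φ v p.1.2) p.1.1 p.2 := by
  have hj := measurable_caratheodory (fun s => (hd s).continuous) hm
  -- Difference quotients with step `1/(n+1)` are jointly measurable and converge everywhere;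
  -- continuity of the derivative is not needed.
  refine measurable_of_tendsto_metrizable (f := fun (n : ℕ) (p : (E × S) × E) =>
    ((n : ℝ) + 1) * (φ (p.1.1 + ((n : ℝ) + 1)⁻¹ • p.2) p.1.2 - φ p.1.1 p.1.2)) (fun n => ?_) ?_
  · refine Measurable.const_mul (Measurable.sub ?_ (hj.comp measurable_fst)) _
    exact hj.comp (f := fun p : (E × S) × E => (p.1.1 + ((n : ℝ) + 1)⁻¹ • p.2, p.1.2)) (by fun_prop)
  · rw [tendsto_pi_nhds]
    rintro ⟨⟨v, s⟩, w⟩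
    have h1 : HasDerivAt (fun t : ℝ => v + t • w) w 0 := by
      simpa using ((hasDerivAt_id (0 : ℝ)).smul_const w).const_add v
    have h0 : HasFDerivAt (fun v => φ v s) (fderiv ℝ (fun v => φ v s) v) (v + (0 : ℝ) • w) := by
      simpa using (hd s v).hasFDerivAt
    have h2 := (h0.comp_hasDerivAt 0 h1).tendsto_slope
    have h3 : Tendsto (fun n : ℕ => ((n : ℝ) + 1)⁻¹) atTop (𝓝[≠] 0) := by
      refine tendsto_nhdsWithin_iff.2 ⟨?_, Eventually.of_forall fun n => ?_⟩
      · simpa using tendsto_one_div_add_atTop_nhds_zero_nat (𝕜 := ℝ)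
      · exact inv_ne_zero (by positivity)
    refine (h2.comp h3).congr fun n => ?_
    simp [slope, Function.comp]

theorem measurable_gradient {φ : E → S → ℝ} (hd : ∀ s, Differentiable ℝ fun v => φ v s)
    (hm : ∀ v, Measurable (φ v)) :
    Measurable fun p : E × S => gradient (fun v => φ v p.2) p.1 := by
  refine measurable_of_inner fun e => ?_
  simp_rw [inner_gradient_left]
  exact (measurable_fderiv_apply hd hm).comp (measurable_id.prodMk measurable_const)

/-- Paired with a fixed `e`, the Hessian is a directional derivative of the scalar function `⟨∇φ,
e⟩`, so the previous argument applies again. -/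
theorem measurable_fderiv_gradient {φ : E → S → ℝ} (hd : ∀ s, Differentiable ℝ fun v => φ v s)
    (hd' : ∀ s, Differentiable ℝ (gradient fun v => φ v s)) (hm : ∀ v, Measurable (φ v)) :
    Measurable fun p : (E × S) × E => fderiv ℝ (gradient fun v => φ v p.1.2) p.1.1 p.2 := by
  refine measurable_of_inner fun e => ?_
  have h1 := measurable_fderiv_apply (φ := fun v s => inner ℝ (gradient (fun v => φ v s) v) e)
    (fun s => (hd' s).inner ℝ (differentiable_const e))
    (fun v =>
      ((measurable_gradient hd hm).comp (measurable_const.prodMk measurable_id)).inner_const)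
  convert h1 using 2 with p
  rw [fderiv_inner_apply ℝ (hd' _ _) (differentiableAt_const e)]
  simp

end Measurability

/-! ### Differentiation under the integral sign with `L²` bounds. -/

section Interchange

variable {S : Type*} [MeasurableSpace S] {ν : Measure S} [IsProbabilityMeasure ν]

/-- Convergence of integrals for a pointwise convergent sequence that is bounded in `L²`. -/
theorem tendsto_integral_of_sq_bounded {Q : ℕ → S → ℝ} {Q' : S → ℝ} {C : ℝ}
    (hm : ∀ n, AEStronglyMeasurable (Q n) ν) (hm' : AEStronglyMeasurable Q' ν)
    (hi : ∀ n, Integrable (fun s => Q n s ^ 2) ν) (hi' : Integrable (fun s => Q' s ^ 2) ν)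
    (hC : ∀ n, ∫ s, Q n s ^ 2 ∂ν ≤ C) (hC' : ∫ s, Q' s ^ 2 ∂ν ≤ C)
    (hlim : ∀ s, Tendsto (fun n => Q n s) atTop (𝓝 (Q' s))) :
    Tendsto (fun n => ∫ s, Q n s ∂ν) atTop (𝓝 (∫ s, Q' s ∂ν)) := by
  have hQ : ∀ n, Integrable (Q n) ν := fun n =>
    ((memLp_two_iff_integrable_sq (hm n)).2 (hi n)).integrable one_le_two
  have hQ' : Integrable Q' ν := ((memLp_two_iff_integrable_sq hm').2 hi').integrable one_le_two
  have hdi : ∀ n, Integrable (fun s => (Q n s - Q' s) ^ 2) ν := fun n =>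
    (((memLp_two_iff_integrable_sq (hm n)).2 (hi n)).sub
      ((memLp_two_iff_integrable_sq hm').2 hi')).integrable_sq
  have hdC : ∀ n, ∫ s, (Q n s - Q' s) ^ 2 ∂ν ≤ 4 * C := fun n => by
    calc ∫ s, (Q n s - Q' s) ^ 2 ∂ν ≤ ∫ s, (2 * Q n s ^ 2 + 2 * Q' s ^ 2) ∂ν :=
          integral_mono (hdi n) (((hi n).const_mul 2).add (hi'.const_mul 2))
            fun s => by dsimp only; nlinarith [sq_nonneg (Q n s + Q' s)]
      _ = 2 * ∫ s, Q n s ^ 2 ∂ν + 2 * ∫ s, Q' s ^ 2 ∂ν := by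
          rw [integral_add ((hi n).const_mul 2) (hi'.const_mul 2), integral_const_mul,
            integral_const_mul]
      _ ≤ 4 * C := by linarith [hC n]
  rw [Metric.tendsto_atTop]
  intro ε hε
  have hC0 : 0 ≤ C := (integral_nonneg fun s => sq_nonneg (Q' s)).trans hC'
  -- Truncation level: the difference has second moment at most `4C`, so its part above `M`
  -- contributes at most `4C/M ≤ ε/2`. The `+ 1` keeps `M` positive when `C = 0`.
  set M := (8 * C + 1) / ε with hM
  have hM0 : 0 < M := by positivity
  have hmin : Tendsto (fun n => ∫ s, min |Q n s - Q' s| M ∂ν) atTop (𝓝 (∫ _, (0 : ℝ) ∂ν)) := by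
    refine tendsto_integral_of_dominated_convergence (fun _ => M)
      (fun n => (((hm n).sub hm').norm.inf aestronglyMeasurable_const)) (integrable_const _)
      (fun n => Eventually.of_forall fun s => ?_) (Eventually.of_forall fun s => ?_)
    · rw [Real.norm_eq_abs, abs_of_nonneg (le_min (abs_nonneg _) hM0.le)]
      exact min_le_right _ _
    · have h1 : Tendsto (fun n => |Q n s - Q' s|) atTop (𝓝 0) := by
        simpa using ((hlim s).sub_const (Q' s)).abs
      simpa [min_eq_left hM0.le] using h1.min (tendsto_const_nhds (x := M))
  rw [integral_zero] at hmin
  obtain ⟨N, hN⟩ := (Metric.tendsto_atTop.1 hmin) (ε / 2) (half_pos hε)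
  refine ⟨N, fun n hn => ?_⟩
  have h1 := hN n hn
  rw [Real.dist_eq, sub_zero] at h1
  have hmi : Integrable (fun s => min |Q n s - Q' s| M) ν :=
    ((hQ n).sub hQ').abs.inf (integrable_const M)
  -- Below `M` the minimum suffices; above `M` one has `|d| ≤ d²/M`. The first part tends to zero by
  -- dominated convergence, the second is uniformly small.
  have h2 : ∫ s, |Q n s - Q' s| ∂ν ≤ ∫ s, (min |Q n s - Q' s| M + M⁻¹ * (Q n s - Q' s) ^ 2) ∂ν := by
    refine integral_mono ((hQ n).sub hQ').abs (hmi.add ((hdi n).const_mul _)) fun s => ?_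
    dsimp only
    rcases le_total |Q n s - Q' s| M with h | h
    · rw [min_eq_left h]; have : 0 ≤ M⁻¹ * (Q n s - Q' s) ^ 2 := by positivity
      linarith
    · rw [min_eq_right h]
      have h3 : |Q n s - Q' s| ≤ M⁻¹ * (Q n s - Q' s) ^ 2 := by
        rw [le_inv_mul_iff₀ hM0, ← sq_abs, sq]
        exact mul_le_mul_of_nonneg_right h (abs_nonneg _)
      linarith
  rw [integral_add hmi ((hdi n).const_mul _), integral_const_mul] at h2
  have h3 : M⁻¹ * ∫ s, (Q n s - Q' s) ^ 2 ∂ν ≤ M⁻¹ * (4 * C) := by gcongr; exact hdC n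
  have h4 : M⁻¹ * (4 * C) ≤ ε / 2 := by
    rw [inv_mul_le_iff₀ hM0, hM]; field_simp; linarith
  rw [Real.dist_eq, ← integral_sub (hQ n) hQ']
  calc |∫ s, (Q n s - Q' s) ∂ν| ≤ ∫ s, |Q n s - Q' s| ∂ν := abs_integral_le_integral_abs
    _ < ε := by linarith [(abs_lt.1 h1).2]

/-- The difference quotient is bounded in the mean square by the derivative. -/
theorem ofReal_sq_slope_le {φ φ' : ℝ → ℝ} (hd : ∀ u, HasDerivAt φ (φ' u) u)
    (hm : Measurable φ') {t : ℝ} (ht : 0 < t) :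
    ENNReal.ofReal ((t⁻¹ * (φ t - φ 0)) ^ 2) ≤
      ENNReal.ofReal t⁻¹ * ∫⁻ u in Set.Ioc 0 t, ENNReal.ofReal (φ' u ^ 2) := by
  -- A derivative need not be integrable. If its square is not, the right side is infinite;
  -- otherwise the fundamental theorem of calculus applies.
  by_cases hfin : ∫⁻ u in Set.Ioc 0 t, ENNReal.ofReal (φ' u ^ 2) = ⊤
  · rw [hfin, ENNReal.mul_top (by simpa using ht)]; exact le_top
  have hsq : Integrable (fun u => φ' u ^ 2) (volume.restrict (Set.Ioc 0 t)) := by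
    refine ⟨(hm.pow_const 2).aestronglyMeasurable, ?_⟩
    rw [hasFiniteIntegral_iff_ofReal (Eventually.of_forall fun u => sq_nonneg _)]
    exact lt_top_iff_ne_top.2 hfin
  have hint : Integrable φ' (volume.restrict (Set.Ioc 0 t)) :=
    ((memLp_two_iff_integrable_sq hm.aestronglyMeasurable).2 hsq).integrable one_le_two
  have hftc : ∫ u in Set.Ioc 0 t, φ' u = φ t - φ 0 := by
    rw [← intervalIntegral.integral_of_le ht.le]
    exact intervalIntegral.integral_eq_sub_of_hasDerivAt (fun u _ => hd u)
      ((intervalIntegrable_iff_integrableOn_Ioc_of_le ht.le).2 hint)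
  rw [← ofReal_integral_eq_lintegral_ofReal hsq (Eventually.of_forall fun u => sq_nonneg _),
    ← ENNReal.ofReal_mul (by positivity)]
  refine ENNReal.ofReal_le_ofReal ?_
  rw [← hftc]
  set m := t⁻¹ * ∫ u in Set.Ioc 0 t, φ' u with hmdef
  -- Jensen's inequality in the form that the variance about the mean `m` is nonnegative.
  have h0 : 0 ≤ ∫ u in Set.Ioc 0 t, (φ' u - m) ^ 2 := integral_nonneg fun u => sq_nonneg _
  have hv : (volume.restrict (Set.Ioc 0 t)).real Set.univ = t := by
    simp [Measure.real, ht.le]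
  have h1 : ∫ u in Set.Ioc 0 t, (φ' u - m) ^ 2 =
      (∫ u in Set.Ioc 0 t, φ' u ^ 2) - 2 * m * (∫ u in Set.Ioc 0 t, φ' u) + t * m ^ 2 := by
    have e : (fun u => (φ' u - m) ^ 2) = fun u => (φ' u ^ 2 - 2 * m * φ' u) + m ^ 2 := by
      funext u; ring
    have h2 : Integrable (fun u => φ' u ^ 2 - 2 * m * φ' u) (volume.restrict (Set.Ioc 0 t)) :=
      hsq.sub (hint.const_mul _)
    rw [e, integral_add h2 (integrable_const _), integral_sub hsq (hint.const_mul _),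
      integral_const_mul, integral_const, hv, smul_eq_mul]
  have h2 : ∫ u in Set.Ioc 0 t, φ' u = t * m := by rw [hmdef]; field_simp
  rw [h1, h2] at h0
  rw [le_inv_mul_iff₀ ht]
  nlinarith

/-- Differentiation under the integral sign, for a derivative that is bounded in `L²`. -/
theorem integral_deriv_eq {φ φ' : ℝ → S → ℝ} (hd : ∀ s u, HasDerivAt (fun u => φ u s) (φ' u s) u)
    (hm' : Measurable fun p : ℝ × S => φ' p.1 p.2) (hi : ∀ u, Integrable (φ u) ν) {C : ℝ}
    (hi2 : ∀ u ∈ Set.Icc (0 : ℝ) 1, Integrable (fun s => φ' u s ^ 2) ν)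
    (hC : ∀ u ∈ Set.Icc (0 : ℝ) 1, ∫ s, φ' u s ^ 2 ∂ν ≤ C) {Φ' : ℝ}
    (hΦ : HasDerivAt (fun u => ∫ s, φ u s ∂ν) Φ' 0) : ∫ s, φ' 0 s ∂ν = Φ' := by
  set r : ℕ → ℝ := fun n => ((n : ℝ) + 1)⁻¹ with hr
  have hr0 : ∀ n, 0 < r n := fun n => by positivity
  have hr1 : ∀ n, r n ≤ 1 := fun n => inv_le_one_of_one_le₀ (by simp)
  have hrt : Tendsto r atTop (𝓝[≠] 0) := by
    refine tendsto_nhdsWithin_iff.2 ⟨?_, Eventually.of_forall fun n => (hr0 n).ne'⟩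
    simpa [hr] using tendsto_one_div_add_atTop_nhds_zero_nat (𝕜 := ℝ)
  have hC0 : 0 ≤ C := (integral_nonneg fun s => sq_nonneg _).trans (hC 0 (by simp))
  set Q : ℕ → S → ℝ := fun n s => (r n)⁻¹ * (φ (r n) s - φ 0 s) with hQ
  have hQm : ∀ n, AEStronglyMeasurable (Q n) ν := fun n =>
    (((hi _).sub (hi _)).const_mul _).aestronglyMeasurable
  have hm'u : ∀ u, Measurable (φ' u) := fun u => hm'.comp (measurable_const.prodMk measurable_id)
  have hm's : ∀ s, Measurable fun u => φ' u s := fun s =>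
    hm'.comp (measurable_id.prodMk measurable_const)
  -- Tonelli: the second moment of the quotient is at most the average over `u ∈ (0, r n]` of that
  -- of the derivative. Since `r n ≤ 1`, bounds on `[0, 1]` suffice.
  have hQlt : ∀ n, ∫⁻ s, ENNReal.ofReal (Q n s ^ 2) ∂ν ≤ ENNReal.ofReal C := fun n => by
    calc ∫⁻ s, ENNReal.ofReal (Q n s ^ 2) ∂ν
        ≤ ∫⁻ s, ENNReal.ofReal (r n)⁻¹ *
            (∫⁻ u in Set.Ioc 0 (r n), ENNReal.ofReal (φ' u s ^ 2)) ∂ν :=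
          lintegral_mono fun s => ofReal_sq_slope_le (hd s) (hm's s) (hr0 n)
      _ = ENNReal.ofReal (r n)⁻¹ *
            ∫⁻ u in Set.Ioc 0 (r n), ∫⁻ s, ENNReal.ofReal (φ' u s ^ 2) ∂ν := by
          rw [lintegral_const_mul' _ _ ENNReal.ofReal_ne_top, lintegral_lintegral_swap]
          exact ((hm'.comp measurable_swap).pow_const 2).ennreal_ofReal.aemeasurable
      _ ≤ ENNReal.ofReal (r n)⁻¹ * ∫⁻ u in Set.Ioc 0 (r n), ENNReal.ofReal C := by
          gcongr 1
          refine setLIntegral_mono measurable_const fun u hu => ?_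
          have hu' : u ∈ Set.Icc (0 : ℝ) 1 := ⟨hu.1.le, hu.2.trans (hr1 n)⟩
          rw [← ofReal_integral_eq_lintegral_ofReal (hi2 u hu')
            (Eventually.of_forall fun s => sq_nonneg _)]
          exact ENNReal.ofReal_le_ofReal (hC u hu')
      _ = ENNReal.ofReal C := by
          rw [setLIntegral_const, Real.volume_Ioc, sub_zero, mul_comm (ENNReal.ofReal C),
            ← mul_assoc, ← ENNReal.ofReal_mul (by have := hr0 n; positivity),
            inv_mul_cancel₀ (hr0 n).ne', ENNReal.ofReal_one, one_mul]
  have hQi : ∀ n, Integrable (fun s => Q n s ^ 2) ν := fun n => by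
    refine ⟨(hQm n).pow 2, ?_⟩
    rw [hasFiniteIntegral_iff_ofReal (Eventually.of_forall fun u => sq_nonneg _)]
    exact (hQlt n).trans_lt ENNReal.ofReal_lt_top
  have hQC : ∀ n, ∫ s, Q n s ^ 2 ∂ν ≤ C := fun n => by
    have := hQlt n
    rw [← ofReal_integral_eq_lintegral_ofReal (hQi n) (Eventually.of_forall fun s => sq_nonneg _)]
      at this
    exact (ENNReal.ofReal_le_ofReal_iff hC0).1 this
  have h0 : (0 : ℝ) ∈ Set.Icc (0 : ℝ) 1 := by simp
  have hlim := tendsto_integral_of_sq_bounded hQm (hm'u 0).aestronglyMeasurable hQi (hi2 0 h0) hQC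
    (hC 0 h0) fun s => ((hd s 0).tendsto_slope.comp hrt).congr fun n => by
      simp [slope, Q]
  have hlim' : Tendsto (fun n => ∫ s, Q n s ∂ν) atTop (𝓝 Φ') :=
    (hΦ.tendsto_slope.comp hrt).congr fun n => by
      simp only [Q]
      rw [integral_const_mul, integral_sub (hi _) (hi _)]
      simp [slope]
  exact tendsto_nhds_unique hlim hlim'

end Interchange

/-! ### Unbiasedness of stochastic gradients. -/

section Unbiased

variable {E S : Type*} [NormedAddCommGroup E] [InnerProductSpace ℝ E] [FiniteDimensional ℝ E]
  [CompleteSpace E] [MeasurableSpace E] [BorelSpace E] [MeasurableSpace S]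
  {ν : Measure S} [IsProbabilityMeasure ν]

theorem memLp_two_of_integrable_sq_sub {φ : S → E} (hm : AEStronglyMeasurable φ ν) {c : E}
    (hi : Integrable (fun s => ‖φ s - c‖ ^ 2) ν) : MemLp φ 2 ν := by
  have h1 : MemLp (fun s => φ s - c) 2 ν :=
    (memLp_two_iff_integrable_sq_norm (hm.sub aestronglyMeasurable_const)).2 hi
  simpa [Pi.add_def] using h1.add (memLp_const c)

theorem integral_fderiv_apply {φ : E → S → ℝ} (hd : ∀ s, Differentiable ℝ fun v => φ v s)
    (hm : ∀ v, Measurable (φ v)) (hi : ∀ v, Integrable (φ v) ν) {v w : E}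
    (hΦ : DifferentiableAt ℝ (fun v => ∫ s, φ v s ∂ν) v) {C : ℝ}
    (hi2 : ∀ u ∈ Set.Icc (0 : ℝ) 1,
      Integrable (fun s => fderiv ℝ (fun v => φ v s) (v + u • w) w ^ 2) ν)
    (hC : ∀ u ∈ Set.Icc (0 : ℝ) 1, ∫ s, fderiv ℝ (fun v => φ v s) (v + u • w) w ^ 2 ∂ν ≤ C) :
    ∫ s, fderiv ℝ (fun v => φ v s) v w ∂ν = fderiv ℝ (fun v => ∫ s, φ v s ∂ν) v w := by
  have hl : ∀ u : ℝ, HasDerivAt (fun u : ℝ => v + u • w) w u := fun u => by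
    simpa using ((hasDerivAt_id u).smul_const w).const_add v
  have h0 : HasFDerivAt (fun v => ∫ s, φ v s ∂ν) (fderiv ℝ (fun v => ∫ s, φ v s ∂ν) v)
      (v + (0 : ℝ) • w) := by simpa using hΦ.hasFDerivAt
  have := integral_deriv_eq (φ := fun u s => φ (v + u • w) s)
    (φ' := fun u s => fderiv ℝ (fun v => φ v s) (v + u • w) w)
    (fun s u => (hd s _).hasFDerivAt.comp_hasDerivAt u (hl u))
    ((measurable_fderiv_apply hd hm).comp
      (g := fun p : (E × S) × E => fderiv ℝ (fun v => φ v p.1.2) p.1.1 p.2)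
      (f := fun p : ℝ × S => ((v + p.1 • w, p.2), w)) (by fun_prop))
    (fun u => hi _) hi2 hC (HasFDerivAt.comp_hasDerivAt (l := fun v => ∫ s, φ v s ∂ν)
      (f := fun u : ℝ => v + u • w) 0 h0 (hl 0))
  simpa using this

/-- The variance bound and the Lipschitz bound on `∇Φ` together bound the directional derivatives in
`L²` uniformly along a unit segment, which is what the interchange requires. -/
theorem integral_gradient {φ : E → S → ℝ} (hd : ∀ s, Differentiable ℝ fun v => φ v s)
    (hm : ∀ v, Measurable (φ v)) (hi : ∀ v, Integrable (φ v) ν) {Φ : E → ℝ}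
    (hΦ : ∀ v, Φ v = ∫ s, φ v s ∂ν) (hdΦ : Differentiable ℝ Φ) {L : ℝ≥0}
    (hL : LipschitzWith L (gradient Φ)) {σ : ℝ}
    (hvar : ∀ v, Integrable (fun s => ‖gradient (fun w => φ w s) v - gradient Φ v‖ ^ 2) ν ∧
      ∫ s, ‖gradient (fun w => φ w s) v - gradient Φ v‖ ^ 2 ∂ν ≤ σ ^ 2) (v : E) :
    MemLp (fun s => gradient (fun w => φ w s) v) 2 ν ∧
      ∫ s, gradient (fun w => φ w s) v ∂ν = gradient Φ v := by
  have hmg : ∀ v, Measurable fun s => gradient (fun w => φ w s) v := fun v =>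
    (measurable_gradient hd hm).comp (measurable_const.prodMk measurable_id)
  have hLp : ∀ v, MemLp (fun s => gradient (fun w => φ w s) v) 2 ν := fun v =>
    memLp_two_of_integrable_sq_sub (hmg v).aestronglyMeasurable (hvar v).1
  refine ⟨hLp v, ext_inner_right ℝ fun w => ?_⟩
  rw [real_inner_comm, ← integral_inner ((hLp v).integrable one_le_two)]
  simp_rw [real_inner_comm _ w, inner_gradient_left]
  have hΦ' : Φ = fun v => ∫ s, φ v s ∂ν := funext hΦ
  have hb : ∀ u ∈ Set.Icc (0 : ℝ) 1, ∀ s, fderiv ℝ (fun v => φ v s) (v + u • w) w ^ 2 ≤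
      2 * ‖w‖ ^ 2 * ‖gradient (fun v => φ v s) (v + u • w) - gradient Φ (v + u • w)‖ ^ 2 +
        2 * ‖w‖ ^ 2 * (‖gradient Φ v‖ + L * ‖w‖) ^ 2 := fun u hu s => by
    rw [← inner_gradient_left]
    have h1 := abs_real_inner_le_norm (gradient (fun v => φ v s) (v + u • w)) w
    have h2 := hL.norm_sub_le (v + u • w) v
    rw [add_sub_cancel_left, norm_smul, Real.norm_eq_abs, abs_of_nonneg hu.1] at h2
    have h3 : ‖gradient Φ (v + u • w)‖ ≤ ‖gradient Φ v‖ + L * ‖w‖ := by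
      have h4 := norm_le_insert' (gradient Φ (v + u • w)) (gradient Φ v)
      have h5 : L * (u * ‖w‖) ≤ L * ‖w‖ := by
        gcongr; exact mul_le_of_le_one_left (norm_nonneg _) hu.2
      linarith
    have h6 := norm_le_insert' (gradient (fun v => φ v s) (v + u • w)) (gradient Φ (v + u • w))
    set p := ‖gradient (fun v => φ v s) (v + u • w) - gradient Φ (v + u • w)‖
    set q := ‖gradient Φ v‖ + L * ‖w‖
    have h7 : |inner ℝ (gradient (fun v => φ v s) (v + u • w)) w| ≤ (p + q) * ‖w‖ :=
      h1.trans (mul_le_mul_of_nonneg_right (by linarith) (norm_nonneg _))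
    calc _ = |inner ℝ (gradient (fun v => φ v s) (v + u • w)) w| ^ 2 := (sq_abs _).symm
      _ ≤ ((p + q) * ‖w‖) ^ 2 := by gcongr
      _ ≤ _ := by rw [mul_pow]; nlinarith [mul_nonneg (sq_nonneg (p - q)) (sq_nonneg ‖w‖)]
  have hi2 : ∀ u ∈ Set.Icc (0 : ℝ) 1,
      Integrable (fun s => fderiv ℝ (fun v => φ v s) (v + u • w) w ^ 2) ν := fun u _ => by
    have h1 : MemLp (fun s => inner ℝ (gradient (fun v => φ v s) (v + u • w)) w) 2 ν :=
      (hLp (v + u • w)).inner_const w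
    have := h1.integrable_sq
    simpa only [inner_gradient_left] using this
  subst hΦ'
  refine integral_fderiv_apply hd hm hi (hdΦ v)
    (C := 2 * ‖w‖ ^ 2 * σ ^ 2 +
      2 * ‖w‖ ^ 2 * (‖gradient (fun v => ∫ s, φ v s ∂ν) v‖ + L * ‖w‖) ^ 2) hi2 fun u hu => ?_
  refine (integral_mono (hi2 u hu) (((hvar _).1.const_mul _).add (integrable_const _))
    (hb u hu)).trans ?_
  rw [integral_add' ((hvar _).1.const_mul _) (integrable_const _), integral_const_mul]
  simp only [integral_const, probReal_univ, one_smul]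
  gcongr
  exact (hvar _).2

end Unbiased

/-! ### Variance of a mini-batch average. -/

section MiniBatch

variable {E T Ω : Type*} [NormedAddCommGroup E] [InnerProductSpace ℝ E] [FiniteDimensional ℝ E]
  [CompleteSpace E] [MeasurableSpace E] [BorelSpace E] [MeasurableSpace T] [MeasurableSpace Ω]
  {P : Measure Ω} [IsProbabilityMeasure P] {ν : Measure T}

/-- The variance of a mini-batch average. -/
theorem integral_norm_add_smul_average_sub_le {W : ℕ → Ω → T} (hW : ∀ i, Measurable (W i))
    (hmap : ∀ i, P.map (W i) = ν) (hind : iIndepFun W P) {φ : T → E} (hφ : Measurable φ)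
    {m : E} (hL2 : MemLp φ 2 ν) (hmean : ∫ s, φ s ∂ν = m) {τ : ℝ}
    (hvar : ∫ s, ‖φ s - m‖ ^ 2 ∂ν ≤ τ) {N : ℕ} (hN : 0 < N) (a : E) (b : ℝ) :
    Integrable (fun ω => ‖a + b • ((N : ℝ)⁻¹ • ∑ i ∈ Finset.range N, φ (W i ω) - m)‖ ^ 2) P ∧
    ∫ ω, ‖a + b • ((N : ℝ)⁻¹ • ∑ i ∈ Finset.range N, φ (W i ω) - m)‖ ^ 2 ∂P
      ≤ ‖a‖ ^ 2 + b ^ 2 * (τ / N) := by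
  have hN' : (N : ℝ) ≠ 0 := by positivity
  have hν : IsProbabilityMeasure ν := by
    rw [← hmap 0]; exact Measure.isProbabilityMeasure_map (hW 0).aemeasurable
  set ψ : ℕ → Ω → E := fun i ω => φ (W i ω) - m with hψ
  have hψL : ∀ i, MemLp (ψ i) 2 P := fun i => by
    have h1 : MemLp φ 2 (P.map (W i)) := by rwa [hmap i]
    exact (h1.comp_measurePreserving ((hW i).measurePreserving P)).sub (memLp_const m)
  have hψi : ∀ i, Integrable (ψ i) P := fun i => (hψL i).integrable one_le_two
  have hψ0 : ∀ i, ∫ ω, ψ i ω ∂P = 0 := fun i => by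
    have h1 : ∫ ω, φ (W i ω) ∂P = m := by
      rw [← hmean, ← hmap i, integral_map (hW i).aemeasurable hφ.aestronglyMeasurable]
    have h2 : Integrable (fun ω => φ (W i ω)) P := by
      have h1 : MemLp φ 2 (P.map (W i)) := by rwa [hmap i]
      exact (h1.comp_measurePreserving ((hW i).measurePreserving P)).integrable one_le_two
    simp only [hψ]
    rw [integral_sub h2 (integrable_const _), h1]; simp
  have hψv : ∀ i, ∫ ω, inner ℝ (ψ i ω) (ψ i ω) ∂P ≤ τ := fun i => by
    refine le_of_eq_of_le ?_ hvar
    rw [← hmap i, integral_map (hW i).aemeasurable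
      ((hφ.sub_const m).norm.pow_const 2).aestronglyMeasurable]
    simp [hψ]
  -- Independent centred vectors are orthogonal in `L²`; this produces the factor `1/N`.
  have hψij : ∀ i j, i ≠ j → ∫ ω, inner ℝ (ψ i ω) (ψ j ω) ∂P = 0 := fun i j hij => by
    have h1 : IndepFun (ψ i) (ψ j) P :=
      (hind.indepFun hij).comp (hφ.sub_const m) (hφ.sub_const m)
    have h2 := h1.integral_bilin (hψi i) (hψi j) (innerSL ℝ)
    refine h2.trans ?_
    rw [hψ0 i, map_zero, zero_apply]
  have hii : ∀ i j, Integrable (fun ω => inner ℝ (ψ i ω) (ψ j ω)) P := fun i j => by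
    have h1 : ∀ i, Integrable (fun ω => ‖ψ i ω‖ ^ 2) P := fun i =>
      (memLp_two_iff_integrable_sq_norm (hψL i).1).1 (hψL i)
    refine ((h1 i).add (h1 j)).mono' ((hψL i).1.inner (𝕜 := ℝ) (hψL j).1) (.of_forall fun ω => ?_)
    refine (norm_inner_le_norm (ψ i ω) (ψ j ω)).trans ?_
    rw [Pi.add_apply]
    nlinarith [sq_nonneg (‖ψ i ω‖ - ‖ψ j ω‖), norm_nonneg (ψ i ω), norm_nonneg (ψ j ω)]
  -- The square splits into a constant, a term linear in the centred samples, with mean zero, and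
  -- their Gram sum, of which only the diagonal survives integration.
  have e : (fun ω => ‖a + b • ((N : ℝ)⁻¹ • ∑ i ∈ Finset.range N, φ (W i ω) - m)‖ ^ 2) =
      fun ω => ‖a‖ ^ 2 + (2 * (b / N) * ∑ i ∈ Finset.range N, inner ℝ a (ψ i ω) +
        (b / N) ^ 2 * ∑ i ∈ Finset.range N, ∑ j ∈ Finset.range N, inner ℝ (ψ i ω) (ψ j ω)) := by
    funext ω
    have h1 : b • ((N : ℝ)⁻¹ • ∑ i ∈ Finset.range N, φ (W i ω) - m) =
        (b / N) • ∑ i ∈ Finset.range N, ψ i ω := by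
      simp only [hψ, Finset.sum_sub_distrib, Finset.sum_const, Finset.card_range, smul_sub,
        smul_smul, ← Nat.cast_smul_eq_nsmul ℝ]
      rw [div_mul_cancel₀ _ hN', div_eq_mul_inv]
    rw [h1, norm_add_sq_real, inner_smul_right, inner_sum, norm_smul, mul_pow, Real.norm_eq_abs,
      sq_abs, ← real_inner_self_eq_norm_sq (∑ i ∈ Finset.range N, ψ i ω), sum_inner]
    simp_rw [inner_sum]
    ring
  have i1 : Integrable (fun ω => ∑ i ∈ Finset.range N, inner ℝ a (ψ i ω)) P :=
    integrable_finsetSum _ fun i _ => (hψi i).const_inner a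
  have i2 : Integrable (fun ω => ∑ i ∈ Finset.range N, ∑ j ∈ Finset.range N,
      inner ℝ (ψ i ω) (ψ j ω)) P :=
    integrable_finsetSum _ fun i _ => integrable_finsetSum _ fun j _ => hii i j
  rw [e]
  refine ⟨(integrable_const _).add ((i1.const_mul _).add (i2.const_mul _)), ?_⟩
  have i3 : Integrable (fun ω => 2 * (b / N) * ∑ i ∈ Finset.range N, inner ℝ a (ψ i ω) +
      (b / N) ^ 2 * ∑ i ∈ Finset.range N, ∑ j ∈ Finset.range N, inner ℝ (ψ i ω) (ψ j ω)) P :=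
    (i1.const_mul _).add (i2.const_mul _)
  rw [integral_add (integrable_const _) i3,
    integral_add (i1.const_mul _) (i2.const_mul _), integral_const_mul, integral_const_mul,
    integral_finsetSum _ fun i _ => (hψi i).const_inner a,
    integral_finsetSum _ fun i _ => integrable_finsetSum _ fun j _ => hii i j]
  have h1 : ∑ i ∈ Finset.range N, ∫ ω, inner ℝ a (ψ i ω) ∂P = 0 :=
    Finset.sum_eq_zero fun i _ => by rw [integral_inner (hψi i), hψ0, inner_zero_right]
  have h2 : ∑ i ∈ Finset.range N, ∫ ω, ∑ j ∈ Finset.range N, inner ℝ (ψ i ω) (ψ j ω) ∂P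
      ≤ N * τ := by
    calc _ ≤ ∑ i ∈ Finset.range N, τ := by
          refine Finset.sum_le_sum fun i hi => ?_
          rw [integral_finsetSum _ fun j _ => hii i j, Finset.sum_eq_single_of_mem i hi
            fun j _ hj => hψij i j hj.symm]
          exact hψv i
      _ = N * τ := by simp
  rw [h1]
  simp only [integral_const, probReal_univ, one_smul, mul_zero, zero_add]
  have h3 : b ^ 2 * (τ / N) = (b / N) ^ 2 * (N * τ) := by field_simp
  rw [h3]
  gcongr

end MiniBatch

/-! ### Moments of the stochastic directions. -/

section Samples

variable {X Y : Type*} [NormedAddCommGroup X] [InnerProductSpace ℝ X] [CompleteSpace X]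
  [NormedAddCommGroup Y] [InnerProductSpace ℝ Y] [CompleteSpace Y]
  [FiniteDimensional ℝ X] [FiniteDimensional ℝ Y]
  [MeasurableSpace X] [BorelSpace X] [MeasurableSpace Y] [BorelSpace Y]
  {Ξ Z : Type*} [MeasurableSpace Ξ] [MeasurableSpace Z]
  {B : Problem X Y Ξ Z} {Lf L1g L2g : ℝ≥0} {Cf μ σf σg1 σg2 : ℝ}

namespace Problem

theorem ExpectationForm.gradient_F (hE : B.ExpectationForm) (hU : B.UpperLevel Lf Cf)
    (hV : B.BoundedVariance σf σg1 σg2) (v : Joint X Y) :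
    MemLp (fun s => gradient (fun w => B.F w s) v) 2 B.lawF ∧
      ∫ s, gradient (fun w => B.F w s) v ∂B.lawF = gradient B.f v :=
  haveI := hE.probF
  integral_gradient hE.differentiable_F hE.measurable_F hE.integrable_F (fun _ => rfl)
    hU.differentiable hU.lipschitz_gradient hV.gradF v

theorem ExpectationForm.gradient_G (hE : B.ExpectationForm) (hL : B.LowerLevel L1g L2g μ)
    (hV : B.BoundedVariance σf σg1 σg2) (v : Joint X Y) :
    MemLp (fun s => gradient (fun w => B.G w s) v) 2 B.lawG ∧
      ∫ s, gradient (fun w => B.G w s) v ∂B.lawG = gradient B.g v :=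
  haveI := hE.probG
  integral_gradient hE.differentiable_G hE.measurable_G hE.integrable_G (fun _ => rfl)
    hL.differentiable hL.lipschitz_gradient hV.gradG v

theorem ExpectationForm.measurable_hess_G (hE : B.ExpectationForm) (v w : Joint X Y) :
    Measurable fun s => hess (fun w => B.G w s) v w :=
  (measurable_fderiv_gradient hE.differentiable_G hE.differentiable_gradient_G hE.measurable_G).comp
    (g := fun p : (Joint X Y × Z) × Joint X Y =>
      fderiv ℝ (gradient fun v => B.G v p.1.2) p.1.1 p.2)
    (f := fun s => ((v, s), w)) (by fun_prop)

theorem ExpectationForm.integrable_hess_G (hE : B.ExpectationForm)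
    (hV : B.BoundedVariance σf σg1 σg2) (v w : Joint X Y) :
    MemLp (fun s => hess (fun w => B.G w s) v w) 2 B.lawG ∧
      ∫ s, ‖hess (fun w => B.G w s) v w - hess B.g v w‖ ^ 2 ∂B.lawG ≤ ‖w‖ ^ 2 * σg2 ^ 2 := by
  have := hE.probG
  have hb : ∀ s, ‖hess (fun w => B.G w s) v w - hess B.g v w‖ ^ 2
      ≤ ‖w‖ ^ 2 * ‖hess (fun w => B.G w s) v - hess B.g v‖ ^ 2 := fun s => by
    rw [← mul_pow, mul_comm ‖w‖]
    gcongr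
    exact (hess (fun w => B.G w s) v - hess B.g v).le_opNorm w
  have hm := hE.measurable_hess_G v w
  have hi : Integrable (fun s => ‖hess (fun w => B.G w s) v w - hess B.g v w‖ ^ 2) B.lawG := by
    refine ((hV.hessG v).1.const_mul (‖w‖ ^ 2)).mono'
      ((hm.sub_const _).norm.pow_const 2).aestronglyMeasurable (.of_forall fun s => ?_)
    rw [Real.norm_eq_abs, abs_of_nonneg (by positivity)]
    exact hb s
  refine ⟨memLp_two_of_integrable_sq_sub hm.aestronglyMeasurable hi, ?_⟩
  refine (integral_mono hi ((hV.hessG v).1.const_mul (‖w‖ ^ 2)) hb).trans ?_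
  rw [integral_const_mul]
  gcongr
  exact (hV.hessG v).2

/-- The interchange is applied to `⟨∇G, e⟩`, whose expectation is `⟨∇g, e⟩` by unbiasedness of the
gradient. The `L²` bound along the segment uses `‖∇²g‖ ≤ L1g`. -/
theorem ExpectationForm.integral_hess_G (hE : B.ExpectationForm) (hL : B.LowerLevel L1g L2g μ)
    (hV : B.BoundedVariance σf σg1 σg2) (v w : Joint X Y) :
    ∫ s, hess (fun w => B.G w s) v w ∂B.lawG = hess B.g v w := by
  have := hE.probG
  refine ext_inner_right ℝ fun e => ?_
  have hint := fun v w => (hE.integrable_hess_G hV v w).1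
  rw [real_inner_comm, ← integral_inner ((hint v w).integrable one_le_two)]
  have hφ : ∀ v, ∫ s, inner ℝ (gradient (fun w => B.G w s) v) e ∂B.lawG
      = inner ℝ (gradient B.g v) e := fun v => by
    have h1 := hE.gradient_G hL hV v
    rw [← h1.2, real_inner_comm, ← integral_inner (h1.1.integrable one_le_two)]
    simp_rw [real_inner_comm]
  have hfd : ∀ s v w, fderiv ℝ (fun v => inner ℝ (gradient (fun w => B.G w s) v) e) v w
      = inner ℝ (hess (fun w => B.G w s) v w) e := fun s v w => by
    rw [fderiv_inner_apply ℝ (hE.differentiable_gradient_G s v) (differentiableAt_const e)]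
    simp [hess]
  have hfd' : ∀ v w, fderiv ℝ (fun v => inner ℝ (gradient B.g v) e) v w
      = inner ℝ (hess B.g v w) e := fun v w => by
    rw [fderiv_inner_apply ℝ (hL.differentiable_gradient v) (differentiableAt_const e)]
    simp [hess]
  have hi2 : ∀ v, Integrable (fun s => inner ℝ (hess (fun w => B.G w s) v w) e ^ 2) B.lawG :=
    fun v => by
      have h1 : MemLp (fun s => inner ℝ (hess (fun w => B.G w s) v w) e) 2 B.lawG :=
        (hint v w).inner_const e
      exact h1.integrable_sq
  have hb : ∀ v s, inner ℝ (hess (fun w => B.G w s) v w) e ^ 2 ≤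
      2 * (‖w‖ * ‖e‖) ^ 2 * ‖hess (fun w => B.G w s) v - hess B.g v‖ ^ 2 +
        2 * (‖w‖ * ‖e‖) ^ 2 * L1g ^ 2 := fun v s => by
    have h1 := abs_real_inner_le_norm (hess (fun w => B.G w s) v w) e
    have h2 := (hess (fun w => B.G w s) v).le_opNorm w
    have h3 := norm_le_insert' (hess (fun w => B.G w s) v) (hess B.g v)
    have h4 := hL.norm_hess_le v
    set p := ‖hess (fun w => B.G w s) v - hess B.g v‖
    have h5 : |inner ℝ (hess (fun w => B.G w s) v w) e| ≤ (p + L1g) * (‖w‖ * ‖e‖) := by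
      rw [← mul_assoc]
      refine h1.trans (mul_le_mul_of_nonneg_right (h2.trans ?_) (norm_nonneg _))
      exact mul_le_mul_of_nonneg_right (by linarith) (norm_nonneg _)
    calc _ = |inner ℝ (hess (fun w => B.G w s) v w) e| ^ 2 := (sq_abs _).symm
      _ ≤ ((p + L1g) * (‖w‖ * ‖e‖)) ^ 2 := by gcongr
      _ ≤ _ := by
        rw [mul_pow]
        nlinarith [mul_nonneg (sq_nonneg (p - L1g)) (sq_nonneg (‖w‖ * ‖e‖))]
  have := integral_fderiv_apply (ν := B.lawG)
    (φ := fun v s => inner ℝ (gradient (fun w => B.G w s) v) e) (v := v) (w := w)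
    (C := 2 * (‖w‖ * ‖e‖) ^ 2 * σg2 ^ 2 + 2 * (‖w‖ * ‖e‖) ^ 2 * L1g ^ 2)
    (fun s => (hE.differentiable_gradient_G s).inner ℝ (differentiable_const e))
    (fun v => ((measurable_gradient hE.differentiable_G hE.measurable_G).comp
      (measurable_const.prodMk measurable_id)).inner_const)
    (fun v => ((hE.gradient_G hL hV v).1.integrable one_le_two).inner_const e)
    (by
      simp_rw [hφ]
      exact ((hL.differentiable_gradient).inner ℝ (differentiable_const e)) v)
    (fun u _ => by simp_rw [hfd]; exact hi2 _)
    (fun u _ => by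
      simp_rw [hfd]
      refine (integral_mono (hi2 _) (((hV.hessG _).1.const_mul _).add (integrable_const _))
        (hb _)).trans ?_
      rw [integral_add' ((hV.hessG _).1.const_mul _) (integrable_const _), integral_const_mul]
      simp only [integral_const, probReal_univ, one_smul]
      gcongr
      exact (hV.hessG _).2)
  simp_rw [hφ, hfd, hfd'] at this
  rw [← this]
  simp_rw [real_inner_comm]

/-- The law of a pair of samples. -/
def law (B : Problem X Y Ξ Z) : Measure (Ξ × Z) := B.lawF.prod B.lawG

/-- The stochastic gradient `∇₂ G`. -/
def sampleY (B : Problem X Y Ξ Z) (v : Joint X Y) (s : Ξ × Z) : Y := grad₂ (fun w => B.G w s.2) v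

/-- The stochastic direction `∇²₂₂ G z - ∇₂ F`. -/
def sampleZ (B : Problem X Y Ξ Z) (v : Joint X Y) (z : Y) (s : Ξ × Z) : Y :=
  hess₂₂ (fun w => B.G w s.2) v z - grad₂ (fun w => B.F w s.1) v

/-- The stochastic direction `∇₁ F - ∇²₁₂ G z`. -/
def sampleX (B : Problem X Y Ξ Z) (v : Joint X Y) (z : Y) (s : Ξ × Z) : X :=
  grad₁ (fun w => B.F w s.1) v - hess₁₂ (fun w => B.G w s.2) v z

section

variable {T : Type*} [MeasurableSpace T] {v : T → Joint X Y} {z : T → Y} {s : T → Ξ × Z}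

theorem ExpectationForm.measurable_gradient_F_comp (hE : B.ExpectationForm) (hv : Measurable v)
    (hs : Measurable s) : Measurable fun t => gradient (fun w => B.F w (s t).1) (v t) :=
  (measurable_gradient hE.differentiable_F hE.measurable_F).comp
    (hv.prodMk (measurable_fst.comp hs))

theorem ExpectationForm.measurable_gradient_G_comp (hE : B.ExpectationForm) (hv : Measurable v)
    (hs : Measurable s) : Measurable fun t => gradient (fun w => B.G w (s t).2) (v t) :=
  (measurable_gradient hE.differentiable_G hE.measurable_G).comp
    (hv.prodMk (measurable_snd.comp hs))

theorem measurable_pt {x : T → X} {y : T → Y} (hx : Measurable x) (hy : Measurable y) :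
    Measurable fun t => pt (x t) (y t) :=
  continuous_pt.measurable.comp (hx.prodMk hy)

theorem ExpectationForm.measurable_hess_G_comp (hE : B.ExpectationForm) (hv : Measurable v)
    (hz : Measurable z) (hs : Measurable s) :
    Measurable fun t => hess (fun w => B.G w (s t).2) (v t) (pt 0 (z t)) :=
  (measurable_fderiv_gradient hE.differentiable_G hE.differentiable_gradient_G hE.measurable_G).comp
    (g := fun p : (Joint X Y × Z) × Joint X Y =>
      fderiv ℝ (gradient fun v => B.G v p.1.2) p.1.1 p.2)
    (f := fun t => ((v t, (s t).2), pt 0 (z t)))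
    ((hv.prodMk (measurable_snd.comp hs)).prodMk (measurable_pt measurable_const hz))

theorem ExpectationForm.measurable_sampleY (hE : B.ExpectationForm) (hv : Measurable v)
    (hs : Measurable s) : Measurable fun t => B.sampleY (v t) (s t) :=
  (Joint.sndL (X := X) (Y := Y)).continuous.measurable.comp (hE.measurable_gradient_G_comp hv hs)

theorem ExpectationForm.measurable_sampleZ (hE : B.ExpectationForm) (hv : Measurable v)
    (hz : Measurable z) (hs : Measurable s) : Measurable fun t => B.sampleZ (v t) (z t) (s t) :=
  ((Joint.sndL (X := X) (Y := Y)).continuous.measurable.comp (hE.measurable_hess_G_comp hv hz hs)).sub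
    ((Joint.sndL (X := X) (Y := Y)).continuous.measurable.comp (hE.measurable_gradient_F_comp hv hs))

theorem ExpectationForm.measurable_sampleX (hE : B.ExpectationForm) (hv : Measurable v)
    (hz : Measurable z) (hs : Measurable s) : Measurable fun t => B.sampleX (v t) (z t) (s t) :=
  ((Joint.fstL (X := X) (Y := Y)).continuous.measurable.comp (hE.measurable_gradient_F_comp hv hs)).sub
    ((Joint.fstL (X := X) (Y := Y)).continuous.measurable.comp (hE.measurable_hess_G_comp hv hz hs))

end

/-- The moments of a sample direction: square integrability, mean and variance. -/
structure Moments {T E : Type*} [MeasurableSpace T] [NormedAddCommGroup E] [NormedSpace ℝ E]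
    (ν : Measure T) (φ : T → E) (m : E) (τ : ℝ) : Prop where
  memLp : MemLp φ 2 ν
  mean : ∫ s, φ s ∂ν = m
  var : ∫ s, ‖φ s - m‖ ^ 2 ∂ν ≤ τ

section Moments

variable {T T' E E' : Type*} [MeasurableSpace T] [MeasurableSpace T']
  [NormedAddCommGroup E] [NormedSpace ℝ E] [CompleteSpace E]
  [NormedAddCommGroup E'] [NormedSpace ℝ E'] [CompleteSpace E'] {ν : Measure T} {ν' : Measure T'}
  [IsProbabilityMeasure ν] [IsProbabilityMeasure ν']

theorem Moments.integrable {φ : T → E} {m : E} {τ : ℝ} (h : Moments ν φ m τ) : Integrable φ ν :=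
  h.memLp.integrable one_le_two

theorem Moments.integrable_sq {φ : T → E} {m : E} {τ : ℝ} (h : Moments ν φ m τ) :
    Integrable (fun s => ‖φ s - m‖ ^ 2) ν :=
  (memLp_two_iff_integrable_sq_norm
    (h.memLp.1.sub aestronglyMeasurable_const)).1 (h.memLp.sub (memLp_const m))

theorem Moments.comp {φ : T → E} {m : E} {τ : ℝ} (h : Moments ν φ m τ) {π : T' → T}
    (hπ : MeasurePreserving π ν' ν) : Moments ν' (fun s => φ (π s)) m τ where
  memLp := h.memLp.comp_measurePreserving hπ
  mean := by
    rw [← h.mean, ← hπ.map_eq, integral_map hπ.measurable.aemeasurable]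
    rw [hπ.map_eq]; exact h.memLp.1
  var := by
    refine le_of_eq_of_le ?_ h.var
    rw [← hπ.map_eq, integral_map hπ.measurable.aemeasurable]
    rw [hπ.map_eq]
    exact h.integrable_sq.1

theorem Moments.clm {φ : T → E} {m : E} {τ : ℝ} (h : Moments ν φ m τ) (A : E →L[ℝ] E')
    (hA : ∀ v, ‖A v‖ ≤ ‖v‖) : Moments ν (fun s => A (φ s)) (A m) τ where
  memLp := A.comp_memLp' h.memLp
  mean := by rw [A.integral_comp_comm h.integrable, h.mean]
  var := by
    have h1 : Integrable (fun s => ‖A (φ s) - A m‖ ^ 2) ν :=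
      (memLp_two_iff_integrable_sq_norm
        ((A.comp_memLp' h.memLp).1.sub aestronglyMeasurable_const)).1
        ((A.comp_memLp' h.memLp).sub (memLp_const (A m)))
    refine (integral_mono h1 h.integrable_sq fun s => ?_).trans h.var
    dsimp only
    rw [← map_sub]
    gcongr
    exact hA _

/-- The factors `2` come from `‖a - b‖² ≤ 2‖a‖² + 2‖b‖²`, so the two terms may be correlated. -/
theorem Moments.sub {φ ψ : T → E} {m m' : E} {τ τ' : ℝ} (h : Moments ν φ m τ)
    (h' : Moments ν ψ m' τ') : Moments ν (fun s => φ s - ψ s) (m - m') (2 * τ + 2 * τ') where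
  memLp := h.memLp.sub h'.memLp
  mean := by rw [integral_sub h.integrable h'.integrable, h.mean, h'.mean]
  var := by
    have h1 : Integrable (fun s => ‖φ s - ψ s - (m - m')‖ ^ 2) ν :=
      (memLp_two_iff_integrable_sq_norm
        ((h.memLp.sub h'.memLp).1.sub aestronglyMeasurable_const)).1
        ((h.memLp.sub h'.memLp).sub (memLp_const (m - m')))
    refine (integral_mono h1 ((h.integrable_sq.const_mul 2).add (h'.integrable_sq.const_mul 2))
      fun s => ?_).trans ?_
    · dsimp only [Pi.add_apply]
      rw [sub_sub_sub_comm]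
      have h2 := norm_sub_le (φ s - m) (ψ s - m')
      have h3 := pow_le_pow_left₀ (norm_nonneg _) h2 2
      nlinarith [sq_nonneg (‖φ s - m‖ - ‖ψ s - m'‖)]
    · rw [integral_add' (h.integrable_sq.const_mul 2) (h'.integrable_sq.const_mul 2),
        integral_const_mul, integral_const_mul]
      linarith [h.var, h'.var]

end Moments

section

variable (hE : B.ExpectationForm) (hU : B.UpperLevel Lf Cf) (hL : B.LowerLevel L1g L2g μ)
  (hV : B.BoundedVariance σf σg1 σg2)

include hE

theorem ExpectationForm.isProbabilityMeasure_law : IsProbabilityMeasure B.law := by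
  have := hE.probF; have := hE.probG
  rw [law]; infer_instance

theorem ExpectationForm.measurePreserving_fst_law : MeasurePreserving Prod.fst B.law B.lawF := by
  have := hE.probF; have := hE.probG
  exact measurePreserving_fst

theorem ExpectationForm.measurePreserving_snd_law : MeasurePreserving Prod.snd B.law B.lawG := by
  have := hE.probF; have := hE.probG
  exact measurePreserving_snd

include hV

include hL in
theorem ExpectationForm.moments_sampleY (v : Joint X Y) :
    Moments B.law (B.sampleY v) (grad₂ B.g v) (σg1 ^ 2) := by
  have := hE.probG; have := hE.isProbabilityMeasure_law
  have h1 : Moments B.lawG (fun s => gradient (fun w => B.G w s) v) (gradient B.g v) (σg1 ^ 2) :=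
    ⟨(hE.gradient_G hL hV v).1, (hE.gradient_G hL hV v).2, (hV.gradG v).2⟩
  exact (h1.comp hE.measurePreserving_snd_law).clm Joint.sndL norm_snd_le

include hU in
theorem ExpectationForm.moments_gradient_F (v : Joint X Y) :
    Moments B.law (fun s => gradient (fun w => B.F w s.1) v) (gradient B.f v) (σf ^ 2) := by
  have := hE.probF; have := hE.isProbabilityMeasure_law
  have h1 : Moments B.lawF (fun s => gradient (fun w => B.F w s) v) (gradient B.f v) (σf ^ 2) :=
    ⟨(hE.gradient_F hU hV v).1, (hE.gradient_F hU hV v).2, (hV.gradF v).2⟩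
  exact h1.comp hE.measurePreserving_fst_law

include hL in
theorem ExpectationForm.moments_hess_G (v : Joint X Y) (z : Y) :
    Moments B.law (fun s => hess (fun w => B.G w s.2) v (pt 0 z)) (hess B.g v (pt 0 z))
      (‖z‖ ^ 2 * σg2 ^ 2) := by
  have := hE.probG; have := hE.isProbabilityMeasure_law
  have h1 : Moments B.lawG (fun s => hess (fun w => B.G w s) v (pt 0 z)) (hess B.g v (pt 0 z))
      (‖z‖ ^ 2 * σg2 ^ 2) :=
    ⟨(hE.integrable_hess_G hV v _).1, hE.integral_hess_G hL hV v _, by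
      simpa using (hE.integrable_hess_G hV v (pt 0 z)).2⟩
  exact h1.comp hE.measurePreserving_snd_law

include hU hL

theorem ExpectationForm.moments_sampleZ (v : Joint X Y) (z : Y) :
    Moments B.law (B.sampleZ v z) (hess₂₂ B.g v z - grad₂ B.f v)
      (2 * (‖z‖ ^ 2 * σg2 ^ 2) + 2 * σf ^ 2) := by
  have := hE.isProbabilityMeasure_law
  exact ((hE.moments_hess_G hL hV v z).clm Joint.sndL norm_snd_le).sub
    ((hE.moments_gradient_F hU hV v).clm Joint.sndL norm_snd_le)

theorem ExpectationForm.moments_sampleX (v : Joint X Y) (z : Y) :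
    Moments B.law (B.sampleX v z) (grad₁ B.f v - hess₁₂ B.g v z)
      (2 * σf ^ 2 + 2 * (‖z‖ ^ 2 * σg2 ^ 2)) := by
  have := hE.isProbabilityMeasure_law
  exact ((hE.moments_gradient_F hU hV v).clm Joint.fstL norm_fst_le).sub
    ((hE.moments_hess_G hL hV v z).clm Joint.fstL norm_fst_le)

end

end Problem

end Samples

/-! ### Contraction inequalities. -/

section Contraction

variable {E : Type*} [NormedAddCommGroup E] [InnerProductSpace ℝ E]

/-- Young's inequality for a contraction with a perturbation. -/
theorem norm_add_sq_le_of_contraction {A b : E} {d τ : ℝ} (hτ : 0 < τ) (hτ' : τ ≤ 1 / 2)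
    (hd : 0 ≤ d) (hA : ‖A‖ ^ 2 ≤ (1 - 2 * τ) * d) :
    ‖A + b‖ ^ 2 ≤ (1 - τ) * d + ‖b‖ ^ 2 / τ := by
  have h1 : ‖A + b‖ ^ 2 ≤ (‖A‖ + ‖b‖) ^ 2 := by gcongr; exact norm_add_le _ _
  refine h1.trans ?_
  set p := ‖A‖
  set q := ‖b‖
  -- This is `(p + q)² ≤ p²/(1 - τ) + q²/τ` without denominators. The loss `1/(1 - τ)` is
  -- compensated by `1 - 2τ ≤ (1 - τ)²`.
  have h2 : τ * (1 - τ) * ((p + q) ^ 2) ≤ τ * p ^ 2 + (1 - τ) * q ^ 2 := by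
    nlinarith [sq_nonneg (τ * p - (1 - τ) * q)]
  have h3 : τ * p ^ 2 ≤ τ * ((1 - τ) ^ 2 * d) := by
    refine mul_le_mul_of_nonneg_left (hA.trans ?_) hτ.le
    exact mul_le_mul_of_nonneg_right (by nlinarith) hd
  have h4 : (1 - τ) * (τ * (p + q) ^ 2) ≤ (1 - τ) * (τ * ((1 - τ) * d + q ^ 2 / τ)) := by
    have e : τ * ((1 - τ) * d + q ^ 2 / τ) = τ * (1 - τ) * d + q ^ 2 := by field_simp
    rw [e]; nlinarith
  exact le_of_mul_le_mul_left (le_of_mul_le_mul_left h4 (by linarith)) hτ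

/-- A gradient step for a strongly monotone Lipschitz operator is a contraction. -/
theorem norm_sub_smul_sq_le {w m : E} {β μ L : ℝ} (hβ : 0 ≤ β) (hβL : β * L ^ 2 ≤ μ)
    (hm : μ * ‖w‖ ^ 2 ≤ inner ℝ m w) (hL : ‖m‖ ≤ L * ‖w‖) :
    ‖w - β • m‖ ^ 2 ≤ (1 - 2 * (β * μ / 2)) * ‖w‖ ^ 2 := by
  rw [norm_sub_sq_real, inner_smul_right, norm_smul, mul_pow, Real.norm_eq_abs, sq_abs,
    real_inner_comm]
  have h1 : ‖m‖ ^ 2 ≤ L ^ 2 * ‖w‖ ^ 2 := by rw [← mul_pow]; gcongr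
  have h2 : β ^ 2 * ‖m‖ ^ 2 ≤ β * μ * ‖w‖ ^ 2 := by
    calc β ^ 2 * ‖m‖ ^ 2 ≤ β ^ 2 * (L ^ 2 * ‖w‖ ^ 2) := by gcongr
      _ = β * (β * L ^ 2) * ‖w‖ ^ 2 := by ring
      _ ≤ β * μ * ‖w‖ ^ 2 := by gcongr
  nlinarith

/-- A convex combination of an error with two perturbations. -/
theorem norm_smul_add_smul_add_sq_le {e b d : E} {ρ : ℝ} (hρ : 0 < ρ) (hρ1 : ρ ≤ 1) :
    ‖(1 - ρ) • e + ρ • b + d‖ ^ 2 ≤ (1 - ρ) * ‖e‖ ^ 2 + 2 * ρ * ‖b‖ ^ 2 + 2 / ρ * ‖d‖ ^ 2 := by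
  have h0 : ‖(1 - ρ) • e + ρ • b + d‖ ≤ (1 - ρ) * ‖e‖ + ρ * ‖b‖ + ‖d‖ := by
    refine (norm_add₃_le).trans ?_
    rw [norm_smul, norm_smul, Real.norm_eq_abs, Real.norm_eq_abs, abs_of_nonneg hρ.le,
      abs_of_nonneg (sub_nonneg.2 hρ1)]
  set p := ‖e‖
  set q := ‖b‖
  set r := ‖d‖ / ρ with hr
  have hd : ‖d‖ = ρ * r := by rw [hr]; field_simp
  have e2 : 2 / ρ * ‖d‖ ^ 2 = 2 * ρ * r ^ 2 := by rw [hd]; field_simp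
  rw [e2]
  rw [hd] at h0
  have h1 := pow_le_pow_left₀ (norm_nonneg _) h0 2
  refine h1.trans ?_
  -- Convexity of the square: after writing the drift as `ρ r`, the sum is a convex combination of
  -- `p` and `q + r`.
  have h2 : ((1 - ρ) * p + ρ * q + ρ * r) ^ 2 ≤ (1 - ρ) * p ^ 2 + ρ * (q + r) ^ 2 := by
    nlinarith [mul_nonneg (mul_nonneg hρ.le (sub_nonneg.2 hρ1)) (sq_nonneg (p - (q + r)))]
  nlinarith [mul_nonneg hρ.le (sq_nonneg (q - r))]

end Contraction

/-! ### One-step bounds for the three errors. -/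

section OneStep

variable {X Y : Type*} [NormedAddCommGroup X] [InnerProductSpace ℝ X] [CompleteSpace X]
  [NormedAddCommGroup Y] [InnerProductSpace ℝ Y] [CompleteSpace Y]
  [FiniteDimensional ℝ X] [FiniteDimensional ℝ Y]
  [MeasurableSpace X] [BorelSpace X] [MeasurableSpace Y] [BorelSpace Y]
  {Ξ Z : Type*} [MeasurableSpace Ξ] [MeasurableSpace Z]
  {B : Problem X Y Ξ Z} {Lf L1g L2g : ℝ≥0} {Cf μ σf σg1 σg2 : ℝ}

namespace Problem

/-- The regularity constants of a problem. -/
structure Regularity (B : Problem X Y Ξ Z) (L μ Z0 M Ly Lz LH Q σf σg1 σg2 : ℝ) : Prop where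
  μ_pos : 0 < μ
  strong_monotone : ∀ x y y',
    μ * ‖y' - y‖ ^ 2 ≤ inner ℝ (grad₂ B.g (pt x y') - grad₂ B.g (pt x y)) (y' - y)
  grad₂_lipschitz : ∀ v w, ‖grad₂ B.g v - grad₂ B.g w‖ ≤ L * ‖v - w‖
  coercive : ∀ v w, μ * ‖w‖ ^ 2 ≤ inner ℝ (hess₂₂ B.g v w) w
  norm_hess₂₂_le : ∀ v z, ‖hess₂₂ B.g v z‖ ≤ L * ‖z‖
  norm_hess₁₂_le : ∀ v z, ‖hess₁₂ B.g v z‖ ≤ L * ‖z‖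
  grad₂_yStar : ∀ x, grad₂ B.g (pt x (B.yStar x)) = 0
  hess₂₂_zStar : ∀ x, hess₂₂ B.g (pt x (B.yStar x)) (B.zStar x) = grad₂ B.f (pt x (B.yStar x))
  norm_zStar_le : ∀ x, ‖B.zStar x‖ ≤ Z0
  dirZ_lipschitz : ∀ v w x, ‖(hess₂₂ B.g v (B.zStar x) - grad₂ B.f v) -
    (hess₂₂ B.g w (B.zStar x) - grad₂ B.f w)‖ ≤ M * ‖v - w‖
  dirX_lipschitz : ∀ v w x, ‖(grad₁ B.f v - hess₁₂ B.g v (B.zStar x)) -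
    (grad₁ B.f w - hess₁₂ B.g w (B.zStar x))‖ ≤ M * ‖v - w‖
  yStar_lipschitz : ∀ x x', ‖B.yStar x - B.yStar x'‖ ≤ Ly * ‖x - x'‖
  zStar_lipschitz : ∀ x x', ‖B.zStar x - B.zStar x'‖ ≤ Lz * ‖x - x'‖
  hyperGrad_lipschitz : ∀ x x', ‖B.hyperGrad x - B.hyperGrad x'‖ ≤ LH * ‖x - x'‖
  quadratic : ∀ x x', |B.H x' - B.H x - inner ℝ (B.hyperGrad x) (x' - x)| ≤ Q * ‖x' - x‖ ^ 2
  moments_sampleY : ∀ v, Moments B.law (B.sampleY v) (grad₂ B.g v) (σg1 ^ 2)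
  moments_sampleZ : ∀ v z, Moments B.law (B.sampleZ v z) (hess₂₂ B.g v z - grad₂ B.f v)
    (2 * (‖z‖ ^ 2 * σg2 ^ 2) + 2 * σf ^ 2)
  moments_sampleX : ∀ v z, Moments B.law (B.sampleX v z) (grad₁ B.f v - hess₁₂ B.g v z)
    (2 * σf ^ 2 + 2 * (‖z‖ ^ 2 * σg2 ^ 2))

theorem regularity (hE : B.ExpectationForm) (hU : B.UpperLevel Lf Cf)
    (hL : B.LowerLevel L1g L2g μ) (hV : B.BoundedVariance σf σg1 σg2) (hμ : 0 < μ) :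
    B.Regularity L1g μ (Cf / μ) (Lf + L2g * (Cf / μ)) (L1g / μ)
      ((Lf + L2g * (Cf / μ)) * (1 + L1g / μ) / μ)
      ((Lf + L2g * (Cf / μ)) * (1 + L1g / μ) +
        L1g * ((Lf + L2g * (Cf / μ)) * (1 + L1g / μ) / μ))
      ((Lf + L2g * (Cf / μ)) * (1 + L1g / μ) ^ 2) σf σg1 σg2 where
  μ_pos := hμ
  strong_monotone := hL.strong_monotone
  grad₂_lipschitz := hL.norm_grad₂_sub_le
  coercive := hL.hess₂₂_coercive
  norm_hess₂₂_le := hL.norm_hess₂₂_le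
  norm_hess₁₂_le := hL.norm_hess₁₂_le
  grad₂_yStar := hL.grad₂_yStar hμ
  hess₂₂_zStar := hL.hess₂₂_zStar hμ
  norm_zStar_le := Problem.norm_zStar_le hU hL hμ
  dirZ_lipschitz := norm_grad₂_sub_hess₂₂_sub_le hU hL hμ
  dirX_lipschitz := norm_grad₁_sub_hess₁₂_sub_le hU hL hμ
  yStar_lipschitz := hL.norm_yStar_sub_le hμ
  zStar_lipschitz := norm_zStar_sub_le hU hL hμ
  hyperGrad_lipschitz := norm_hyperGrad_sub_le hU hL hμ
  quadratic := abs_H_sub_sub_inner_le hU hL hμ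
  moments_sampleY := hE.moments_sampleY hL hV
  moments_sampleZ := hE.moments_sampleZ hU hL hV
  moments_sampleX := hE.moments_sampleX hU hL hV

variable {L Z0 M Ly Lz LH Q : ℝ} {Ω : Type*} [MeasurableSpace Ω] {P : Measure Ω}
  [IsProbabilityMeasure P] {W : ℕ → Ω → Ξ × Z} {N : ℕ}

/-- A sequence of independent samples. -/
structure IID (B : Problem X Y Ξ Z) (P : Measure Ω) (W : ℕ → Ω → Ξ × Z) : Prop where
  measurable : ∀ i, Measurable (W i)
  map_eq : ∀ i, P.map (W i) = B.law
  indep : iIndepFun W P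

/-- The mini-batch average. -/
def batchAverage {E T : Type*} [AddCommGroup E] [Module ℝ E] (N : ℕ) (φ : T → E) (w : ℕ → T) : E :=
  (N : ℝ)⁻¹ • ∑ i ∈ Finset.range N, φ (w i)

theorem IID.integral_le {E : Type*} [NormedAddCommGroup E] [InnerProductSpace ℝ E]
    [FiniteDimensional ℝ E] [CompleteSpace E] [MeasurableSpace E] [BorelSpace E]
    (hW : B.IID P W) {φ : Ξ × Z → E} (hφ : Measurable φ) {m : E} {τ : ℝ}
    (h : Moments B.law φ m τ) (hN : 0 < N) (a : E) (b : ℝ) :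
    Integrable (fun ω => ‖a + b • (batchAverage N φ (fun i => W i ω) - m)‖ ^ 2) P ∧
    ∫ ω, ‖a + b • (batchAverage N φ (fun i => W i ω) - m)‖ ^ 2 ∂P ≤ ‖a‖ ^ 2 + b ^ 2 * (τ / N) :=
  integral_norm_add_smul_average_sub_le hW.measurable hW.map_eq hW.indep hφ h.memLp h.mean h.var
    hN a b

variable (hR : B.Regularity L μ Z0 M Ly Lz LH Q σf σg1 σg2) (hE : B.ExpectationForm)
  (hW : B.IID P W) (hN : 0 < N)

include hR hE hW hN

/-- The new error is a contracted old error plus the drift `y*(x) - y*(x')` plus centred noise. The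
point `x'` is fixed, so the noise contributes its variance alone. -/
theorem Regularity.step_y {β : ℝ} (hβ : 0 < β) (hβL : β * L ^ 2 ≤ μ) (hβμ : β * μ ≤ 1)
    (x x' : X) (y : Y) :
    Integrable (fun ω => ‖y - β • batchAverage N (B.sampleY (pt x y)) (fun i => W i ω)
      - B.yStar x'‖ ^ 2) P ∧
    ∫ ω, ‖y - β • batchAverage N (B.sampleY (pt x y)) (fun i => W i ω) - B.yStar x'‖ ^ 2 ∂P ≤
      (1 - β * μ / 2) * ‖y - B.yStar x‖ ^ 2 + 2 / (β * μ) * (Ly ^ 2 * ‖x' - x‖ ^ 2)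
        + β ^ 2 * (σg1 ^ 2 / N) := by
  have hμ := hR.μ_pos
  set m := grad₂ B.g (pt x y) with hm
  have e : ∀ ω, y - β • batchAverage N (B.sampleY (pt x y)) (fun i => W i ω) - B.yStar x' =
      ((y - B.yStar x) - β • m + (B.yStar x - B.yStar x')) +
        (-β) • (batchAverage N (B.sampleY (pt x y)) (fun i => W i ω) - m) := fun ω => by module
  simp_rw [e]
  have h1 := hW.integral_le (hE.measurable_sampleY measurable_const measurable_id)
    (hR.moments_sampleY (pt x y)) hN ((y - B.yStar x) - β • m + (B.yStar x - B.yStar x')) (-β)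
  refine ⟨h1.1, h1.2.trans ?_⟩
  have hm' : m = grad₂ B.g (pt x y) - grad₂ B.g (pt x (B.yStar x)) := by
    rw [hR.grad₂_yStar, sub_zero]
  have h2 : ‖m‖ ≤ L * ‖y - B.yStar x‖ := by
    rw [hm']
    refine (hR.grad₂_lipschitz _ _).trans_eq ?_
    rw [pt_sub, sub_self, norm_pt_zero_left]
  have h3 : μ * ‖y - B.yStar x‖ ^ 2 ≤ inner ℝ m (y - B.yStar x) := by
    rw [hm']; exact hR.strong_monotone x (B.yStar x) y
  have h4 := norm_add_sq_le_of_contraction (b := B.yStar x - B.yStar x') (τ := β * μ / 2)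
    (by positivity) (by linarith) (sq_nonneg _) (norm_sub_smul_sq_le hβ.le hβL h3 h2)
  have h5 : ‖B.yStar x - B.yStar x'‖ ^ 2 ≤ Ly ^ 2 * ‖x' - x‖ ^ 2 := by
    rw [← mul_pow, norm_sub_rev x' x]
    exact pow_le_pow_left₀ (norm_nonneg _) (hR.yStar_lipschitz x x') 2
  have h6 : ‖B.yStar x - B.yStar x'‖ ^ 2 / (β * μ / 2) ≤
      2 / (β * μ) * (Ly ^ 2 * ‖x' - x‖ ^ 2) := by
    rw [div_div_eq_mul_div, mul_div_assoc, mul_comm]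
    gcongr
  rw [neg_sq]
  linarith

omit hE hW hN in
theorem Regularity.norm_sq_le (x : X) (z : Y) :
    ‖z‖ ^ 2 ≤ 2 * ‖z - B.zStar x‖ ^ 2 + 2 * Z0 ^ 2 := by
  have h1 := norm_le_insert' z (B.zStar x)
  have h2 := hR.norm_zStar_le x
  have h3 : ‖z‖ ^ 2 ≤ (‖z - B.zStar x‖ + Z0) ^ 2 := by
    gcongr; linarith
  nlinarith [sq_nonneg (‖z - B.zStar x‖ - Z0)]

omit hE hW in
-- The variance grows with `‖z‖²`, which is split around the bounded `z*`. The part in `‖z - z*‖²`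
-- is kept without `1/N`, to be absorbed elsewhere; the constant part keeps it and becomes the
-- genuine noise.
theorem Regularity.variance_le (x : X) (z : Y) :
    (2 * σf ^ 2 + 2 * (‖z‖ ^ 2 * σg2 ^ 2)) / N ≤
      4 * σg2 ^ 2 * ‖z - B.zStar x‖ ^ 2 + (2 * σf ^ 2 + 4 * σg2 ^ 2 * Z0 ^ 2) / N := by
  have hN1 : (1 : ℝ) ≤ N := by exact_mod_cast hN
  have a1 := mul_le_mul_of_nonneg_right (hR.norm_sq_le x z) (sq_nonneg σg2)
  calc _ ≤ (4 * σg2 ^ 2 * ‖z - B.zStar x‖ ^ 2 +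
          (2 * σf ^ 2 + 4 * σg2 ^ 2 * Z0 ^ 2)) / (N : ℝ) :=
        div_le_div_of_nonneg_right (by linarith) (by positivity)
    _ = 4 * σg2 ^ 2 * ‖z - B.zStar x‖ ^ 2 / N +
          (2 * σf ^ 2 + 4 * σg2 ^ 2 * Z0 ^ 2) / N := add_div _ _ _
    _ ≤ _ := by gcongr; exact div_le_self (by positivity) hN1

/-- Besides contraction and drift there is a residual `r`, because the system is taken at `(x, y)`
and not at `(x, y*(x))`; it is bounded by `M‖y - y*‖`. The contraction rate `γμ/2` drops to `γμ/4`
in paying for the multiplicative noise, which is the purpose of `16γσg2² ≤ μ`. -/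
theorem Regularity.step_z {γ : ℝ} (hγ : 0 < γ) (hγL : γ * L ^ 2 ≤ μ) (hγμ : γ * μ ≤ 1)
    (hγσ : 16 * γ * σg2 ^ 2 ≤ μ) (x x' : X) (y z : Y) :
    Integrable (fun ω => ‖z - γ • batchAverage N (B.sampleZ (pt x y) z) (fun i => W i ω)
      - B.zStar x'‖ ^ 2) P ∧
    ∫ ω, ‖z - γ • batchAverage N (B.sampleZ (pt x y) z) (fun i => W i ω) - B.zStar x'‖ ^ 2 ∂P ≤
      (1 - γ * μ / 4) * ‖z - B.zStar x‖ ^ 2 + 4 * γ / μ * (M ^ 2 * ‖y - B.yStar x‖ ^ 2)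
        + 4 / (γ * μ) * (Lz ^ 2 * ‖x' - x‖ ^ 2)
        + γ ^ 2 * ((2 * σf ^ 2 + 4 * σg2 ^ 2 * Z0 ^ 2) / N) := by
  have hμ := hR.μ_pos
  set v := pt x y with hv
  set m := hess₂₂ B.g v z - grad₂ B.f v with hm
  set w := z - B.zStar x with hw
  set r := hess₂₂ B.g v (B.zStar x) - grad₂ B.f v with hr
  have e : ∀ ω, z - γ • batchAverage N (B.sampleZ v z) (fun i => W i ω) - B.zStar x' =
      (w - γ • hess₂₂ B.g v w + (-(γ • r) + (B.zStar x - B.zStar x'))) +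
        (-γ) • (batchAverage N (B.sampleZ v z) (fun i => W i ω) - m) := fun ω => by
    rw [hw, hess₂₂_sub, hm, hr]; module
  simp_rw [e]
  have h1 := hW.integral_le (hE.measurable_sampleZ measurable_const measurable_const measurable_id)
    (hR.moments_sampleZ v z) hN
    (w - γ • hess₂₂ B.g v w + (-(γ • r) + (B.zStar x - B.zStar x'))) (-γ)
  refine ⟨h1.1, h1.2.trans ?_⟩
  have h4 := norm_add_sq_le_of_contraction (b := -(γ • r) + (B.zStar x - B.zStar x'))
    (τ := γ * μ / 2) (by positivity) (by linarith) (sq_nonneg ‖w‖)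
    (norm_sub_smul_sq_le hγ.le hγL (hR.coercive v w) (hR.norm_hess₂₂_le v w))
  have h5 : ‖r‖ ≤ M * ‖y - B.yStar x‖ := by
    have := hR.dirZ_lipschitz v (pt x (B.yStar x)) x
    rwa [hR.hess₂₂_zStar, sub_self, sub_zero, pt_sub, sub_self, norm_pt_zero_left] at this
  have h6 : ‖-(γ • r) + (B.zStar x - B.zStar x')‖ ^ 2 ≤
      2 * γ ^ 2 * (M ^ 2 * ‖y - B.yStar x‖ ^ 2) + 2 * (Lz ^ 2 * ‖x' - x‖ ^ 2) := by
    have a1 : ‖-(γ • r) + (B.zStar x - B.zStar x')‖ ≤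
        γ * (M * ‖y - B.yStar x‖) + Lz * ‖x' - x‖ := by
      refine (norm_add_le _ _).trans (add_le_add ?_ ?_)
      · rw [norm_neg, norm_smul, Real.norm_eq_abs, abs_of_pos hγ]; gcongr
      · rw [norm_sub_rev x' x]; exact hR.zStar_lipschitz x x'
    refine (pow_le_pow_left₀ (norm_nonneg _) a1 2).trans ?_
    nlinarith [sq_nonneg (γ * (M * ‖y - B.yStar x‖) - Lz * ‖x' - x‖)]
  have h7 : ‖-(γ • r) + (B.zStar x - B.zStar x')‖ ^ 2 / (γ * μ / 2) ≤
      4 * γ / μ * (M ^ 2 * ‖y - B.yStar x‖ ^ 2) + 4 / (γ * μ) * (Lz ^ 2 * ‖x' - x‖ ^ 2) := by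
    refine (div_le_div_of_nonneg_right h6 (by positivity)).trans_eq ?_
    field_simp
    ring
  have h8 : γ ^ 2 * ((2 * (‖z‖ ^ 2 * σg2 ^ 2) + 2 * σf ^ 2) / N) ≤
      γ * μ / 4 * ‖w‖ ^ 2 + γ ^ 2 * ((2 * σf ^ 2 + 4 * σg2 ^ 2 * Z0 ^ 2) / N) := by
    have a3 := hR.variance_le hN x z
    rw [← hw, add_comm (2 * σf ^ 2) (2 * _)] at a3
    calc _ ≤ γ ^ 2 * (4 * σg2 ^ 2 * ‖w‖ ^ 2 + (2 * σf ^ 2 + 4 * σg2 ^ 2 * Z0 ^ 2) / N) := by gcongr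
      _ = γ / 4 * (16 * γ * σg2 ^ 2) * ‖w‖ ^ 2 +
          γ ^ 2 * ((2 * σf ^ 2 + 4 * σg2 ^ 2 * Z0 ^ 2) / N) := by ring
      _ ≤ γ / 4 * μ * ‖w‖ ^ 2 + γ ^ 2 * ((2 * σf ^ 2 + 4 * σg2 ^ 2 * Z0 ^ 2) / N) := by gcongr
      _ = _ := by ring
  rw [neg_sq]
  linarith

/-- `D` estimates `∇H(x)` and not `∇H(x')`, hence a drift term. Its conditional mean has bias `b`,
at most `M‖y - y*‖ + L‖z - z*‖`, which enters with the small factor `ρ`. -/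
theorem Regularity.step_u {ρ : ℝ} (hρ : 0 < ρ) (hρ1 : ρ ≤ 1) (x x' : X) (y z : Y) (u : X) :
    Integrable (fun ω => ‖(1 - ρ) • u + ρ • batchAverage N (B.sampleX (pt x y) z) (fun i => W i ω)
      - B.hyperGrad x'‖ ^ 2) P ∧
    ∫ ω, ‖(1 - ρ) • u + ρ • batchAverage N (B.sampleX (pt x y) z) (fun i => W i ω)
      - B.hyperGrad x'‖ ^ 2 ∂P ≤
      (1 - ρ) * ‖u - B.hyperGrad x‖ ^ 2 + 4 * ρ * (M ^ 2 * ‖y - B.yStar x‖ ^ 2)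
        + (4 * ρ * L ^ 2 + 4 * ρ ^ 2 * σg2 ^ 2) * ‖z - B.zStar x‖ ^ 2
        + 2 / ρ * (LH ^ 2 * ‖x' - x‖ ^ 2)
        + ρ ^ 2 * ((2 * σf ^ 2 + 4 * σg2 ^ 2 * Z0 ^ 2) / N) := by
  have hμ := hR.μ_pos
  set v := pt x y with hv
  set m := grad₁ B.f v - hess₁₂ B.g v z with hm
  set b := m - B.hyperGrad x with hb
  have e : ∀ ω, (1 - ρ) • u + ρ • batchAverage N (B.sampleX v z) (fun i => W i ω) - B.hyperGrad x' =
      ((1 - ρ) • (u - B.hyperGrad x) + ρ • b + (B.hyperGrad x - B.hyperGrad x')) +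
        ρ • (batchAverage N (B.sampleX v z) (fun i => W i ω) - m) := fun ω => by
    rw [hb]; module
  simp_rw [e]
  have h1 := hW.integral_le (hE.measurable_sampleX measurable_const measurable_const measurable_id)
    (hR.moments_sampleX v z) hN
    ((1 - ρ) • (u - B.hyperGrad x) + ρ • b + (B.hyperGrad x - B.hyperGrad x')) ρ
  refine ⟨h1.1, h1.2.trans ?_⟩
  have h2 := norm_smul_add_smul_add_sq_le (e := u - B.hyperGrad x) (b := b)
    (d := B.hyperGrad x - B.hyperGrad x') hρ hρ1
  have h3 : ‖B.hyperGrad x - B.hyperGrad x'‖ ^ 2 ≤ LH ^ 2 * ‖x' - x‖ ^ 2 := by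
    rw [← mul_pow, norm_sub_rev x' x]
    exact pow_le_pow_left₀ (norm_nonneg _) (hR.hyperGrad_lipschitz x x') 2
  have h4 : ‖b‖ ≤ M * ‖y - B.yStar x‖ + L * ‖z - B.zStar x‖ := by
    have a1 := hR.dirX_lipschitz v (pt x (B.yStar x)) x
    rw [pt_sub, sub_self, norm_pt_zero_left] at a1
    have e1 : b = ((grad₁ B.f v - hess₁₂ B.g v (B.zStar x)) -
        (grad₁ B.f (pt x (B.yStar x)) - hess₁₂ B.g (pt x (B.yStar x)) (B.zStar x))) -
        hess₁₂ B.g v (z - B.zStar x) := by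
      rw [hess₁₂_sub, hb, hm, hyperGrad]; abel
    rw [e1]
    exact (norm_sub_le _ _).trans (add_le_add a1 (hR.norm_hess₁₂_le _ _))
  have h5 : ‖b‖ ^ 2 ≤ 2 * (M ^ 2 * ‖y - B.yStar x‖ ^ 2) + 2 * (L ^ 2 * ‖z - B.zStar x‖ ^ 2) := by
    refine (pow_le_pow_left₀ (norm_nonneg _) h4 2).trans ?_
    nlinarith [sq_nonneg (M * ‖y - B.yStar x‖ - L * ‖z - B.zStar x‖)]
  have h8 : ρ ^ 2 * ((2 * σf ^ 2 + 2 * (‖z‖ ^ 2 * σg2 ^ 2)) / N) ≤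
      4 * ρ ^ 2 * σg2 ^ 2 * ‖z - B.zStar x‖ ^ 2 +
        ρ ^ 2 * ((2 * σf ^ 2 + 4 * σg2 ^ 2 * Z0 ^ 2) / N) := by
    have a3 := hR.variance_le hN x z
    calc _ ≤ ρ ^ 2 * (4 * σg2 ^ 2 * ‖z - B.zStar x‖ ^ 2 +
          (2 * σf ^ 2 + 4 * σg2 ^ 2 * Z0 ^ 2) / N) := by gcongr
      _ = _ := by ring
  have h9 : 2 * ρ * ‖b‖ ^ 2 ≤ 2 * ρ * (2 * (M ^ 2 * ‖y - B.yStar x‖ ^ 2) +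
    2 * (L ^ 2 * ‖z - B.zStar x‖ ^ 2)) := by gcongr
  have h10 : 2 / ρ * ‖B.hyperGrad x - B.hyperGrad x'‖ ^ 2 ≤
    2 / ρ * (LH ^ 2 * ‖x' - x‖ ^ 2) := by gcongr
  linarith

end Problem

end OneStep

/-! ### Choice of step sizes and weights. -/

/-- Step sizes and Lyapunov weights for which the Lyapunov function decreases. -/
structure StepSizes (L μ M Ly Lz LH Q σ α β γ ρ a b c : ℝ) : Prop where
  α_pos : 0 < α
  β_pos : 0 < β
  γ_pos : 0 < γ
  ρ_pos : 0 < ρ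
  ρ_le : ρ ≤ 1
  a_nonneg : 0 ≤ a
  b_nonneg : 0 ≤ b
  c_nonneg : 0 ≤ c
  β_L : β * L ^ 2 ≤ μ
  β_μ : β * μ ≤ 1
  γ_L : γ * L ^ 2 ≤ μ
  γ_μ : γ * μ ≤ 1
  γ_σ : 16 * γ * σ ^ 2 ≤ μ
  coeff_y : b * (4 * γ / μ * M ^ 2) + c * (4 * ρ * M ^ 2) ≤ a * (β * μ / 2)
  coeff_z : c * (4 * ρ * L ^ 2 + 4 * ρ ^ 2 * σ ^ 2) ≤ b * (γ * μ / 4)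
  coeff_e : α / 2 ≤ c * ρ
  coeff_u : a * (2 / (β * μ) * (Ly ^ 2 * α ^ 2)) + b * (4 / (γ * μ) * (Lz ^ 2 * α ^ 2)) +
    c * (2 / ρ * (LH ^ 2 * α ^ 2)) + Q * α ^ 2 ≤ α / 2

/-- Every condition is of first order in `t`, up to terms that only improve for `t ≤ 1`, so the
weights can be independent of `t`. They are fixed backwards: `c` from the momentum error, `b` from
the `z`-error given `c`, `a` from the `y`-error given `b` and `c`. All carry a factor `cα`, so the
drift costs are of order `cα³t` against the gain `cα t/2`, and a small `cα` closes the system. -/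
theorem exists_stepSizes (L M Ly Lz LH σ : ℝ) {μ Q : ℝ} (hμ : 0 < μ) (hQ : 0 ≤ Q) :
    ∃ cα cβ cγ a b c : ℝ, 0 < cα ∧ 0 < cβ ∧ 0 < cγ ∧ ∀ t : ℝ, 0 < t → t ≤ 1 →
      StepSizes L μ M Ly Lz LH Q σ (cα * t) (cβ * t) (cγ * t) t a b c := by
  -- The denominators contain one summand for each upper bound imposed on the step.
  obtain ⟨cβ, hcβ⟩ : ∃ r, r = μ / (L ^ 2 + μ ^ 2) := ⟨_, rfl⟩
  obtain ⟨cγ, hcγ⟩ : ∃ r, r = μ / (L ^ 2 + μ ^ 2 + 16 * σ ^ 2) := ⟨_, rfl⟩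
  have hcβ0 : 0 < cβ := by rw [hcβ]; positivity
  have hcγ0 : 0 < cγ := by rw [hcγ]; positivity
  obtain ⟨b₁, hb₁⟩ : ∃ r, r = 8 * (L ^ 2 + σ ^ 2) / (cγ * μ) := ⟨_, rfl⟩
  obtain ⟨a₁, ha₁⟩ : ∃ r, r = 2 / (cβ * μ) * (4 * b₁ * cγ * M ^ 2 / μ + 2 * M ^ 2) := ⟨_, rfl⟩
  have hb₁0 : 0 ≤ b₁ := by rw [hb₁]; positivity
  have ha₁0 : 0 ≤ a₁ := by rw [ha₁]; positivity
  -- `R` is the total drift cost with the powers of `cα` and `t` removed.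
  obtain ⟨R, hR⟩ : ∃ r, r = a₁ * (2 / (cβ * μ) * Ly ^ 2) + b₁ * (4 / (cγ * μ) * Lz ^ 2) + LH ^ 2 :=
    ⟨_, rfl⟩
  have hR0 : 0 ≤ R := by rw [hR]; positivity
  obtain ⟨cα, hcα⟩ : ∃ r, r = 1 / (1 + 2 * R + 2 * Q) := ⟨_, rfl⟩
  have hcα0 : 0 < cα := by rw [hcα]; positivity
  have hcα1 : cα ≤ 1 := by rw [hcα, div_le_one (by positivity)]; linarith
  have hcαR : cα * (R + Q) ≤ 1 / 2 := by
    rw [hcα, div_mul_eq_mul_div, div_le_iff₀ (by positivity)]; linarith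
  have hβ : cβ * (L ^ 2 + μ ^ 2) = μ := by rw [hcβ]; field_simp
  have hγ : cγ * (L ^ 2 + μ ^ 2 + 16 * σ ^ 2) = μ := by rw [hcγ]; field_simp
  refine ⟨cα, cβ, cγ, cα * a₁, cα * b₁, cα / 2, hcα0, hcβ0, hcγ0, fun t ht ht1 => ?_⟩
  have hle : ∀ {r s : ℝ}, 0 ≤ r → r ≤ s → t * r ≤ s := fun hr hrs =>
    (mul_le_of_le_one_left hr ht1).trans hrs
  refine ⟨by positivity, by positivity, by positivity, ht, ht1, by positivity, by positivity,
    by positivity, ?_, ?_, ?_, ?_, ?_, ?_, ?_, ?_, ?_⟩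
  · have : cβ * L ^ 2 ≤ μ := by nlinarith [mul_nonneg hcβ0.le (sq_nonneg μ)]
    linarith [hle (by positivity) this]
  · have : cβ * μ ≤ 1 := by
      refine le_of_mul_le_mul_right (a := μ) ?_ hμ
      nlinarith [mul_nonneg hcβ0.le (sq_nonneg L)]
    linarith [hle (by positivity) this]
  · have : cγ * L ^ 2 ≤ μ := by
      nlinarith [mul_nonneg hcγ0.le (sq_nonneg μ), mul_nonneg hcγ0.le (sq_nonneg σ)]
    linarith [hle (by positivity) this]
  · have : cγ * μ ≤ 1 := by
      refine le_of_mul_le_mul_right (a := μ) ?_ hμ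
      nlinarith [mul_nonneg hcγ0.le (sq_nonneg L), mul_nonneg hcγ0.le (sq_nonneg σ)]
    linarith [hle (by positivity) this]
  · have : cγ * (16 * σ ^ 2) ≤ μ := by
      nlinarith [mul_nonneg hcγ0.le (sq_nonneg μ), mul_nonneg hcγ0.le (sq_nonneg L)]
    linarith [hle (by positivity) this]
  · refine le_of_eq ?_
    rw [ha₁]; field_simp; ring
  · have e : cα * b₁ * (cγ * t * μ / 4) = cα * (2 * t * (L ^ 2 + σ ^ 2)) := by
      rw [hb₁]; field_simp; ring
    rw [e]
    have h1 : t ^ 2 * σ ^ 2 ≤ t * σ ^ 2 :=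
      mul_le_mul_of_nonneg_right (by nlinarith) (sq_nonneg _)
    have h2 : cα * (2 * t * L ^ 2 + 2 * (t ^ 2 * σ ^ 2)) ≤ cα * (2 * t * (L ^ 2 + σ ^ 2)) := by
      refine mul_le_mul_of_nonneg_left ?_ hcα0.le
      linarith
    linarith
  · exact le_of_eq (by ring)
  · have e : cα * a₁ * (2 / (cβ * t * μ) * (Ly ^ 2 * (cα * t) ^ 2)) +
        cα * b₁ * (4 / (cγ * t * μ) * (Lz ^ 2 * (cα * t) ^ 2)) +
        cα / 2 * (2 / t * (LH ^ 2 * (cα * t) ^ 2)) + Q * (cα * t) ^ 2 =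
        cα * t * (cα * (cα * R + t * Q)) := by
      rw [hR]; field_simp
    rw [e]
    have h1 : cα * R + t * Q ≤ R + Q :=
      add_le_add (mul_le_of_le_one_left hR0 hcα1) (mul_le_of_le_one_left hQ ht1)
    have h2 : cα * (cα * R + t * Q) ≤ 1 / 2 := (mul_le_mul_of_nonneg_left h1 hcα0.le).trans hcαR
    have h3 := mul_le_mul_of_nonneg_left h2 (mul_pos hcα0 ht).le
    linarith

theorem integrable_and_integral_affine {Ω : Type*} [MeasurableSpace Ω] {P : Measure Ω}
    [IsProbabilityMeasure P] {φ ψ χ : Ω → ℝ} (hφ : Integrable φ P) (hψ : Integrable ψ P)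
    (hχ : Integrable χ P) (r a b c : ℝ) :
    Integrable (fun ω => r + a * φ ω + b * ψ ω + c * χ ω) P ∧
      ∫ ω, (r + a * φ ω + b * ψ ω + c * χ ω) ∂P =
        r + a * ∫ ω, φ ω ∂P + b * ∫ ω, ψ ω ∂P + c * ∫ ω, χ ω ∂P := by
  have i1 : Integrable (fun ω => r + a * φ ω) P := (integrable_const r).add (hφ.const_mul a)
  have i2 : Integrable (fun ω => r + a * φ ω + b * ψ ω) P := i1.add (hψ.const_mul b)
  refine ⟨i2.add (hχ.const_mul c), ?_⟩
  rw [integral_add i2 (hχ.const_mul c), integral_add i1 (hψ.const_mul b),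
    integral_add (integrable_const _) (hφ.const_mul a)]
  simp [integral_const_mul]

/-! ### Lyapunov function along the algorithm. -/

section Run

variable {X Y : Type*} [NormedAddCommGroup X] [InnerProductSpace ℝ X] [CompleteSpace X]
  [NormedAddCommGroup Y] [InnerProductSpace ℝ Y] [CompleteSpace Y]
  [FiniteDimensional ℝ X] [FiniteDimensional ℝ Y]
  [MeasurableSpace X] [BorelSpace X] [MeasurableSpace Y] [BorelSpace Y]
  {Ξ Z : Type*} [MeasurableSpace Ξ] [MeasurableSpace Z]
  {B : Problem X Y Ξ Z} {L μ Z0 M Ly Lz LH Q σf σg1 σg2 : ℝ}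

open Problem

/-- Pairing `ξ i` with `ζ i` turns a combination of two mini-batch averages into one average over
independent pairs, to which the variance bound applies. -/
theorem dirX_fst (B : Problem X Y Ξ Z) (S : ℕ) (ξ : ℕ → Ξ) (ζ : ℕ → Z) (x : X) (y z : Y) :
    (dirX B S ξ ζ x y z).1 = batchAverage S (B.sampleX (pt x y) z) fun i => (ξ i, ζ i) := by
  simp [dirX, miniBatch, batchAverage, sampleX, Finset.sum_sub_distrib, smul_sub]

theorem dirY_fst (B : Problem X Y Ξ Z) (S : ℕ) (ξ : ℕ → Ξ) (ζ : ℕ → Z) (x : X) (y : Y) :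
    (dirY B S ζ x y).1 = batchAverage S (B.sampleY (pt x y)) fun i => (ξ i, ζ i) := rfl

theorem dirZ_fst (B : Problem X Y Ξ Z) (S : ℕ) (ξ : ℕ → Ξ) (ζ : ℕ → Z) (x : X) (y z : Y) :
    (dirZ B S ξ ζ x y z).1 = batchAverage S (B.sampleZ (pt x y) z) fun i => (ξ i, ζ i) := by
  simp [dirZ, miniBatch, batchAverage, sampleZ, Finset.sum_sub_distrib, smul_sub]

/-- The Lyapunov function of the algorithm. -/
def lyapunov (B : Problem X Y Ξ Z) (h₀ ρ a b c : ℝ) (s : State X Y) : ℝ :=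
  B.H s.x - h₀ + a * ‖s.y - B.yStar s.x‖ ^ 2 + b * ‖s.z - B.zStar s.x‖ ^ 2 +
    c * ‖(1 - ρ) • s.v + ρ • s.D - B.hyperGrad s.x‖ ^ 2

/-- The noise added to the Lyapunov function in one step, times the mini-batch size. -/
def noise (Z0 σf σg1 σg2 β γ ρ a b c : ℝ) : ℝ :=
  a * (β ^ 2 * σg1 ^ 2) + b * (γ ^ 2 * (2 * σf ^ 2 + 4 * σg2 ^ 2 * Z0 ^ 2)) +
    c * (ρ ^ 2 * (2 * σf ^ 2 + 4 * σg2 ^ 2 * Z0 ^ 2))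

section OneStep

variable {Ω : Type*} [MeasurableSpace Ω] {P : Measure Ω} [IsProbabilityMeasure P]
  {W : ℕ → Ω → Ξ × Z} {θ : Params} {h₀ a b c : ℝ}

theorem Problem.Regularity.lyapunov_step (hR : B.Regularity L μ Z0 M Ly Lz LH Q σf σg1 σg2)
    (hE : B.ExpectationForm) (hW : B.IID P W) (hN : 0 < θ.batch)
    (hθ : StepSizes L μ M Ly Lz LH Q σg2 θ.α θ.β θ.γ θ.ρ a b c) (s : State X Y) :
    Integrable (fun ω => lyapunov B h₀ θ.ρ a b c
      (step B θ (fun i => (W i ω).1) (fun i => (W i ω).2) s)) P ∧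
    ∫ ω, lyapunov B h₀ θ.ρ a b c (step B θ (fun i => (W i ω).1) (fun i => (W i ω).2) s) ∂P +
      θ.α / 2 * ‖B.hyperGrad s.x‖ ^ 2 ≤
      lyapunov B h₀ θ.ρ a b c s + noise Z0 σf σg1 σg2 θ.β θ.γ θ.ρ a b c / θ.batch := by
  -- The direction of this iteration uses the previous `D`, so `u` and `x'` do not depend on the
  -- fresh samples.
  set u := (1 - θ.ρ) • s.v + θ.ρ • s.D with hu
  set x' := s.x - θ.α • u with hx'
  obtain ⟨iy, ey⟩ := hR.step_y hE hW hN hθ.β_pos hθ.β_L hθ.β_μ s.x x' s.y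
  obtain ⟨iz, ez⟩ := hR.step_z hE hW hN hθ.γ_pos hθ.γ_L hθ.γ_μ hθ.γ_σ s.x x' s.y s.z
  obtain ⟨iu, eu⟩ := hR.step_u hE hW hN hθ.ρ_pos hθ.ρ_le s.x x' s.y s.z u
  have e : (fun ω => lyapunov B h₀ θ.ρ a b c
      (step B θ (fun i => (W i ω).1) (fun i => (W i ω).2) s)) = fun ω =>
      B.H x' - h₀ + a * ‖s.y - θ.β • batchAverage θ.batch (B.sampleY (pt s.x s.y)) (fun i => W i ω)
          - B.yStar x'‖ ^ 2 +
        b * ‖s.z - θ.γ • batchAverage θ.batch (B.sampleZ (pt s.x s.y) s.z) (fun i => W i ω)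
          - B.zStar x'‖ ^ 2 +
        c * ‖(1 - θ.ρ) • u + θ.ρ • batchAverage θ.batch (B.sampleX (pt s.x s.y) s.z) (fun i => W i ω)
          - B.hyperGrad x'‖ ^ 2 := by
    funext ω
    simp only [lyapunov, step, dirX_fst, dirZ_fst, dirY_fst B _ fun i => (W i ω).1, Prod.mk.eta,
      ← hu, ← hx']
  obtain ⟨hi, hint⟩ := integrable_and_integral_affine iy iz iu (B.H x' - h₀) a b c
  rw [e]
  refine ⟨hi, ?_⟩
  rw [hint]
  have hxx : ‖x' - s.x‖ ^ 2 = θ.α ^ 2 * ‖u‖ ^ 2 := by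
    rw [hx', sub_sub_cancel_left, norm_neg, norm_smul, mul_pow, Real.norm_eq_abs, sq_abs]
  rw [hxx] at ey ez eu
  have hq := (abs_le.1 (hR.quadratic s.x x')).2
  -- Polarization keeps the full `-α/2‖u‖²`, the budget for all drift terms.
  have hin : inner ℝ (B.hyperGrad s.x) (x' - s.x) = θ.α / 2 *
      (‖u - B.hyperGrad s.x‖ ^ 2 - ‖B.hyperGrad s.x‖ ^ 2 - ‖u‖ ^ 2) := by
    rw [hx', sub_sub_cancel_left, inner_neg_right, inner_smul_right, norm_sub_sq_real,
      real_inner_comm u]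
    ring
  rw [hxx, hin] at hq
  have hay := mul_le_mul_of_nonneg_left ey hθ.a_nonneg
  have hbz := mul_le_mul_of_nonneg_left ez hθ.b_nonneg
  have hcu := mul_le_mul_of_nonneg_left eu hθ.c_nonneg
  have c1 := mul_le_mul_of_nonneg_right hθ.coeff_y (sq_nonneg ‖s.y - B.yStar s.x‖)
  have c2 := mul_le_mul_of_nonneg_right hθ.coeff_z (sq_nonneg ‖s.z - B.zStar s.x‖)
  have c3 := mul_le_mul_of_nonneg_right hθ.coeff_e (sq_nonneg ‖u - B.hyperGrad s.x‖)
  have c4 := mul_le_mul_of_nonneg_right hθ.coeff_u (sq_nonneg ‖u‖)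
  have hn : noise Z0 σf σg1 σg2 θ.β θ.γ θ.ρ a b c / θ.batch =
      a * (θ.β ^ 2 * (σg1 ^ 2 / θ.batch)) +
      b * (θ.γ ^ 2 * ((2 * σf ^ 2 + 4 * σg2 ^ 2 * Z0 ^ 2) / θ.batch)) +
      c * (θ.ρ ^ 2 * ((2 * σf ^ 2 + 4 * σg2 ^ 2 * Z0 ^ 2) / θ.batch)) := by
    rw [noise]; ring
  rw [hn, lyapunov, ← hu]
  linarith

/-- The direction `D₋₁` is computed at a point unrelated to `x₀`, so its error is only bounded, not
small. The bound is uniform in `ρ ≤ 1` and in the batch size, hence in `K`, `p`, `q`. -/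
theorem Problem.Regularity.lyapunov_init (hR : B.Regularity L μ Z0 M Ly Lz LH Q σf σg1 σg2)
    (hE : B.ExpectationForm) (hW : B.IID P W) (hN : 0 < θ.batch) (hρ : 0 ≤ θ.ρ) (hρ1 : θ.ρ ≤ 1)
    (hc : 0 ≤ c) (I : Init X Y) :
    Integrable (fun ω => lyapunov B h₀ θ.ρ a b c
      (initState B θ I (fun i => (W i ω).1) (fun i => (W i ω).2))) P ∧
    ∫ ω, lyapunov B h₀ θ.ρ a b c
      (initState B θ I (fun i => (W i ω).1) (fun i => (W i ω).2)) ∂P ≤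
      B.H I.x - h₀ + a * ‖I.y - B.yStar I.x‖ ^ 2 + b * ‖I.z - B.zStar I.x‖ ^ 2 +
      c * ((‖I.vPrev - B.hyperGrad I.x‖ + ‖grad₁ B.f (pt I.xPrev I.yPrev) -
        hess₁₂ B.g (pt I.xPrev I.yPrev) I.zPrev - B.hyperGrad I.x‖) ^ 2 +
        (2 * σf ^ 2 + 2 * (‖I.zPrev‖ ^ 2 * σg2 ^ 2))) := by
  set v := pt I.xPrev I.yPrev with hv
  set m := grad₁ B.f v - hess₁₂ B.g v I.zPrev with hm
  set h := B.hyperGrad I.x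
  set τ := 2 * σf ^ 2 + 2 * (‖I.zPrev‖ ^ 2 * σg2 ^ 2) with hτ
  obtain ⟨iD, eD⟩ := hW.integral_le
    (hE.measurable_sampleX measurable_const measurable_const measurable_id)
    (hR.moments_sampleX v I.zPrev) hN ((1 - θ.ρ) • (I.vPrev - h) + θ.ρ • (m - h)) θ.ρ
  have e : (fun ω => lyapunov B h₀ θ.ρ a b c
      (initState B θ I (fun i => (W i ω).1) (fun i => (W i ω).2))) = fun ω =>
      B.H I.x - h₀ + a * ‖I.y - B.yStar I.x‖ ^ 2 + b * ‖I.z - B.zStar I.x‖ ^ 2 +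
      c * ‖(1 - θ.ρ) • (I.vPrev - h) + θ.ρ • (m - h) +
        θ.ρ • (batchAverage θ.batch (fun s => B.sampleX v I.zPrev (id s)) (fun i => W i ω) - m)‖ ^ 2 := by
    funext ω
    simp only [lyapunov, initState, dirX_fst, Prod.mk.eta, id]
    congr 4
    module
  rw [e]
  refine ⟨(integrable_const _).add (iD.const_mul c), ?_⟩
  rw [integral_add (integrable_const _) (iD.const_mul c), integral_const_mul]
  simp only [integral_const, probReal_univ, one_smul]
  gcongr
  refine eD.trans ?_
  have hN1 : (1 : ℝ) ≤ θ.batch := by exact_mod_cast hN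
  have h1 : θ.ρ ^ 2 * (τ / θ.batch) ≤ τ := by
    have : 0 ≤ τ := by positivity
    exact (mul_le_of_le_one_left (by positivity) (pow_le_one₀ hρ hρ1)).trans
      (div_le_self this hN1)
  have h2 : ‖(1 - θ.ρ) • (I.vPrev - h) + θ.ρ • (m - h)‖ ≤ ‖I.vPrev - h‖ + ‖m - h‖ := by
    refine (norm_add_le _ _).trans (add_le_add ?_ ?_) <;>
    rw [norm_smul, Real.norm_eq_abs, abs_of_nonneg (by linarith)] <;>
    exact mul_le_of_le_one_left (norm_nonneg _) (by linarith)
  exact add_le_add (pow_le_pow_left₀ (norm_nonneg _) h2 2) h1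

end OneStep

section Measurability

/-- A state without its counter of oracle calls. -/
def State.vars {X Y : Type*} (s : State X Y) : X × Y × Y × X × X := (s.x, s.y, s.z, s.v, s.D)

/-- The counter is left out of the σ-algebra, as the Lyapunov function and the iterates do not see
it. -/
instance : MeasurableSpace (State X Y) := MeasurableSpace.comap State.vars inferInstance

variable {T : Type*} [mT : MeasurableSpace T]

theorem measurable_state {s : T → State X Y} (hx : Measurable fun t => (s t).x)
    (hy : Measurable fun t => (s t).y) (hz : Measurable fun t => (s t).z)
    (hv : Measurable fun t => (s t).v) (hD : Measurable fun t => (s t).D) : Measurable s :=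
  measurable_comap_iff.2 (hx.prodMk (hy.prodMk (hz.prodMk (hv.prodMk hD))))

theorem State.measurable_vars : Measurable (State.vars : State X Y → _) := comap_measurable _

theorem State.measurable_x : Measurable fun s : State X Y => s.x :=
  measurable_fst.comp State.measurable_vars

theorem State.measurable_y : Measurable fun s : State X Y => s.y :=
  measurable_snd.fst.comp State.measurable_vars

theorem State.measurable_z : Measurable fun s : State X Y => s.z :=
  measurable_snd.snd.fst.comp State.measurable_vars

theorem State.measurable_v : Measurable fun s : State X Y => s.v :=
  measurable_snd.snd.snd.fst.comp State.measurable_vars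

theorem State.measurable_D : Measurable fun s : State X Y => s.D :=
  measurable_snd.snd.snd.snd.comp State.measurable_vars

theorem measurable_average {E : Type*} [NormedAddCommGroup E] [InnerProductSpace ℝ E]
    [FiniteDimensional ℝ E] [MeasurableSpace E] [BorelSpace E] {N : ℕ} {φ : T → Ξ × Z → E}
    {w : T → ℕ → Ξ × Z} (h : ∀ i, Measurable fun t => φ t (w t i)) :
    Measurable fun t => batchAverage N (φ t) (w t) :=
  (Finset.measurable_sum _ fun i _ => h i).const_smul ((N : ℝ)⁻¹)

theorem measurable_step (hE : B.ExpectationForm) (θ : Params) {s : T → State X Y}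
    {ξ : ℕ → T → Ξ} {ζ : ℕ → T → Z} (hs : Measurable s) (hξ : ∀ i, Measurable (ξ i))
    (hζ : ∀ i, Measurable (ζ i)) :
    Measurable fun t => step B θ (fun i => ξ i t) (fun i => ζ i t) (s t) := by
  have hx := State.measurable_x.comp hs
  have hy := State.measurable_y.comp hs
  have hz := State.measurable_z.comp hs
  have hv := State.measurable_v.comp hs
  have hD := State.measurable_D.comp hs
  have hp := measurable_pt hx hy
  have hw := fun i => (hξ i).prodMk (hζ i)
  refine measurable_state ?_ ?_ ?_ ?_ ?_
  · exact hx.sub (((hv.const_smul _).add (hD.const_smul _)).const_smul _)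
  · exact hy.sub ((measurable_average fun i => hE.measurable_sampleY hp (hw i)).const_smul θ.β)
  · simp only [step, dirZ_fst]
    exact hz.sub ((measurable_average fun i => hE.measurable_sampleZ hp hz (hw i)).const_smul θ.γ)
  · exact (hv.const_smul _).add (hD.const_smul _)
  · simp only [step, dirX_fst]
    exact measurable_average fun i => hE.measurable_sampleX hp hz (hw i)

/-- The σ-algebra on `T` is arbitrary and only samples up to `k` are involved, so the lemma also
shows that the state is measurable with respect to the past samples. -/
theorem measurable_run (hE : B.ExpectationForm) (θ : Params) (I : Init X Y)
    {ξ : ℕ → ℕ → T → Ξ} {ζ : ℕ → ℕ → T → Z} (k : ℕ) (hξ : ∀ j ≤ k, ∀ i, Measurable (ξ j i))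
    (hζ : ∀ j ≤ k, ∀ i, Measurable (ζ j i)) :
    Measurable fun t => run B θ I (fun j i => ξ j i t) (fun j i => ζ j i t) k := by
  induction k with
  | zero =>
    refine measurable_state measurable_const measurable_const measurable_const measurable_const ?_
    simp only [run, initState, dirX_fst]
    exact measurable_average fun i => hE.measurable_sampleX measurable_const measurable_const
      ((hξ 0 le_rfl i).prodMk (hζ 0 le_rfl i))
  | succ k ih =>
    exact measurable_step hE θ
      (ih (fun j hj => hξ j (hj.trans k.le_succ)) (fun j hj => hζ j (hj.trans k.le_succ)))
      (hξ (k + 1) le_rfl) (hζ (k + 1) le_rfl)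

theorem continuous_of_norm_sub_le {E F : Type*} [NormedAddCommGroup E] [NormedAddCommGroup F]
    {φ : E → F} {C : ℝ} (h : ∀ x x', ‖φ x - φ x'‖ ≤ C * ‖x - x'‖) : Continuous φ :=
  (LipschitzWith.of_dist_le_mul (K := C.toNNReal) fun x y => by
    rw [dist_eq_norm, dist_eq_norm]
    exact (h x y).trans (mul_le_mul_of_nonneg_right (Real.le_coe_toNNReal C)
      (norm_nonneg _))).continuous

theorem Problem.Regularity.measurable_lyapunov
    (hR : B.Regularity L μ Z0 M Ly Lz LH Q σf σg1 σg2) (hH : Differentiable ℝ B.H)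
    (h₀ ρ a b c : ℝ) : Measurable (lyapunov B h₀ ρ a b c) := by
  have hx := State.measurable_x (X := X) (Y := Y)
  have h1 := (continuous_of_norm_sub_le hR.yStar_lipschitz).measurable.comp hx
  have h2 := (continuous_of_norm_sub_le hR.zStar_lipschitz).measurable.comp hx
  have h3 := (continuous_of_norm_sub_le hR.hyperGrad_lipschitz).measurable.comp hx
  have hu := (State.measurable_v (X := X) (Y := Y)).const_smul (1 - ρ) |>.add
    (State.measurable_D.const_smul ρ)
  exact ((((hH.continuous.measurable.comp hx).sub_const h₀).add
    (((State.measurable_y.sub h1).norm.pow_const 2).const_mul a)).add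
    (((State.measurable_z.sub h2).norm.pow_const 2).const_mul b)).add
    (((hu.sub h3).norm.pow_const 2).const_mul c)

end Measurability

end Run

/-! ### Independence, telescoping and the sum of squared gradients. -/

section Convergence

variable {X Y : Type*} [NormedAddCommGroup X] [InnerProductSpace ℝ X] [CompleteSpace X]
  [NormedAddCommGroup Y] [InnerProductSpace ℝ Y] [CompleteSpace Y]
  [FiniteDimensional ℝ X] [FiniteDimensional ℝ Y]
  [MeasurableSpace X] [BorelSpace X] [MeasurableSpace Y] [BorelSpace Y]
  {Ξ Z : Type*} [MeasurableSpace Ξ] [MeasurableSpace Z]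
  {B : Problem X Y Ξ Z} {L μ Z0 M Ly Lz LH Q σf σg1 σg2 : ℝ}
  {Ω : Type*} [MeasurableSpace Ω] {P : Measure Ω} [IsProbabilityMeasure P]
  {ξ : ℕ → ℕ → Ω → Ξ} {ζ : ℕ → ℕ → Ω → Z}

open Problem

theorem IIDSamples.iid (hS : IIDSamples B P ξ ζ) (j : ℕ) :
    B.IID P fun i ω => (ξ j i ω, ζ j i ω) where
  measurable i := (hS.measurable_ξ j i).prodMk (hS.measurable_ζ j i)
  map_eq := hS.map_eq j
  indep := hS.indep.precomp (g := fun i => (j, i)) fun _ _ h => (Prod.mk.inj h).2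

/-- The state after `k` iterations is a function of the samples with `j ≤ k`, the next step uses
those with `j = k + 1`, and the σ-algebras generated by disjoint index sets are independent. -/
theorem IIDSamples.indepFun_run (hS : IIDSamples B P ξ ζ) (hE : B.ExpectationForm) (θ : Params)
    (I : Init X Y) (k : ℕ) :
    IndepFun (fun ω => run B θ I (fun j i => ξ j i ω) (fun j i => ζ j i ω) k)
      (fun ω i => (ξ (k + 1) i ω, ζ (k + 1) i ω)) P := by
  set m : ℕ × ℕ → MeasurableSpace Ω := fun a =>
    MeasurableSpace.comap (fun ω => (ξ a.1 a.2 ω, ζ a.1 a.2 ω)) inferInstance with hm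
  have hle : ∀ a, m a ≤ ‹MeasurableSpace Ω› := fun a =>
    ((hS.measurable_ξ a.1 a.2).prodMk (hS.measurable_ζ a.1 a.2)).comap_le
  have hdisj : Disjoint {a : ℕ × ℕ | a.1 ≤ k} {a : ℕ × ℕ | a.1 = k + 1} := by
    rw [Set.disjoint_left]
    intro a (h1 : a.1 ≤ k) (h2 : a.1 = k + 1)
    omega
  have hi := indep_iSup_of_disjoint hle hS.indep.iIndep hdisj
  have hmeas : ∀ (s : Set (ℕ × ℕ)) (a : ℕ × ℕ), a ∈ s →
      Measurable[⨆ a ∈ s, m a] fun ω => (ξ a.1 a.2 ω, ζ a.1 a.2 ω) := fun s a ha =>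
    (comap_measurable _).mono (le_iSup₂ (f := fun a (_ : a ∈ s) => m a) a ha) le_rfl
  refine indep_of_indep_of_le_left (indep_of_indep_of_le_right hi ?_) ?_
  · refine Measurable.comap_le (@measurable_pi_lambda Ω ℕ (fun _ => Ξ × Z)
      (⨆ a ∈ {a : ℕ × ℕ | a.1 = k + 1}, m a) _ _ fun i => ?_)
    exact hmeas {a : ℕ × ℕ | a.1 = k + 1} (k + 1, i) rfl
  · refine Measurable.comap_le ?_
    refine measurable_run (mT := ⨆ a ∈ {a : ℕ × ℕ | a.1 ≤ k}, m a) hE θ I k ?_ ?_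
    · exact fun j hj i => measurable_fst.comp (hmeas {a : ℕ × ℕ | a.1 ≤ k} (j, i) hj)
    · exact fun j hj i => measurable_snd.comp (hmeas {a : ℕ × ℕ | a.1 ≤ k} (j, i) hj)

/-- Fubini's theorem for a function of two independent variables. -/
theorem lintegral_comp_of_indepFun {T T' : Type*} [MeasurableSpace T] [MeasurableSpace T']
    {s : Ω → T} {w : Ω → T'} (hs : Measurable s) (hw : Measurable w) (hind : IndepFun s w P)
    {φ : T → T' → ENNReal} (hφ : Measurable fun p : T × T' => φ p.1 p.2) :
    ∫⁻ ω, φ (s ω) (w ω) ∂P = ∫⁻ ω, ∫⁻ ω', φ (s ω) (w ω') ∂P ∂P := by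
  have h1 := (indepFun_iff_map_prod_eq_prod_map_map hs.aemeasurable hw.aemeasurable).1 hind
  have := Measure.isProbabilityMeasure_map (μ := P) hw.aemeasurable
  calc ∫⁻ ω, φ (s ω) (w ω) ∂P = ∫⁻ p, φ p.1 p.2 ∂(P.map fun ω => (s ω, w ω)) :=
        (lintegral_map hφ (hs.prodMk hw)).symm
    _ = ∫⁻ a, ∫⁻ b, φ a b ∂(P.map w) ∂(P.map s) := by
        rw [h1, lintegral_prod _ hφ.aemeasurable]
    _ = ∫⁻ ω, ∫⁻ b, φ (s ω) b ∂(P.map w) ∂P := lintegral_map hφ.lintegral_prod_right' hs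
    _ = _ := by
        congr 1; funext ω
        exact lintegral_map (hφ.comp (measurable_const.prodMk measurable_id)) hw

variable {θ : Params} {h₀ a b c : ℝ} (hR : B.Regularity L μ Z0 M Ly Lz LH Q σf σg1 σg2)
  (hE : B.ExpectationForm) (hH : Differentiable ℝ B.H) (hh : ∀ x, h₀ ≤ B.H x)
  (hS : IIDSamples B P ξ ζ) (hN : 0 < θ.batch)
  (hθ : StepSizes L μ M Ly Lz LH Q σg2 θ.α θ.β θ.γ θ.ρ a b c) (I : Init X Y)

omit [InnerProductSpace ℝ X] [CompleteSpace X] [InnerProductSpace ℝ Y] [CompleteSpace Y]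
  [FiniteDimensional ℝ X] [FiniteDimensional ℝ Y]
  [MeasurableSpace X] [BorelSpace X] [MeasurableSpace Y] [BorelSpace Y] in
theorem noise_nonneg (β γ ρ : ℝ) (ha : 0 ≤ a) (hb : 0 ≤ b) (hc : 0 ≤ c) :
    0 ≤ noise Z0 σf σg1 σg2 β γ ρ a b c := by
  rw [noise]; positivity

include hh in
theorem lyapunov_nonneg (ρ : ℝ) (ha : 0 ≤ a) (hb : 0 ≤ b) (hc : 0 ≤ c) (s : State X Y) :
    0 ≤ lyapunov B h₀ ρ a b c s := by
  have := sub_nonneg.2 (hh s.x)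
  rw [lyapunov]; positivity

include hR hE hS hH hh hN hθ

/-- Independence and Fubini freeze the current state, so the one-step bound applies pointwise; this
replaces conditional expectations. Integrals are taken in `[0, ∞]` because integrability along the
run is not yet known; it follows afterwards. -/
theorem lintegral_lyapunov_succ_le (k : ℕ) :
    ∫⁻ ω, ENNReal.ofReal (lyapunov B h₀ θ.ρ a b c
        (run B θ I (fun j i => ξ j i ω) (fun j i => ζ j i ω) (k + 1))) ∂P +
      ∫⁻ ω, ENNReal.ofReal (θ.α / 2 * ‖B.hyperGrad (iterate B θ I ξ ζ k ω)‖ ^ 2) ∂P ≤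
    ∫⁻ ω, ENNReal.ofReal (lyapunov B h₀ θ.ρ a b c
        (run B θ I (fun j i => ξ j i ω) (fun j i => ζ j i ω) k)) ∂P +
      ENNReal.ofReal (noise Z0 σf σg1 σg2 θ.β θ.γ θ.ρ a b c / θ.batch) := by
  set s : Ω → State X Y := fun ω => run B θ I (fun j i => ξ j i ω) (fun j i => ζ j i ω) k with hs
  have hsm : Measurable s := measurable_run hE θ I k (fun j _ => hS.measurable_ξ j)
    (fun j _ => hS.measurable_ζ j)
  have hwm : Measurable fun ω i => (ξ (k + 1) i ω, ζ (k + 1) i ω) :=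
    measurable_pi_lambda _ (hS.iid (k + 1)).measurable
  have hV := hR.measurable_lyapunov hH h₀ θ.ρ a b c
  have hV0 := lyapunov_nonneg (Z := Z) hh θ.ρ hθ.a_nonneg hθ.b_nonneg hθ.c_nonneg
  have hα := hθ.α_pos
  have hφ : Measurable fun p : State X Y × (ℕ → Ξ × Z) => ENNReal.ofReal (lyapunov B h₀ θ.ρ a b c
      (step B θ (fun i => (p.2 i).1) (fun i => (p.2 i).2) p.1)) := by
    refine (hV.comp (measurable_step hE θ measurable_fst (fun i => ?_) fun i => ?_)).ennreal_ofReal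
    · exact measurable_fst.comp ((measurable_pi_apply i).comp measurable_snd)
    · exact measurable_snd.comp ((measurable_pi_apply i).comp measurable_snd)
  have h1 := lintegral_comp_of_indepFun hsm hwm (hS.indepFun_run hE θ I k)
    (φ := fun t w => ENNReal.ofReal (lyapunov B h₀ θ.ρ a b c
      (step B θ (fun i => (w i).1) (fun i => (w i).2) t))) hφ
  change ∫⁻ ω, ENNReal.ofReal (lyapunov B h₀ θ.ρ a b c
      (step B θ (fun i => ξ (k + 1) i ω) (fun i => ζ (k + 1) i ω) (s ω))) ∂P + _ ≤ _
  rw [h1, ← lintegral_add_right _ ?_]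
  · calc _ ≤ ∫⁻ ω, (ENNReal.ofReal (lyapunov B h₀ θ.ρ a b c (s ω)) +
          ENNReal.ofReal (noise Z0 σf σg1 σg2 θ.β θ.γ θ.ρ a b c / θ.batch)) ∂P := by
          refine lintegral_mono fun ω => ?_
          obtain ⟨i1, e1⟩ := hR.lyapunov_step (h₀ := h₀) hE (hS.iid (k + 1)) hN hθ (s ω)
          dsimp only
          rw [← ofReal_integral_eq_lintegral_ofReal i1 (.of_forall fun _ => hV0 _),
            ← ENNReal.ofReal_add (integral_nonneg fun _ => hV0 _) (by positivity),
            ← ENNReal.ofReal_add (hV0 _)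
              (div_nonneg (noise_nonneg _ _ _ hθ.a_nonneg hθ.b_nonneg hθ.c_nonneg)
                (Nat.cast_nonneg _))]
          exact ENNReal.ofReal_le_ofReal e1
      _ = _ := by rw [lintegral_add_right _ measurable_const]; simp [hs]
  · have h3 := (continuous_of_norm_sub_le hR.hyperGrad_lipschitz).measurable.comp
      (State.measurable_x.comp hsm)
    exact ((h3.norm.pow_const 2).const_mul _).ennreal_ofReal

theorem lintegral_lyapunov_add_sum_le (m : ℕ) :
    ∫⁻ ω, ENNReal.ofReal (lyapunov B h₀ θ.ρ a b c
        (run B θ I (fun j i => ξ j i ω) (fun j i => ζ j i ω) m)) ∂P +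
      ∑ k ∈ Finset.range m,
        ∫⁻ ω, ENNReal.ofReal (θ.α / 2 * ‖B.hyperGrad (iterate B θ I ξ ζ k ω)‖ ^ 2) ∂P ≤
    ∫⁻ ω, ENNReal.ofReal (lyapunov B h₀ θ.ρ a b c
        (run B θ I (fun j i => ξ j i ω) (fun j i => ζ j i ω) 0)) ∂P +
      m * ENNReal.ofReal (noise Z0 σf σg1 σg2 θ.β θ.γ θ.ρ a b c / θ.batch) := by
  induction m with
  | zero => simp
  | succ m ih =>
    have h := lintegral_lyapunov_succ_le hR hE hH hh hS hN hθ I m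
    rw [Finset.sum_range_succ, add_comm (∑ k ∈ Finset.range m, _), ← add_assoc]
    refine (add_le_add_left h _).trans ?_
    rw [add_right_comm]
    refine (add_le_add_left ih _).trans_eq ?_
    push_cast
    ring

omit hR hE hS hH hh hN hθ in
/-- A bound on the expectation of the Lyapunov function at the initialization. -/
def initBound (B : Problem X Y Ξ Z) (I : Init X Y) (h₀ σf σg2 a b c : ℝ) : ℝ :=
  B.H I.x - h₀ + a * ‖I.y - B.yStar I.x‖ ^ 2 + b * ‖I.z - B.zStar I.x‖ ^ 2 +
    c * ((‖I.vPrev - B.hyperGrad I.x‖ + ‖grad₁ B.f (pt I.xPrev I.yPrev) -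
      hess₁₂ B.g (pt I.xPrev I.yPrev) I.zPrev - B.hyperGrad I.x‖) ^ 2 +
      (2 * σf ^ 2 + 2 * (‖I.zPrev‖ ^ 2 * σg2 ^ 2)))

omit hR hE hS hH hN hθ in
include hh in
theorem initBound_nonneg (ha : 0 ≤ a) (hb : 0 ≤ b) (hc : 0 ≤ c) :
    0 ≤ initBound B I h₀ σf σg2 a b c := by
  have := sub_nonneg.2 (hh I.x)
  rw [initBound]; positivity

theorem integrable_and_sum_integral_le (K : ℕ) :
    (∀ k ∈ Finset.Icc 1 K,
      Integrable (fun ω => ‖B.hyperGrad (iterate B θ I ξ ζ k ω)‖ ^ 2) P) ∧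
    θ.α / 2 * ∑ k ∈ Finset.Icc 1 K, ∫ ω, ‖B.hyperGrad (iterate B θ I ξ ζ k ω)‖ ^ 2 ∂P ≤
      initBound B I h₀ σf σg2 a b c +
        (K + 1) * (noise Z0 σf σg1 σg2 θ.β θ.γ θ.ρ a b c / θ.batch) := by
  have hα := hθ.α_pos
  have hn : 0 ≤ noise Z0 σf σg1 σg2 θ.β θ.γ θ.ρ a b c / θ.batch :=
    div_nonneg (noise_nonneg _ _ _ hθ.a_nonneg hθ.b_nonneg hθ.c_nonneg) (Nat.cast_nonneg _)
  have hI0 := initBound_nonneg (σf := σf) (σg2 := σg2) hh I hθ.a_nonneg hθ.b_nonneg hθ.c_nonneg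
  obtain ⟨i0, e0⟩ := hR.lyapunov_init (h₀ := h₀) (a := a) (b := b) hE (hS.iid 0) hN hθ.ρ_pos.le
    hθ.ρ_le hθ.c_nonneg I
  have hV0 := lyapunov_nonneg (Z := Z) hh θ.ρ hθ.a_nonneg hθ.b_nonneg hθ.c_nonneg
  have h0 : ∫⁻ ω, ENNReal.ofReal (lyapunov B h₀ θ.ρ a b c
      (run B θ I (fun j i => ξ j i ω) (fun j i => ζ j i ω) 0)) ∂P ≤
      ENNReal.ofReal (initBound B I h₀ σf σg2 a b c) := by
    rw [show (fun ω => ENNReal.ofReal (lyapunov B h₀ θ.ρ a b c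
      (run B θ I (fun j i => ξ j i ω) (fun j i => ζ j i ω) 0))) = fun ω =>
      ENNReal.ofReal (lyapunov B h₀ θ.ρ a b c
      (initState B θ I (fun i => ξ 0 i ω) (fun i => ζ 0 i ω))) from rfl,
      ← ofReal_integral_eq_lintegral_ofReal i0 (.of_forall fun _ => hV0 _)]
    exact ENNReal.ofReal_le_ofReal e0
  have hsum : ∑ k ∈ Finset.Icc 1 K,
      ∫⁻ ω, ENNReal.ofReal (θ.α / 2 * ‖B.hyperGrad (iterate B θ I ξ ζ k ω)‖ ^ 2) ∂P ≤
      ENNReal.ofReal (initBound B I h₀ σf σg2 a b c +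
        (K + 1) * (noise Z0 σf σg1 σg2 θ.β θ.γ θ.ρ a b c / θ.batch)) := by
    -- The gradient at `x_K` appears only in the step from `K` to `K + 1`, so `K + 1` steps are
    -- summed, and the term `k = 0` is dropped.
    have h1 := lintegral_lyapunov_add_sum_le hR hE hH hh hS hN hθ I (K + 1)
    calc _ ≤ ∑ k ∈ Finset.range (K + 1),
          ∫⁻ ω, ENNReal.ofReal (θ.α / 2 * ‖B.hyperGrad (iterate B θ I ξ ζ k ω)‖ ^ 2) ∂P :=
          Finset.sum_le_sum_of_subset fun k hk => by
            simp only [Finset.mem_Icc, Finset.mem_range] at hk ⊢; omega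
      _ ≤ _ := le_add_self.trans (h1.trans (add_le_add_left h0 _))
      _ = _ := by
          rw [ENNReal.ofReal_add hI0 (by positivity), ENNReal.ofReal_mul (by positivity)]
          congr 2
          rw [← Nat.cast_succ, ENNReal.ofReal_natCast]
  have hmeas : ∀ k, AEStronglyMeasurable (fun ω =>
      ‖B.hyperGrad (iterate B θ I ξ ζ k ω)‖ ^ 2) P := fun k => by
    have hsm := measurable_run hE θ I k (fun j _ => hS.measurable_ξ j)
      (fun j _ => hS.measurable_ζ j)
    have h3 := (continuous_of_norm_sub_le hR.hyperGrad_lipschitz).measurable.comp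
      (State.measurable_x.comp hsm)
    exact (h3.norm.pow_const 2).aestronglyMeasurable
  have hint : ∀ k ∈ Finset.Icc 1 K, Integrable (fun ω =>
      θ.α / 2 * ‖B.hyperGrad (iterate B θ I ξ ζ k ω)‖ ^ 2) P := fun k hk => by
    refine ⟨(hmeas k).const_mul _, ?_⟩
    rw [hasFiniteIntegral_iff_ofReal (.of_forall fun ω => by positivity)]
    exact ((Finset.single_le_sum (f := fun k => ∫⁻ ω, ENNReal.ofReal (θ.α / 2 *
      ‖B.hyperGrad (iterate B θ I ξ ζ k ω)‖ ^ 2) ∂P) (fun _ _ => zero_le) hk).trans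
      hsum).trans_lt ENNReal.ofReal_lt_top
  refine ⟨fun k hk => ?_, ?_⟩
  · refine ((hint k hk).const_mul (θ.α / 2)⁻¹).congr (.of_forall fun ω => ?_)
    dsimp only
    rw [inv_mul_cancel_left₀ (by positivity)]
  · rw [← ENNReal.ofReal_le_ofReal_iff (by positivity)]
    refine le_of_eq_of_le ?_ hsum
    rw [Finset.mul_sum, ENNReal.ofReal_sum_of_nonneg fun k _ =>
      mul_nonneg (by positivity) (integral_nonneg fun ω => by positivity)]
    refine Finset.sum_congr rfl fun k hk => ?_
    rw [← integral_const_mul, ofReal_integral_eq_lintegral_ofReal (hint k hk)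
      (.of_forall fun ω => by positivity)]

omit hR hE hS hH hh hN hθ in
-- Two calls per sample index for `D₋₁`; then, in each iteration, two for `D`, one for the
-- `y`-direction and two for the `z`-direction.
theorem oracleCalls_eq (K : ℕ) (ω : Ω) :
    oracleCalls B θ I ξ ζ K ω = 2 * θ.batch + 5 * (θ.batch * K) := by
  rw [oracleCalls]
  induction K with
  | zero => simp [run, initState, dirX, miniBatch]; ring
  | succ K ih =>
    simp only [run, step, dirX, dirY, dirZ, miniBatch] at ih ⊢
    rw [ih]; ring

end Convergence

/-! ### Rate and sample complexity as functions of `K`. -/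

theorem exists_iterations {C p q ε : ℝ} (hC : 1 ≤ C) (hp : 0 ≤ p) (hq : 0 ≤ q)
    (hpq : q + 2 * p = 1) (hε : 0 < ε) (hε1 : ε ≤ 1) :
    ∃ K : ℕ, 1 < K ∧ C * (1 / (K : ℝ) ^ (1 - p) + 1 / (K : ℝ) ^ (p + q)) ≤ ε ∧
      2 * (⌈(K : ℝ) ^ q⌉₊ : ℝ) + 5 * (⌈(K : ℝ) ^ q⌉₊ * K) ≤ 224 * C ^ 2 * ε⁻¹ ^ 2 := by
  have hs : 0 < 1 - p := by linarith
  have hs1 : 1 - p ≤ 1 := by linarith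
  -- Both terms of the rate equal `K^{-(1-p)}`, so the target is `K^{1-p} ≥ A`. Here `p ≤ 1/2` makes
  -- the exponent positive, and `A ≥ 2` ensures `K > 1` and lets rounding up cost at most a factor
  -- `2`.
  set A := 2 * C / ε with hA
  have hA2 : 2 ≤ A := by rw [hA, le_div_iff₀ hε]; nlinarith
  have hA0 : 0 < A := by linarith
  have hAr : A ≤ A ^ (1 / (1 - p)) :=
    Real.self_le_rpow_of_one_le (by linarith) (by rw [le_div_iff₀ hs]; linarith)
  set K := ⌈A ^ (1 / (1 - p))⌉₊ with hK
  have hK1 : A ^ (1 / (1 - p)) ≤ K := Nat.le_ceil _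
  have hK2 : (2 : ℝ) ≤ K := by linarith
  have hK0 : (0 : ℝ) < K := by linarith
  have hKA : A ≤ (K : ℝ) ^ (1 - p) := by
    calc A = (A ^ (1 / (1 - p))) ^ (1 - p) := by
          rw [← Real.rpow_mul hA0.le, one_div_mul_cancel hs.ne', Real.rpow_one]
      _ ≤ _ := Real.rpow_le_rpow (by positivity) hK1 hs.le
  have hKA2 : (K : ℝ) ^ (1 - p) ≤ 2 * A := by
    have h1 : (K : ℝ) ≤ 2 * A ^ (1 / (1 - p)) := by
      have := Nat.ceil_lt_add_one (a := A ^ (1 / (1 - p))) (by positivity)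
      linarith
    calc (K : ℝ) ^ (1 - p) ≤ (2 * A ^ (1 / (1 - p))) ^ (1 - p) :=
          Real.rpow_le_rpow hK0.le h1 hs.le
      _ = 2 ^ (1 - p) * A := by
          rw [Real.mul_rpow (by norm_num) (by positivity), ← Real.rpow_mul hA0.le,
            one_div_mul_cancel hs.ne', Real.rpow_one]
      _ ≤ 2 * A := by
          gcongr
          simpa using Real.rpow_le_rpow_of_exponent_le (one_le_two (α := ℝ)) hs1
  refine ⟨K, by exact_mod_cast hK2, ?_, ?_⟩
  · have e : p + q = 1 - p := by linarith
    rw [e, ← add_div, mul_div_assoc', div_le_iff₀ (by positivity)]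
    calc C * (1 + 1) = ε * A := by rw [hA]; field_simp; ring
      _ ≤ _ := by gcongr
  · have hKq : 1 ≤ (K : ℝ) ^ q := Real.one_le_rpow (by linarith) hq
    have hSle : (⌈(K : ℝ) ^ q⌉₊ : ℝ) ≤ 2 * (K : ℝ) ^ q := by
      have := Nat.ceil_lt_add_one (a := (K : ℝ) ^ q) (by positivity)
      linarith
    -- This is `q + 1 = 2(1 - p)`; it makes the cost quadratic in `1/ε` for every admissible pair.
    have e : (K : ℝ) ^ q * K = ((K : ℝ) ^ (1 - p)) ^ 2 := by
      rw [← Real.rpow_add_one hK0.ne', ← Real.rpow_natCast, ← Real.rpow_mul hK0.le]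
      congr 1; push_cast; linarith
    have h1 : (⌈(K : ℝ) ^ q⌉₊ : ℝ) * K ≤ 8 * A ^ 2 := by
      calc (⌈(K : ℝ) ^ q⌉₊ : ℝ) * K ≤ 2 * (K : ℝ) ^ q * K := by gcongr
        _ = 2 * ((K : ℝ) ^ (1 - p)) ^ 2 := by rw [mul_assoc, e]
        _ ≤ 2 * (2 * A) ^ 2 := by gcongr
        _ = _ := by ring
    have h2 : (⌈(K : ℝ) ^ q⌉₊ : ℝ) ≤ ⌈(K : ℝ) ^ q⌉₊ * K :=
      le_mul_of_one_le_right (Nat.cast_nonneg _) (by linarith)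
    -- Here `2S + 5SK ≤ 7SK`, and `56A² = 224C²/ε²`.
    calc _ ≤ 7 * (8 * A ^ 2) := by linarith
      _ = _ := by rw [hA]; field_simp; ring

/-- The rate, from a bound on the sum of the squared gradients. -/
theorem average_le_rate {cα V n p q s : ℝ} {K : ℕ} (hcα : 0 < cα) (hV : 0 ≤ V) (hn : 0 ≤ n)
    (hK : 1 < K)
    (h : cα * (K : ℝ) ^ (-p) / 2 * s ≤
      V + (K + 1) * (((K : ℝ) ^ (-p)) ^ 2 * n / (⌈(K : ℝ) ^ q⌉₊ : ℝ))) :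
    1 / (K : ℝ) * s ≤ (2 * V / cα + 4 * n / cα + 1) *
      (1 / (K : ℝ) ^ (1 - p) + 1 / (K : ℝ) ^ (p + q)) := by
  have hK0 : (0 : ℝ) < K := by exact_mod_cast (by omega : 0 < K)
  have hK1 : (1 : ℝ) ≤ K := by exact_mod_cast hK.le
  obtain ⟨t, ht⟩ : ∃ t, t = (K : ℝ) ^ (-p) := ⟨_, rfl⟩
  have ht0 : 0 < t := by rw [ht]; positivity
  have e1 : 1 / (K : ℝ) ^ (1 - p) = 1 / (K * t) := by
    rw [ht, Real.rpow_sub hK0, Real.rpow_one, Real.rpow_neg hK0.le, div_eq_mul_inv (K : ℝ)]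
  have e2 : 1 / (K : ℝ) ^ (p + q) = t / (K : ℝ) ^ q := by
    rw [ht, Real.rpow_add hK0, Real.rpow_neg hK0.le]; field_simp
  rw [← ht] at h
  rw [e1, e2]
  have hKq : 0 < (K : ℝ) ^ q := by positivity
  have h1 : t ^ 2 * n / (⌈(K : ℝ) ^ q⌉₊ : ℝ) ≤ t ^ 2 * n / (K : ℝ) ^ q := by
    gcongr; exact Nat.le_ceil _
  have h2 : cα * t / 2 * s ≤ V + 2 * K * (t ^ 2 * n / (K : ℝ) ^ q) := by
    -- The surplus step is absorbed by `K + 1 ≤ 2K`.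
    refine h.trans ?_
    gcongr
    linarith
  have h3 : 1 / (K : ℝ) * s ≤ 2 * V / cα * (1 / (K * t)) + 4 * n / cα * (t / (K : ℝ) ^ q) := by
    have h4 : 1 / (K : ℝ) * s = 2 / (cα * t * K) * (cα * t / 2 * s) := by field_simp
    rw [h4]
    refine (mul_le_mul_of_nonneg_left h2 (by positivity)).trans_eq ?_
    field_simp
    ring
  refine h3.trans ?_
  have a1 : 0 ≤ 1 / (K * t) := by positivity
  have a2 : 0 ≤ t / (K : ℝ) ^ q := by positivity
  have a3 : 0 ≤ 2 * V / cα := by positivity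
  have a4 : 0 ≤ 4 * n / cα := by positivity
  nlinarith [mul_nonneg a3 a2, mul_nonneg a4 a1]

end

end Bilevel

/-! ### Proof of the theorem. -/

open Bilevel in
theorem mainTheorem5 (Lf L1g L2g : ℝ≥0) (Cf μ σf σg1 σg2 : ℝ)
    (hCf : 0 < Cf) (hμ : 0 < μ) (hσf : 0 < σf) (hσg1 : 0 < σg1) (hσg2 : 0 < σg2) :
    ∃ cα cβ cγ cρ : ℝ, 0 < cα ∧ 0 < cβ ∧ 0 < cγ ∧ 0 < cρ ∧
      ∀ (dx dy : ℕ) (Ξ Z Ω : Type*) [MeasurableSpace Ξ] [MeasurableSpace Z] [MeasurableSpace Ω]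
        (B : Problem (Vec dx) (Vec dy) Ξ Z) (P : Measure Ω) [IsProbabilityMeasure P]
        (ξ : ℕ → ℕ → Ω → Ξ) (ζ : ℕ → ℕ → Ω → Z) (I : Init (Vec dx) (Vec dy)),
        B.ExpectationForm → B.UpperLevel Lf Cf → B.LowerLevel L1g L2g μ →
        B.BoundedVariance σf σg1 σg2 → BddBelow (Set.range B.H) → IIDSamples B P ξ ζ →
        Differentiable ℝ B.H ∧
        ∃ C : ℝ, 0 < C ∧
          -- the convergence rate
          (∀ p q : ℝ, 0 ≤ p → 0 ≤ q → ∀ K : ℕ, 1 < K →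
            (∀ k ∈ Finset.Icc 1 K, Integrable (fun ω =>
              ‖gradient B.H (iterate B (params cα cβ cγ cρ p q K) I ξ ζ k ω)‖ ^ 2) P) ∧
            avgSqGrad B (params cα cβ cγ cρ p q K) I P ξ ζ K
              ≤ C * (1 / (K : ℝ) ^ (1 - p) + 1 / (K : ℝ) ^ (p + q))) ∧
          -- the sample complexity
          (∀ p q : ℝ, 0 ≤ p → 0 ≤ q → q + 2 * p = 1 → ∀ ε : ℝ, 0 < ε → ε ≤ 1 →
            ∃ K : ℕ, 1 < K ∧
              avgSqGrad B (params cα cβ cγ cρ p q K) I P ξ ζ K ≤ ε ∧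
              (∃ k ∈ Finset.Icc 1 K,
                IsStationary B P ε (iterate B (params cα cβ cγ cρ p q K) I ξ ζ k)) ∧
              ∀ ω, (oracleCalls B (params cα cβ cγ cρ p q K) I ξ ζ K ω : ℝ) ≤ C * ε⁻¹ ^ 2) := by
  obtain ⟨cα, cβ, cγ, a, b, c, hcα, hcβ, hcγ, hstep⟩ :=
    exists_stepSizes L1g (Lf + L2g * (Cf / μ)) (L1g / μ)
      ((Lf + L2g * (Cf / μ)) * (1 + L1g / μ) / μ)
      ((Lf + L2g * (Cf / μ)) * (1 + L1g / μ) +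
        L1g * ((Lf + L2g * (Cf / μ)) * (1 + L1g / μ) / μ)) σg2 hμ
      (Q := (Lf + L2g * (Cf / μ)) * (1 + L1g / μ) ^ 2) (by positivity)
  refine ⟨cα, cβ, cγ, 1, hcα, hcβ, hcγ, one_pos, ?_⟩
  intro dx dy Ξ Z Ω _ _ _ B P _ ξ ζ I hE hU hL hV ⟨h₀, hh₀⟩ hS
  have hR := Problem.regularity hE hU hL hV hμ
  have hH := Problem.differentiable_H hU hL hμ
  have hgrad := Problem.gradient_H hU hL hμ
  have hh : ∀ x, h₀ ≤ B.H x := fun x => hh₀ ⟨x, rfl⟩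
  -- The instance `t = 1` supplies the signs of the weights, which do not depend on `t`.
  have h1 := hstep 1 one_pos le_rfl
  set V := initBound B I h₀ σf σg2 a b c with hVdef
  set n := noise (Cf / μ) σf σg1 σg2 cβ cγ 1 a b c with hndef
  have hV0 : 0 ≤ V := initBound_nonneg hh I h1.a_nonneg h1.b_nonneg h1.c_nonneg
  have hn0 : 0 ≤ n := noise_nonneg _ _ _ h1.a_nonneg h1.b_nonneg h1.c_nonneg
  set C₀ := 2 * V / cα + 4 * n / cα + 1 with hC₀
  have hC₀1 : 1 ≤ C₀ := le_add_of_nonneg_left (by positivity)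
  have hrate : ∀ p q : ℝ, 0 ≤ p → 0 ≤ q → ∀ K : ℕ, 1 < K →
      (∀ k ∈ Finset.Icc 1 K, Integrable (fun ω =>
        ‖gradient B.H (iterate B (params cα cβ cγ 1 p q K) I ξ ζ k ω)‖ ^ 2) P) ∧
      avgSqGrad B (params cα cβ cγ 1 p q K) I P ξ ζ K
        ≤ C₀ * (1 / (K : ℝ) ^ (1 - p) + 1 / (K : ℝ) ^ (p + q)) := by
    intro p q hp hq K hK
    have hK1 : (1 : ℝ) ≤ K := by exact_mod_cast hK.le
    have hK0 : (0 : ℝ) < K := by linarith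
    set t := (K : ℝ) ^ (-p) with ht
    have ht0 : 0 < t := Real.rpow_pos_of_pos hK0 _
    have ht1 : t ≤ 1 := Real.rpow_le_one_of_one_le_of_nonpos hK1 (by linarith)
    have hN : 0 < (params cα cβ cγ 1 p q K).batch := Nat.ceil_pos.2 (Real.rpow_pos_of_pos hK0 q)
    have hθ := hstep t ht0 ht1
    -- Matches `ρ = cρ t` with `cρ = 1`; the first three occurrences, in `α`, `β` and `γ`, are then
    -- restored.
    rw [← one_mul t] at hθ
    nth_rewrite 1 2 3 [one_mul t] at hθ
    obtain ⟨hint, hsum⟩ := integrable_and_sum_integral_le (θ := params cα cβ cγ 1 p q K)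
      hR hE hH hh hS hN hθ I K
    rw [avgSqGrad, hgrad]
    refine ⟨hint, average_le_rate (q := q) hcα hV0 hn0 hK (hsum.trans_eq ?_)⟩
    -- The noise is homogeneous of degree two in the step sizes, so `n` is free of `K`, `p`, `q`.
    have e : noise (Cf / μ) σf σg1 σg2 (cβ * t) (cγ * t) (1 * t) a b c = t ^ 2 * n := by
      rw [hndef, noise, noise]; ring
    rw [← e]
    rfl
  -- One constant serves both parts: `C₀` for the rate, `224 C₀²` for the number of calls.
  refine ⟨hH, C₀ + 224 * C₀ ^ 2, by positivity, fun p q hp hq K hK => ?_,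
    fun p q hp hq hpq ε hε hε1 => ?_⟩
  · obtain ⟨hint, hle⟩ := hrate p q hp hq K hK
    refine ⟨hint, hle.trans ?_⟩
    gcongr
    exact le_add_of_nonneg_right (by positivity)
  · obtain ⟨K, hK, hKε, hcalls⟩ := exists_iterations hC₀1 hp hq hpq hε hε1
    obtain ⟨hint, hle⟩ := hrate p q hp hq K hK
    have havg := hle.trans hKε
    refine ⟨K, hK, havg, ?_, fun ω => ?_⟩
    · have hK0 : (0 : ℝ) < K := by exact_mod_cast (by omega : 0 < K)
      rw [avgSqGrad, one_div, inv_mul_le_iff₀ hK0] at havg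
      obtain ⟨k, hk, hkε⟩ := Finset.exists_le_of_sum_le (s := Finset.Icc 1 K)
        (Finset.nonempty_Icc.2 hK.le) (g := fun _ => ε) (havg.trans_eq (by simp))
      exact ⟨k, hk, hint k hk, hkε⟩
    · rw [oracleCalls_eq]
      push_cast
      refine hcalls.trans ?_
      gcongr
      linarith
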